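/- **Conventions.** An $r$-graph on a vertex set $V$ is identified with its edge set; $K_n^r$ is the complete $r$-graph on $[n]$. For a hypergraph $E$ and a vertex set $U$, $E(U)$ is the set of edges containing $U$; $\Delta_t(E)=\max_{|U|=t}|E(U)|$; $E^{(i)}$ is the set of edges of size $i$; for an $r$-graph, $\Delta(G):=\Delta_{r-1}(G)$. Let $q>r\ge 1$. A clique is a copy of $K_q^r$ (a set of $\binom qr$ edges). For a family $\mathcal F$ of cliques, $V(\bigcup\mathcal F)$ is the set of vertices it spans. A packing is a family of pairwise edge-disjoint cliques; a decomposition of $G$ is a packing whose union is $G$. $G$ is $K_q^r$-divisible if $\binom{q-i}{r-i}$ divides $|G(S)|$ for all $0\le i\le r-1$ and $|S|=i$. **Girth.** A $(j,i)$-configuration is a set of $i$ cliques spanning at most $j$ vertices. The girth of a packing is the least $i\ge2$ such that it contains an $(i(q-r)+r,i)$-configuration ($\infty$ if none). The rooted girth of a packing $\mathcal P$ at a vertex set $S$ is the least $i\ge1$ such that some $i$ members $\mathcal P'\subseteq\mathcal P$ satisfy $|V(\bigcup\mathcal P')\setminus S|<(q-r)i$ ($\infty$ if none). An $(i(q-r)+r,i)$-configuration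 is Erdős if it contains no $(i'(q-r)+r,i')$-configuration with $2\le i'<i$. **Treasuries.** A treasury $T=(G_1,G_2,H)$ consists of hypergraphs $G_1$, $G_2$, where the parts of $G_2$ are $P=V(G_1)\cap V(G_2)$ and $R=V(G_2)\setminus V(G_1)$, and a hypergraph $H$ with $E(G_1)\cup E(G_2)\subseteq V(H)$. It is $(D,\sigma,\beta,\alpha)$-regular (with respect to $g$) if: (i) every vertex of $G_1$ has degree at most $D$ in $G_1$, and every vertex of $P$ has degree at least $D-\sigma$ in $G_1$; (ii) every vertex of $R$ has degree at most $D$ in $G_2$, every vertex of $P$ has degree at least $D^{1-\alpha}$ in $G_2$, and $\Delta_1(H^{(i)})\le\alpha D^{i-1}\log D$ for $2\le i\le g$; (iii) $\Delta_2(G_1\cup G_2)\le D^{1-\beta}$; $\Delta_t(H^{(s)})\le D^{s-t-\beta}$ for $2\le t<s\le g$; for every vertex $v$ and edge $e\not\ni v$ of $G_1\cup G_2$, at most $D^{1-\beta}$ edges of $H^{(2)}$ contain $e$ and an edge of $G_1\cup G_2$ through $v$; and for all distinct disjoint $u,v\in V(H)$, $|\{w\in V(H):\{u,w\},\{v,w\}\in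 H^{(2)}\}|\le D^{1-\beta}$. For $X,G'\subseteq G$, $\mathrm{Treasury}_q^g(G,G',X)=(G_1,G_2,H)$, where $V(G_1)=G'\setminus X$ and $E(G_1)$ is the set of cliques in $G'\setminus X$; $V(G_2)=G'\cup X$ and $E(G_2)$ is the set of cliques in $G'\cup X$ with exactly one edge in $G'\setminus X$; $V(H)$ is the set of cliques in $G$ and $E(H)$ is the set of Erdős $(i(q-r)+r,i)$-configurations of $G$ with $3\le i\le g$. For a set $\mathcal M$ of subsets of $V(H)$, the common projection $T\perp\mathcal M=(G_1',G_2',H')$ has $V(G_i')=V(G_i)$, $E(G_i')=E(G_i)\cap V(H')$, $V(H')=V(H)\setminus\{v:\exists S\in E(H),M\in\mathcal M,\ v\in S\setminus M,\ S\setminus\{v\}\subseteq M\}$ and $E(H')=\{F\subseteq V(H'):\exists S\in E(H),M\in\mathcal M,\ F\subseteq S,\ F\cap M=\emptyset,\ S\setminus F\subseteq M\}$. **Sponges.** $(G,A,X,\mathcal H)$ is a $K_q^r$-sponge if $X\subseteq G$ and $A\subseteq G\setminus X$ are $r$-graphs on the same vertex set and $A$ is a $K_q^r$-omni-absorber for $X$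 with decomposition family $\mathcal H$: every $F\in\mathcal H$ is a clique contained in $X\cup A$ with $|F\cap X|\le1$, and for every $K_q^r$-divisible $L\subseteq X$ some subfamily of $\mathcal H$ is a decomposition of $L\cup A$. With $N$ the number of vertices, it is $(\alpha,g)$-regular if $\mathrm{Treasury}_q^g(G,G\setminus A,X)$ is $\left(\binom N{q-r},\alpha\binom N{q-r},\frac1{2g(q-r)},\alpha\right)$-regular; $b$-bounded if $\Delta(X)\le N/\log^bN$; and $C$-refined if every $e\in X\cup A$ lies in at most $C$ members of $\mathcal H$ and $\Delta(A)\le C\max\{\Delta(X),N^{1-1/r}\log N\}$. **Boosters.** A rooted $K_q^r$-booster with root a clique $S$ is an $r$-graph $B$ edge-disjoint from $S$, with $V(S)\subseteq V(B)$, together with disjoint families $B_{\rm off}$, a decomposition of $B$, and $B_{\rm on}$, a decomposition of $B\cup S$ with $S\notin B_{\rm on}$. Its rooted girth is the minimum of the girth of $B_{\rm on}$, the girth of $B_{\rm off}\cup\{S\}$, and the rooted girth of $B_{\rm on}$ at $V(S)$. A quantum omni-booster collection for a sponge is a family $\mathcal B=(\mathcal B_F:F\in\mathcal H)$ in which $\mathcal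 B_F$ is a set of rooted boosters in $G\setminus(X\cup A)$ with root $F$. Its matching set $\mathcal M(\mathcal B)$ is the set of all packings in $G$ obtained by choosing for each $F\in\mathcal H$ one of $B_{\rm on},B_{\rm off}$ for one $B\in\mathcal B_F$ and taking the union. Its girth-$g$ projection treasury is $\mathrm{Treasury}_q^g(G,G\setminus A,X)\perp\mathcal M(\mathcal B)$. For a rooted booster $B_0$, $\mathcal B\in\mathrm{Full}_{B_0}(G,A,X)$ means that each $\mathcal B_F$ consists of exactly one copy of $B_0$ in $G\setminus(X\cup A)$ with root $F$ and vertices in $V(F)\cup S$, for each set $S$ of $v(B_0)-q$ vertices for which such a copy exists. The random $p$-sparsification $\mathcal B_p$ retains each element of each $\mathcal B_F$ independently with probability $p$. **Lemma.** For all integers $q>r\ge1$, $C\ge1$, $g\ge3$, all real $\alpha\in\left(0,\frac1{2(q-r)}\right)$ and every rooted $K_q^r$-booster $B_0$ of rooted girth at least $g$, there is an integer $a_2\ge1$ such that for every integer $a\ge a_2$ there is an integer $n_2\ge1$ such that the following holds for all $n\ge n_2$. Let $(K_n^r,A,X,\mathcal H)$ be an $(\alpha,g)$-regular, $ga$-bounded,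 $C$-refined $K_q^r$-sponge, let $\mathcal B\in\mathrm{Full}_{B_0}(K_n^r,A,X)$ and let $p:=\log^an\big/\binom n{v(B_0)-q}$. Then $p\in[0,1]$, and with probability at least $0.9$ the girth-$g$ projection treasury of $\mathcal B_p$ is $$\left(\binom n{q-r},\ 2\alpha\binom n{q-r},\ \frac1{4g(q-r)},\ 2\alpha\right)\text{-regular}.$$ -/

import Mathlib

/-!
All `r`-graphs `G`, `X`, `A`, ... live on a common vertex set (a type `V`, which is `Fin n` in the
theorem) and are identified with their edge sets, of type `Set (Set V)`. A copy of `K_q^r` is such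
an edge set, and a family of copies of `K_q^r` has type `Set (Set (Set V))`.
Every vertex type in use is finite, so `Set.ncard` is the true cardinality.
-/

namespace HighGirth

variable {V W α : Type*}

/-! ### Degrees -/

/-- `|E(U)|`, the number of edges that contain the vertex set `U`. -/
noncomputable def codegree (E : Set (Set α)) (U : Set α) : ℕ :=
  {e ∈ E | U ⊆ e}.ncard

/-- `Δ_t(E)`, the maximum of `|E(U)|` over vertex sets `U` of size `t`. -/
noncomputable def maxCodegree (E : Set (Set α)) (t : ℕ) : ℕ :=
  ⨆ U : {U : Set α // U.encard = t}, codegree E U.1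

/-- `Δ(G) = Δ_{r-1}(G)`, the maximum degree of an `r`-graph. -/
noncomputable def maxDegree (r : ℕ) (G : Set (Set V)) : ℕ :=
  maxCodegree G (r - 1)

/-! ### Cliques, packings and configurations -/

/-- The complete `r`-graph on the vertex set `Q`. -/
def complete (r : ℕ) (Q : Set V) : Set (Set V) :=
  {e | e ⊆ Q ∧ e.encard = r}

/-- `K` is a copy of `K_q^r`. -/
def IsClique (q r : ℕ) (K : Set (Set V)) : Prop :=
  ∃ Q : Set V, Q.encard = q ∧ K = complete r Q

/-- The set of vertices spanned by a family of `r`-graphs. -/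
def spanned (F : Set (Set (Set V))) : Set V := ⋃₀ ⋃₀ F

/-- `F` is a `K_q^r` decomposition of the `r`-graph `G`. -/
def IsDecomposition (q r : ℕ) (F : Set (Set (Set V))) (G : Set (Set V)) : Prop :=
  (∀ K ∈ F, IsClique q r K) ∧ F.PairwiseDisjoint id ∧ ⋃₀ F = G

/-- `G` is `K_q^r`-divisible. -/
def IsDivisible (q r : ℕ) (G : Set (Set V)) : Prop :=
  ∀ i < r, ∀ S : Set V, S.encard = i → (q - i).choose (r - i) ∣ codegree G S

/-- A family of cliques is a `(j, i)`-configuration: `i` cliques spanning at most `j` vertices. -/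
def IsConfiguration (j i : ℕ) (F : Set (Set (Set V))) : Prop :=
  F.encard = i ∧ (spanned F).encard ≤ j

/-- `F` is an `(i(q-r)+r, i)` Erdős-configuration. -/
def IsErdosConfiguration (q r i : ℕ) (F : Set (Set (Set V))) : Prop :=
  IsConfiguration (i * (q - r) + r) i F ∧
    ∀ i', 2 ≤ i' → i' < i → ∀ F' ⊆ F, ¬ IsConfiguration (i' * (q - r) + r) i' F'

/-- The girth of a `K_q^r` packing (`⊤` if there is no short configuration at all). -/
noncomputable def packingGirth (q r : ℕ) (F : Set (Set (Set V))) : ℕ∞ :=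
  ⨅ (i : ℕ) (_ : 2 ≤ i ∧ ∃ F' ⊆ F, IsConfiguration (i * (q - r) + r) i F'), (i : ℕ∞)

/-- The rooted girth of a `K_q^r` packing at a vertex set `S`. -/
noncomputable def packingRootedGirth (q r : ℕ) (F : Set (Set (Set V))) (S : Set V) : ℕ∞ :=
  ⨅ (i : ℕ) (_ : 1 ≤ i ∧ ∃ F' ⊆ F, F'.encard = i ∧
    (spanned F' \ S).encard < ((q - r) * i : ℕ)), (i : ℕ∞)

/-! ### Design, reserve and girth hypergraphs -/

/-- `Design_{K_q^r}(G)`: vertices are the edges of `G`, edges are the copies of `K_q^r` in `G`. -/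
def design (q r : ℕ) (G : Set (Set V)) : Hypergraph (Set V) where
  vertexSet := G
  edgeSet := {S | S ⊆ G ∧ IsClique q r S}
  subset_vertexSet_of_mem_edgeSet' _ he := he.1

/-- `Reserve_{K_q^r}(G, A, B)` (which depends on `G ⊇ A ∪ B` only through `A` and `B`): the copies
of `K_q^r` in `A ∪ B` that have exactly one edge in `A`. -/
def reserve (q r : ℕ) (A B : Set (Set V)) : Hypergraph (Set V) where
  vertexSet := A ∪ B
  edgeSet := {S | S ⊆ A ∪ B ∧ IsClique q r S ∧ (S ∩ A).encard = 1}
  subset_vertexSet_of_mem_edgeSet' _ he := he.1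

/-- `Girth_{K_q^r}^g(G)`: vertices are the copies of `K_q^r` in `G`, edges are the
Erdős-configurations of size `i` for `3 ≤ i ≤ g`. -/
def girthHypergraph (q r g : ℕ) (G : Set (Set V)) : Hypergraph (Set (Set V)) where
  vertexSet := (design q r G).edgeSet
  edgeSet := {S | S ⊆ (design q r G).edgeSet ∧
    ∃ i, 3 ≤ i ∧ i ≤ g ∧ IsErdosConfiguration q r i S}
  subset_vertexSet_of_mem_edgeSet' _ he := he.1

/-! ### Treasuries -/

/-- The data `(G₁, G₂, H)` of a treasury. The vertices of `H` are sets of vertices of `G₁ ∪ G₂`,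
and the parts of the bipartite hypergraph `G₂` are `V(G₁) ∩ V(G₂)` and `V(G₂) \ V(G₁)`. -/
structure Treasury (α : Type*) where
  G₁ : Hypergraph α
  G₂ : Hypergraph α
  H : Hypergraph (Set α)

namespace Treasury

/-- `E(G₁ ∪ G₂)`. -/
def edges (T : Treasury α) : Set (Set α) := T.G₁.edgeSet ∪ T.G₂.edgeSet

/-- `E(H^{(i)})`, the edges of `H` of size `i`. -/
def level (T : Treasury α) (i : ℕ) : Set (Set (Set α)) := {S ∈ T.H.edgeSet | S.encard = i}

/-- `T`, as an `(r', g)`-treasury for some `r'`, is `(D, σ, β, a)`-regular. -/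
structure IsRegular (T : Treasury α) (g : ℕ) (D σ β a : ℝ) : Prop where
  degree_le : ∀ v ∈ T.G₁.vertexSet, (codegree T.G₁.edgeSet {v} : ℝ) ≤ D
  le_degree : ∀ v ∈ T.G₁.vertexSet ∩ T.G₂.vertexSet, D - σ ≤ codegree T.G₁.edgeSet {v}
  reserve_degree_le : ∀ v ∈ T.G₂.vertexSet \ T.G₁.vertexSet,
    (codegree T.G₂.edgeSet {v} : ℝ) ≤ D
  le_reserve_degree : ∀ v ∈ T.G₁.vertexSet ∩ T.G₂.vertexSet,
    D ^ (1 - a) ≤ codegree T.G₂.edgeSet {v}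
  config_degree_le : ∀ i : ℕ, 2 ≤ i → i ≤ g →
    (maxCodegree (T.level i) 1 : ℝ) ≤ a * D ^ (i - 1) * Real.log D
  codegree_le : (maxCodegree T.edges 2 : ℝ) ≤ D ^ (1 - β)
  config_codegree_le : ∀ t s : ℕ, 2 ≤ t → t < s → s ≤ g →
    (maxCodegree (T.level s) t : ℝ) ≤ D ^ ((s : ℝ) - t - β)
  two_codegree_le : ∀ v ∈ T.G₁.vertexSet ∪ T.G₂.vertexSet, ∀ e ∈ T.edges, v ∉ e →
    ({S ∈ T.level 2 | e ∈ S ∧ ∃ f ∈ S, f ∈ T.edges ∧ v ∈ f}.ncard : ℝ) ≤ D ^ (1 - β)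
  common_two_degree_le : ∀ u ∈ T.H.vertexSet, ∀ v ∈ T.H.vertexSet, u ≠ v → Disjoint u v →
    ({w ∈ T.H.vertexSet | {u, w} ∈ T.level 2 ∧ {v, w} ∈ T.level 2}.ncard : ℝ) ≤ D ^ (1 - β)

/-- The vertices of `H` that survive in the common projection of `T` by `𝓜`. -/
def projVertices (T : Treasury α) (𝓜 : Set (Set (Set α))) : Set (Set α) :=
  T.H.vertexSet \ {v | ∃ S ∈ T.H.edgeSet, ∃ M ∈ 𝓜, v ∈ S ∧ v ∉ M ∧ S \ {v} ⊆ M}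

/-- The common projection `T ⊥ 𝓜`. -/
def proj (T : Treasury α) (𝓜 : Set (Set (Set α))) : Treasury α where
  G₁ :=
    { vertexSet := T.G₁.vertexSet
      edgeSet := T.G₁.edgeSet ∩ T.projVertices 𝓜
      subset_vertexSet_of_mem_edgeSet' := fun _ he =>
        T.G₁.subset_vertexSet_of_mem_edgeSet' he.1 }
  G₂ :=
    { vertexSet := T.G₂.vertexSet
      edgeSet := T.G₂.edgeSet ∩ T.projVertices 𝓜
      subset_vertexSet_of_mem_edgeSet' := fun _ he =>
        T.G₂.subset_vertexSet_of_mem_edgeSet' he.1 }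
  H :=
    { vertexSet := T.projVertices 𝓜
      edgeSet := {F | F ⊆ T.projVertices 𝓜 ∧
        ∃ S ∈ T.H.edgeSet, ∃ M ∈ 𝓜, F ⊆ S ∧ F ∩ M = ∅ ∧ S \ F ⊆ M}
      subset_vertexSet_of_mem_edgeSet' := fun _ he => he.1 }

end Treasury

/-- `Treasury_q^g(G, G', X)`, the girth-`g` design treasury of `G` on `G'` with reserve `X`. -/
def designTreasury (q r g : ℕ) (G G' X : Set (Set V)) : Treasury (Set V) where
  G₁ := design q r (G' \ X)
  G₂ := reserve q r (G' \ X) X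
  H := girthHypergraph q r g G

/-! ### Omni-absorbers and sponges -/

/-- `A` is a `K_q^r`-omni-absorber for `X` with decomposition family `𝓗` and decomposition
function `𝒬`. -/
structure IsOmniAbsorber (q r : ℕ) (X A : Set (Set V)) (𝓗 : Set (Set (Set V)))
    (𝒬 : Set (Set V) → Set (Set (Set V))) : Prop where
  disjoint : Disjoint X A
  isClique : ∀ H ∈ 𝓗, IsClique q r H ∧ H ⊆ X ∪ A
  inter_le : ∀ H ∈ 𝓗, (H ∩ X).encard ≤ 1
  decomp : ∀ L ⊆ X, IsDivisible q r L → 𝒬 L ⊆ 𝓗 ∧ IsDecomposition q r (𝒬 L) (L ∪ A)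

/-- `(G, A, X, 𝓗)` is a `K_q^r`-sponge. -/
def IsSponge (q r : ℕ) (G A X : Set (Set V)) (𝓗 : Set (Set (Set V))) : Prop :=
  (∀ e ∈ G, e.encard = r) ∧ X ⊆ G ∧ A ⊆ G \ X ∧ ∃ 𝒬, IsOmniAbsorber q r X A 𝓗 𝒬

/-- The sponge `(G, A, X)` is `(a, g)`-regular. -/
def IsSpongeRegular (q r : ℕ) (G A X : Set (Set V)) (a : ℝ) (g : ℕ) : Prop :=
  (designTreasury q r g G (G \ A) X).IsRegular g
    ((Nat.card V).choose (q - r)) (a * (Nat.card V).choose (q - r))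
    (1 / (2 * g * ((q : ℝ) - r))) a

/-- A sponge with reserve `X` is `a`-bounded. -/
def IsSpongeBounded (r : ℕ) (X : Set (Set V)) (a : ℕ) : Prop :=
  (maxDegree r X : ℝ) ≤ Nat.card V / Real.log (Nat.card V) ^ a

/-- The sponge `(G, A, X, 𝓗)` is `C`-refined. -/
def IsSpongeRefined (r : ℕ) (A X : Set (Set V)) (𝓗 : Set (Set (Set V))) (C : ℝ) : Prop :=
  (∀ e ∈ X ∪ A, ({H ∈ 𝓗 | e ∈ H}.ncard : ℝ) ≤ C) ∧
    (maxDegree r A : ℝ) ≤ C * max (maxDegree r X : ℝ)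
      ((Nat.card V : ℝ) ^ (1 - 1 / (r : ℝ)) * Real.log (Nat.card V))

/-! ### Rooted boosters -/

/-- The data of a rooted booster: the hypergraph `B` (its vertex set, which includes the vertices
of the root, and its edges), the root, and the two packings `𝓑_off` and `𝓑_on`. -/
structure RootedBooster (V : Type*) where
  verts : Set V
  edges : Set (Set V)
  root : Set (Set V)
  off : Set (Set (Set V))
  on : Set (Set (Set V))

namespace RootedBooster

/-- `B` is a rooted `K_q^r`-booster. -/
structure IsRootedBooster (q r : ℕ) (B : RootedBooster V) : Prop where
  edges_subset : ⋃₀ B.edges ⊆ B.verts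
  root_subset : ⋃₀ B.root ⊆ B.verts
  isClique_root : IsClique q r B.root
  disjoint_root : Disjoint B.edges B.root
  off_decomp : IsDecomposition q r B.off B.edges
  on_decomp : IsDecomposition q r B.on (B.edges ∪ B.root)
  off_disjoint_on : Disjoint B.off B.on
  root_notMem_on : B.root ∉ B.on

/-- The rooted girth of a rooted booster. -/
noncomputable def rootedGirth (q r : ℕ) (B : RootedBooster V) : ℕ∞ :=
  min (min (packingGirth q r B.on) (packingGirth q r (B.off ∪ {B.root})))
    (packingRootedGirth q r B.on (⋃₀ B.root))

/-- The image of a rooted booster under a map of vertices. -/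
def map (φ : W → V) (B : RootedBooster W) : RootedBooster V where
  verts := φ '' B.verts
  edges := Set.image φ '' B.edges
  root := Set.image φ '' B.root
  off := Set.image (Set.image φ) '' B.off
  on := Set.image (Set.image φ) '' B.on

/-- `B` is a copy of `B₀`. -/
def IsCopy (B₀ : RootedBooster W) (B : RootedBooster V) : Prop :=
  ∃ φ : W → V, Set.InjOn φ B₀.verts ∧ B = B₀.map φ

/-- `B` is a copy of `B₀` in `G \ (X ∪ A)` rooted at `H`. -/
def IsCopyAt (B₀ : RootedBooster W) (G A X H : Set (Set V)) (B : RootedBooster V) : Prop :=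
  B₀.IsCopy B ∧ B.root = H ∧ B.edges ⊆ G \ (X ∪ A)

end RootedBooster

/-! ### Quantum omni-boosters

A quantum booster collection `(𝓑_H : H ∈ 𝓗)` is a function `𝓑` from copies of `K_q^r` to sets of
rooted boosters, of which only the values at `H ∈ 𝓗` matter. -/

/-- `𝓑` is the collection of a quantum `K_q^r`-omni-booster for `A` and `X` in `G`. -/
def IsQuantumOmniBooster (q r : ℕ) (G A X : Set (Set V)) (𝓗 : Set (Set (Set V)))
    (𝓑 : Set (Set V) → Set (RootedBooster V)) : Prop :=
  ∀ H ∈ 𝓗, ∀ B ∈ 𝓑 H, B.IsRootedBooster q r ∧ B.root = H ∧ B.edges ⊆ G \ (X ∪ A)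

/-- The matching set `𝓜(𝓑)`: choose, for every `H ∈ 𝓗`, one of the packings `B_on`, `B_off` of
one `B ∈ 𝓑_H`, and take the union of the choices whenever it is a matching of
`Design_{K_q^r}(G)`. -/
def matchingSet (q r : ℕ) (G : Set (Set V)) (𝓗 : Set (Set (Set V)))
    (𝓑 : Set (Set V) → Set (RootedBooster V)) : Set (Set (Set (Set V))) :=
  {M | (∃ c : Set (Set V) → Set (Set (Set V)),
      (∀ H ∈ 𝓗, ∃ B ∈ 𝓑 H, c H = B.on ∨ c H = B.off) ∧ M = ⋃ H ∈ 𝓗, c H) ∧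
    M ⊆ (design q r G).edgeSet ∧ M.PairwiseDisjoint id}

/-- The girth-`g` projection treasury `Proj_g(B, A, G, X)` of a quantum omni-booster. -/
def projTreasury (q r g : ℕ) (G A X : Set (Set V)) (𝓗 : Set (Set (Set V)))
    (𝓑 : Set (Set V) → Set (RootedBooster V)) : Treasury (Set V) :=
  (designTreasury q r g G (G \ A) X).proj (matchingSet q r G 𝓗 𝓑)

/-- `𝒮(H)`: the sets `S` of `v(B₀) - q` vertices such that some copy of `B₀` in `G \ (X ∪ A)` rooted
at `H` has its vertices in `V(H) ∪ S`. -/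
def slots (q : ℕ) (B₀ : RootedBooster W) (G A X H : Set (Set V)) : Set (Set V) :=
  {S | S.encard = (B₀.verts.ncard - q : ℕ) ∧
    ∃ B : RootedBooster V, B₀.IsCopyAt G A X H B ∧ B.verts ⊆ ⋃₀ H ∪ S}

/-- `𝓑 ∈ Full_{B₀}(G, A, X)`: each `𝓑_H` consists of exactly one copy of `B₀` in `G \ (X ∪ A)`
rooted at `H` with vertices in `V(H) ∪ S` for each `S ∈ 𝒮(H)`. (Every copy rooted at `H` belongs
to exactly one `S`, its set of non-root vertices.) -/
def IsFull (q r : ℕ) (B₀ : RootedBooster W) (G A X : Set (Set V)) (𝓗 : Set (Set (Set V)))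
    (𝓑 : Set (Set V) → Set (RootedBooster V)) : Prop :=
  IsQuantumOmniBooster q r G A X 𝓗 𝓑 ∧
    ∀ H ∈ 𝓗, (∀ B ∈ 𝓑 H, B₀.IsCopyAt G A X H B) ∧
      ∀ S ∈ slots q B₀ G A X H, ∃! B, B ∈ 𝓑 H ∧ B.verts ⊆ ⋃₀ H ∪ S

/-- The collection `((𝓑_H) ∩ ω : H ∈ 𝓗)`. -/
def restrict (𝓑 : Set (Set V) → Set (RootedBooster V)) (ω : Set (RootedBooster V)) :
    Set (Set V) → Set (RootedBooster V) :=
  fun H => 𝓑 H ∩ ω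

/-- The law of the set `ω` of retained boosters in the random `p`-sparsification: each element of
`⋃_{H ∈ 𝓗} 𝓑_H` is retained independently with probability `p`. (Boosters for different `H` have
different roots, so this union is disjoint.) The sparsification is `restrict 𝓑 ω`. -/
noncomputable def sparsification (𝓗 : Set (Set (Set V)))
    (𝓑 : Set (Set V) → Set (RootedBooster V)) (p : unitInterval) :
    MeasureTheory.Measure (Set (RootedBooster V)) :=
  ProbabilityTheory.setBernoulli (⋃ H ∈ 𝓗, 𝓑 H) p

end HighGirth

open HighGirth

/-!
The sparsification is typical because every quantity that has to be bounded is at most a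
polynomial of bounded degree in the indicators of the retained boosters, and all its expected partial derivatives
are small.

*Tail bound.* Let `𝓔` be a family of structures, each of which is present if at most `m` given
boosters are retained. If for every set `A` of boosters the expected number of members of `𝓔` that
are present, given that the boosters of `A` are retained and counting only those that use all of
`A`, is at most `M`, then the `t`-th moment of the number of present structures is at most
`(m + 1) ^ t * (t * m + 1) ^ (m * t) * M ^ t`. With `t` of order `log n`, Markov's inequality and a union
bound over polynomially many families give `O(log n) ^ m * M` for all of them at once
(`measure_exists_monomialCount_le`).

*Which structures.* An edge of the projection treasury is a set `F` of cliques which is completed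
to an Erdős configuration `S` by parts `P_b` of `B_on` or `B_off`, for some retained boosters `b`
(`IsExtension`, `exists_isExtension`); a clique `K` is removed if `{K}` is completed in this way.
So removed cliques and degrees, codegrees and common neighbourhoods in the projection are all
bounded by the number of present pairs consisting of the set of boosters `b` and of `F`.

*Expectations.* Such pairs are counted by choosing the boosters and then the cliques one after the
other. A step is worth `n ^ stepExp`, up to a power of `log n`, where the exponent depends only on
how the new object meets the vertices known before it: a booster whose root has `s < r` known
vertices is one of about `n ^ (r - s)`, there are boundedly many if `s ≥ r`, and each further known
vertex costs a factor `n`, while `p * n ^ k` is polylogarithmic if boosters have `k` vertices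
outside the root (`BoosterFamily.stepBounds`). The rooted girth gives `P_b` at least
`|P_b| * (q - r)` vertices outside the root, and the Erdős property says that a proper subset `Z` of `S` with at
least two members spans more than `|Z| * (q - r) + r` vertices. Comparing the two
(`listExp_boosters_le`, `IsExtension.hasOrder`) shows that the count never exceeds that of the
cliques in a configuration, and that it loses a factor `n` as soon as the known objects include a
nontrivial proper part of `S`.

*The remaining case.* A factor `n` need not be lost when only one clique is known in advance. But
then either the first booster can be chosen such that its root has fewer than `r` known vertices,
and the sparsity `log n ^ (-g * a)` of the reserve and the absorber outweighs the at most `g - 1`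
factors `log n ^ a` of the boosters (`hasSparseOrder_or_hasOrder`), or this clique together with
the part of one booster is a proper part of `S`. For a removed clique `K` (so `|F| = 1`) the part
can be all that is left; there it is used that `K` meets the roots in at most one edge
(`card_rootVerts_inter_le`). Common neighbourhoods need an ordering of two configurations at once
(`hasOrder_common`).

The deviations are thus smaller than the main terms by a factor of at least `log n` for degrees,
and by nearly a factor `n` for everything else, which `regularity_estimates` turns into the claimed
regularity.
-/

namespace HighGirth

noncomputable section Proof
open MeasureTheory ProbabilityTheory
open scoped Classical

/-! ### Upper tails of polynomials in independent indicators -/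

section Tail
variable {β ε : Type*}

lemma setBernoulli_superset (u : Set β) (p : unitInterval) (I : Finset β) (hI : ↑I ⊆ u) :
    setBernoulli u p {ω | (↑I : Set β) ⊆ ω} = ENNReal.ofReal p ^ I.card := by
  have h : (fun P : β → Prop => {i | P i}) ⁻¹' {ω | (↑I : Set β) ⊆ ω}
      = cylinder I ({fun _ => True} : Set (∀ _ : I, Prop)) := by
    ext P
    simp [cylinder, Set.subset_def, funext_iff]
  rw [setBernoulli_apply', h, Measure.infinitePi_cylinder _ (by simp), Measure.pi_singleton]
  have : ∀ i ∈ I, i ∈ u := fun i hi => hI hi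
  rw [Finset.prod_congr rfl (g := fun _ => ENNReal.ofReal p)]
  · simp
  · rintro ⟨i, hi⟩ -
    simp only [this i hi]
    simp [ENNReal.ofReal]
    exact NNReal.eq (by simp [p.2.1])

lemma measurableSet_superset (I : Finset β) :
    MeasurableSet {ω : Set β | (↑I : Set β) ⊆ ω} := by
  have : {ω : Set β | (↑I : Set β) ⊆ ω} = ⋂ i ∈ I, {ω | i ∈ ω} := by
    ext; simp [Set.subset_def]
  rw [this]
  exact Finset.measurableSet_biInter _ fun i _ => measurableSet_setOfPred.2 (by fun_prop)

lemma card_powerset_card_le (A : Finset β) (m N : ℕ) (hA : A.card ≤ N) :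
    (A.powerset.filter fun A' => A'.card ≤ m).card ≤ (m + 1) * (N + 1) ^ m := by
  have h : (A.powerset.filter fun A' => A'.card ≤ m) ⊆
      (Finset.range (m + 1)).biUnion fun k => A.powersetCard k := by
    intro A' hA'
    simp only [Finset.mem_filter, Finset.mem_powerset] at hA'
    simp only [Finset.mem_biUnion, Finset.mem_range, Finset.mem_powersetCard]
    exact ⟨_, by omega, hA'.1, rfl⟩
  refine (Finset.card_le_card h).trans (Finset.card_biUnion_le.trans ?_)
  calc ∑ k ∈ Finset.range (m + 1), (A.powersetCard k).card
      ≤ ∑ k ∈ Finset.range (m + 1), (N + 1) ^ m := by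
        refine Finset.sum_le_sum fun k hk => ?_
        rw [Finset.card_powersetCard]
        refine (Nat.choose_le_pow _ _).trans ?_
        exact (Nat.pow_le_pow_left (by omega) _).trans
          (Nat.pow_le_pow_right (by omega) (by simpa [Nat.lt_succ_iff] using hk))
    _ = _ := by simp

/-- Once the variables in `A` are fixed, the monomials are grouped by the variables that they share
with `A`, and each group is bounded by a partial derivative. -/
lemma sum_pow_card_sdiff_le (𝓔 : Finset ε) (I : ε → Finset β) {p M : ℝ} {m : ℕ} (hp : 0 ≤ p)
    (hm : ∀ e ∈ 𝓔, (I e).card ≤ m)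
    (hM : ∀ A, ∑ e ∈ 𝓔 with A ⊆ I e, p ^ (I e \ A).card ≤ M)
    (A : Finset β) (N : ℕ) (hA : A.card ≤ N) :
    ∑ e ∈ 𝓔, p ^ (I e \ A).card ≤ ((m + 1) * (N + 1) ^ m : ℕ) * M := by
  have hM0 : 0 ≤ M := (Finset.sum_nonneg fun e _ => by positivity).trans (hM ∅)
  rw [← Finset.sum_fiberwise_of_maps_to (t := A.powerset.filter fun A' => A'.card ≤ m)
    (g := fun e => I e ∩ A)]
  · calc _ ≤ ∑ A' ∈ A.powerset.filter fun A' => A'.card ≤ m, M := by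
          refine Finset.sum_le_sum fun A' _ => (le_trans ?_ (hM A'))
          calc _ = ∑ e ∈ 𝓔 with I e ∩ A = A', p ^ (I e \ A').card := by
                refine Finset.sum_congr rfl fun e he => ?_
                rw [← (Finset.mem_filter.1 he).2, Finset.sdiff_inter_self_left]
            _ ≤ _ := by
                refine Finset.sum_le_sum_of_subset_of_nonneg ?_ fun _ _ _ => by positivity
                intro e he
                simp only [Finset.mem_filter] at he ⊢
                exact ⟨he.1, he.2 ▸ Finset.inter_subset_left⟩
      _ ≤ _ := by
          rw [Finset.sum_const, nsmul_eq_mul]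
          gcongr
          exact card_powerset_card_le A m N hA
  · intro e he
    simp only [Finset.mem_filter, Finset.mem_powerset]
    exact ⟨Finset.inter_subset_right,
      (Finset.card_le_card Finset.inter_subset_left).trans (hm e he)⟩

/-- The number of monomials of a polynomial in indicators that are present in `ω`. -/
def monomialCount (𝓔 : Finset ε) (I : ε → Finset β) (ω : Set β) : ℕ :=
  (𝓔.filter fun e => (↑(I e) : Set β) ⊆ ω).card

lemma monomialCount_eq_sum (𝓔 : Finset ε) (I : ε → Finset β) (ω : Set β) :
    (monomialCount 𝓔 I ω : ENNReal) =
      ∑ e ∈ 𝓔, {ω : Set β | (↑(I e) : Set β) ⊆ ω}.indicator 1 ω := by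
  simp [monomialCount, Finset.sum_boole, Set.indicator_apply]

lemma measurable_monomialCount (𝓔 : Finset ε) (I : ε → Finset β) :
    Measurable fun ω => (monomialCount 𝓔 I ω : ENNReal) := by
  simp_rw [monomialCount_eq_sum]
  exact Finset.measurable_sum _ fun e _ => measurable_one.indicator (measurableSet_superset _)

/-- The moments of a polynomial in indicators are bounded by its expected partial derivatives:
every further factor is averaged with the indicators of the earlier factors held fixed. -/
lemma lintegral_monomialCount_pow_le (u : Set β) (p : unitInterval)
    (𝓔 : Finset ε) (I : ε → Finset β) {M : ℝ} {m N : ℕ}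
    (hI : ∀ e ∈ 𝓔, ↑(I e) ⊆ u) (hm : ∀ e ∈ 𝓔, (I e).card ≤ m)
    (hM : ∀ A, ∑ e ∈ 𝓔 with A ⊆ I e, (p : ℝ) ^ (I e \ A).card ≤ M)
    (t : ℕ) (A : Finset β) (hAu : ↑A ⊆ u) (hA : A.card + t * m ≤ N) :
    ∫⁻ ω in {ω | (↑A : Set β) ⊆ ω}, (monomialCount 𝓔 I ω : ENNReal) ^ t ∂setBernoulli u p ≤
      ENNReal.ofReal p ^ A.card * ENNReal.ofReal (((m + 1) * (N + 1) ^ m : ℕ) * M) ^ t := by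
  induction t generalizing A with
  | zero =>
    simp [setBernoulli_superset u p A hAu]
  | succ t ih =>
    have hAN : A.card ≤ N := by nlinarith
    have key : ∀ e ∈ 𝓔, ∫⁻ ω in {ω | (↑A : Set β) ⊆ ω}, (monomialCount 𝓔 I ω : ENNReal) ^ t *
        {ω : Set β | (↑(I e) : Set β) ⊆ ω}.indicator 1 ω ∂setBernoulli u p ≤
        ENNReal.ofReal p ^ A.card * ENNReal.ofReal (((m + 1) * (N + 1) ^ m : ℕ) * M) ^ t *
          ENNReal.ofReal (p ^ (I e \ A).card) := by
      intro e he
      have h1 : ∀ ω, (monomialCount 𝓔 I ω : ENNReal) ^ t *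
          {ω : Set β | (↑(I e) : Set β) ⊆ ω}.indicator 1 ω =
          {ω : Set β | (↑(I e) : Set β) ⊆ ω}.indicator
            (fun ω => (monomialCount 𝓔 I ω : ENNReal) ^ t) ω := by
        intro ω
        by_cases h : (↑(I e) : Set β) ⊆ ω <;> simp [h]
      simp_rw [h1]
      rw [setLIntegral_indicator (measurableSet_superset _)]
      have h2 : {ω : Set β | (↑(I e) : Set β) ⊆ ω} ∩ {ω | (↑A : Set β) ⊆ ω} =
          {ω | (↑(A ∪ I e) : Set β) ⊆ ω} := by
        ext ω; simp [and_comm]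
      rw [h2]
      refine (ih (A ∪ I e) (by simp [hAu, hI e he]) ?_).trans_eq ?_
      · have := Finset.card_union_le A (I e)
        have := hm e he
        nlinarith
      · rw [ENNReal.ofReal_pow p.2.1, ← Finset.union_sdiff_self_eq_union,
          Finset.card_union_of_disjoint Finset.disjoint_sdiff, pow_add]
        ring
    calc _ = ∑ e ∈ 𝓔, ∫⁻ ω in {ω | (↑A : Set β) ⊆ ω}, (monomialCount 𝓔 I ω : ENNReal) ^ t *
        {ω : Set β | (↑(I e) : Set β) ⊆ ω}.indicator 1 ω ∂setBernoulli u p := by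
          rw [← lintegral_finsetSum]
          · simp_rw [← Finset.mul_sum, ← monomialCount_eq_sum, pow_succ]
          · intro e _
            exact ((measurable_monomialCount 𝓔 I).pow_const t).mul
              (measurable_one.indicator (measurableSet_superset _))
      _ ≤ _ := Finset.sum_le_sum key
      _ ≤ _ := by
          rw [← Finset.mul_sum, ← ENNReal.ofReal_sum_of_nonneg
            (fun _ _ => pow_nonneg p.2.1 _), mul_assoc, pow_succ]
          gcongr
          exact sum_pow_card_sdiff_le 𝓔 I p.2.1 hm hM A N hAN

/-- Markov's inequality for the `t`-th moment. -/
lemma measure_monomialCount_le (u : Set β) (p : unitInterval)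
    (𝓔 : Finset ε) (I : ε → Finset β) {M : ℝ} {m : ℕ}
    (hI : ∀ e ∈ 𝓔, ↑(I e) ⊆ u) (hm : ∀ e ∈ 𝓔, (I e).card ≤ m) (hM0 : 0 < M)
    (hM : ∀ A, ∑ e ∈ 𝓔 with A ⊆ I e, (p : ℝ) ^ (I e \ A).card ≤ M) (t : ℕ) :
    setBernoulli u p
      {ω | 2 * ((m + 1) * (t * m + 1) ^ m : ℕ) * M ≤ (monomialCount 𝓔 I ω : ℝ)} ≤ 2⁻¹ ^ t := by
  set K : ℝ := ((m + 1) * (t * m + 1) ^ m : ℕ) * M with hK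
  have hK0 : 0 < K := by positivity
  have h0 := lintegral_monomialCount_pow_le u p 𝓔 I (N := t * m) hI hm hM t ∅ (by simp) (by simp)
  simp only [Finset.coe_empty, Set.empty_subset, Set.ofPred_true, Measure.restrict_univ,
    Finset.card_empty, pow_zero, one_mul] at h0
  rw [← hK] at h0
  have h1 := mul_meas_ge_le_lintegral₀ (μ := setBernoulli u p)
    ((measurable_monomialCount 𝓔 I).pow_const t).aemeasurable (ENNReal.ofReal (2 * K) ^ t)
  have h2 : {ω | 2 * ((m + 1) * (t * m + 1) ^ m : ℕ) * M ≤ (monomialCount 𝓔 I ω : ℝ)} ⊆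
      {ω | ENNReal.ofReal (2 * K) ^ t ≤ (monomialCount 𝓔 I ω : ENNReal) ^ t} := by
    intro ω hω
    simp only [Set.mem_ofPred_eq] at hω ⊢
    gcongr
    rw [← ENNReal.ofReal_natCast]
    exact ENNReal.ofReal_le_ofReal (by rw [hK]; linarith)
  refine (measure_mono h2).trans ?_
  have h5 := h1.trans h0
  have h6 : ENNReal.ofReal K ^ t ≠ 0 := by simp [hK0]
  have h7 : ENNReal.ofReal K ^ t ≠ ⊤ := by simp
  generalize setBernoulli u p {ω | ENNReal.ofReal (2 * K) ^ t ≤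
    (monomialCount 𝓔 I ω : ENNReal) ^ t} = x at h5 ⊢
  rw [ENNReal.ofReal_mul (by norm_num), mul_pow, mul_right_comm] at h5
  have h8 := (ENNReal.le_div_iff_mul_le (Or.inl h6) (Or.inl h7)).2 h5
  rw [ENNReal.div_self h6 h7] at h8
  rw [← ENNReal.inv_pow, ENNReal.le_inv_iff_mul_le, mul_comm]
  simpa using h8

lemma measurableSet_le_monomialCount (𝓔 : Finset ε) (I : ε → Finset β) (x : ℝ) :
    MeasurableSet {ω | x ≤ (monomialCount 𝓔 I ω : ℝ)} := by
  have : Measurable fun ω => (monomialCount 𝓔 I ω : ℝ) := by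
    simpa using (measurable_monomialCount 𝓔 I).ennreal_toReal
  exact measurableSet_le measurable_const this

/-- Simultaneous upper bounds for a family of polynomials, given by a union bound. -/
lemma measure_exists_monomialCount_le {ι : Type*} (u : Set β) (p : unitInterval) (T : Finset ι)
    (𝓔 : ι → Finset ε) (I : ε → Finset β) (M : ι → ℝ) {m : ℕ}
    (hI : ∀ τ ∈ T, ∀ e ∈ 𝓔 τ, ↑(I e) ⊆ u) (hm : ∀ τ ∈ T, ∀ e ∈ 𝓔 τ, (I e).card ≤ m)
    (hM0 : ∀ τ ∈ T, 0 < M τ)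
    (hM : ∀ τ ∈ T, ∀ A, ∑ e ∈ 𝓔 τ with A ⊆ I e, (p : ℝ) ^ (I e \ A).card ≤ M τ) (t : ℕ) :
    (setBernoulli u p).real (⋃ τ ∈ T, {ω | 2 * ((m + 1) * (t * m + 1) ^ m : ℕ) * M τ ≤
      (monomialCount (𝓔 τ) I ω : ℝ)}) ≤ T.card * 2⁻¹ ^ t := by
  refine (measureReal_biUnion_finset_le _ _).trans ?_
  rw [← nsmul_eq_mul]
  refine Finset.sum_le_card_nsmul _ _ _ fun τ hτ => ?_
  have := measure_monomialCount_le u p (𝓔 τ) I (hI τ hτ) (hm τ hτ) (hM0 τ hτ) (hM τ hτ) t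
  rw [Measure.real]
  refine (ENNReal.toReal_mono (by simp) this).trans (by simp)

end Tail

/-! ### Vertex counts for sequences of boosters and cliques -/

section Exponents
variable {V : Type*} [Fintype V]

/-- The vertex set of an `r`-graph without isolated vertices, as a finset. -/
def cliqueVerts (K : Set (Set V)) : Finset V := (⋃₀ K).toFinset

/-- The vertices spanned by a family of cliques. -/
def spanVerts (S : Finset (Set (Set V))) : Finset V := S.biUnion cliqueVerts

/-- The vertices of the root of a booster. -/
def rootVerts (b : RootedBooster V) : Finset V := cliqueVerts b.root

/-- The vertices of a booster, those of its root included. -/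
def boosterVerts (b : RootedBooster V) : Finset V := b.verts.toFinset

/-- A structure is counted by choosing boosters and cliques one after the other. -/
abbrev Step (V : Type*) := RootedBooster V ⊕ Set (Set V)

/-- The vertices that are known once a step is made. -/
def stepVerts : Step V → Finset V
  | .inl b => boosterVerts b
  | .inr K => cliqueVerts K

/-- `n ^ stepExp r σ Y` is, up to powers of `log n`, the expected number of steps that meet the
known vertex set `Y` in the same way as `σ`. For a booster, there are about `n ^ (r - s)` roots
with `s` prescribed vertices if `s ≤ r` and a bounded number of them if `s ≥ r`, and every further
prescribed vertex costs a factor `n`. -/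
def stepExp (r : ℕ) : Step V → Finset V → ℤ
  | .inl b, Y => ((r - (rootVerts b ∩ Y).card : ℕ) : ℤ) - ((boosterVerts b ∩ Y) \ rootVerts b).card
  | .inr K, Y => (cliqueVerts K \ Y).card

/-- The exponent of the expected number of sequences of steps of the given kind, if the vertex set
`Y` is known at the beginning. -/
def listExp (r : ℕ) : List (Step V) → Finset V → ℤ
  | [], _ => 0
  | σ :: l, Y => stepExp r σ Y + listExp r l (Y ∪ stepVerts σ)

/-- The vertices that are known at the end of a sequence of steps. -/
def reach (l : List (Step V)) (Y : Finset V) : Finset V :=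
  l.foldl (fun Y σ => Y ∪ stepVerts σ) Y

lemma stepVerts_inl (b : RootedBooster V) : stepVerts (.inl b) = boosterVerts b := rfl

lemma reach_cons (σ : Step V) (l : List (Step V)) (Y : Finset V) :
    reach (σ :: l) Y = reach l (Y ∪ stepVerts σ) := rfl

lemma listExp_append (r : ℕ) (l₁ l₂ : List (Step V)) (Y : Finset V) :
    listExp r (l₁ ++ l₂) Y = listExp r l₁ Y + listExp r l₂ (reach l₁ Y) := by
  induction l₁ generalizing Y with
  | nil => simp [listExp, reach]
  | cons σ l ih => simp [listExp, ih, reach, add_assoc]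

lemma subset_reach (l : List (Step V)) (Y : Finset V) : Y ⊆ reach l Y := by
  induction l generalizing Y with
  | nil => simp [reach]
  | cons σ l ih => exact Finset.subset_union_left.trans (ih _)

lemma stepVerts_subset_reach {l : List (Step V)} {σ : Step V} (hσ : σ ∈ l) (Y : Finset V) :
    stepVerts σ ⊆ reach l Y := by
  induction l generalizing Y with
  | nil => simp at hσ
  | cons σ' l ih =>
    rcases List.mem_cons.1 hσ with rfl | h
    · exact Finset.subset_union_right.trans (subset_reach l _)
    · exact ih h _

lemma spanVerts_mono {S T : Finset (Set (Set V))} (h : S ⊆ T) : spanVerts S ⊆ spanVerts T :=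
  Finset.biUnion_subset_biUnion_of_subset_left _ h

lemma cliqueVerts_subset_spanVerts {S : Finset (Set (Set V))} {K : Set (Set V)} (h : K ∈ S) :
    cliqueVerts K ⊆ spanVerts S := Finset.subset_biUnion_of_mem _ h

lemma spanVerts_union (S T : Finset (Set (Set V))) :
    spanVerts (S ∪ T) = spanVerts S ∪ spanVerts T := by
  ext; simp [spanVerts, or_and_right, exists_or]

lemma spanVerts_singleton (K : Set (Set V)) : spanVerts {K} = cliqueVerts K := by
  simp [spanVerts]

lemma listExp_cliques (r : ℕ) (l : List (Set (Set V))) (Y : Finset V) :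
    listExp r (l.map Sum.inr) Y = (spanVerts l.toFinset \ Y).card := by
  induction l generalizing Y with
  | nil => simp [listExp, spanVerts]
  | cons K l ih =>
    simp only [List.map_cons, listExp, stepExp, ih, stepVerts]
    rw [← Nat.cast_add, ← Finset.card_union_of_disjoint]
    · congr 2
      ext x
      simp [spanVerts]
      tauto
    · rw [Finset.disjoint_left]
      intro x
      simp
      tauto

/-- If a booster carries a set `W` of vertices, its exponent is made up for by the number of its
vertices in `V₀ ⊇ W` that become known, up to `j * d`. -/
lemma stepExp_booster_le {r d j : ℕ} {b : RootedBooster V} {W V₀ Y : Finset V}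
    (hWb : W ⊆ boosterVerts b) (hWV : W ⊆ V₀) (hW : j * d + r ≤ W.card)
    (h : (rootVerts b ∩ Y).card ≤ r ∨ j * d ≤ (W \ rootVerts b).card) :
    stepExp r (.inl b) Y + (V₀ \ (Y ∪ boosterVerts b)).card + j * d ≤ (V₀ \ Y).card := by
  have h1 : (V₀ \ Y).card = (V₀ \ (Y ∪ boosterVerts b)).card + ((V₀ ∩ boosterVerts b) \ Y).card := by
    rw [← Finset.card_union_of_disjoint]
    · congr 1; ext x; simp; tauto
    · rw [Finset.disjoint_left]; intro x; simp; tauto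
  have h2 : (W \ Y).card ≤ ((V₀ ∩ boosterVerts b) \ Y).card := Finset.card_le_card fun x => by
    simp only [Finset.mem_sdiff, Finset.mem_inter]
    exact fun hx => ⟨⟨hWV hx.1, hWb hx.1⟩, hx.2⟩
  have h3 : ((W ∩ Y) \ rootVerts b).card ≤ ((boosterVerts b ∩ Y) \ rootVerts b).card :=
    Finset.card_le_card fun x => by
      simp only [Finset.mem_sdiff, Finset.mem_inter]
      exact fun hx => ⟨⟨hWb hx.1.1, hx.1.2⟩, hx.2⟩
  have h4 : W.card ≤ (W \ Y).card + ((W ∩ Y) \ rootVerts b).card + (rootVerts b ∩ Y).card := by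
    refine (Finset.card_le_card (t := (W \ Y ∪ (W ∩ Y) \ rootVerts b) ∪ (rootVerts b ∩ Y))
      fun x hx => ?_).trans ((Finset.card_union_le _ _).trans ?_)
    · simp [hx]; tauto
    · gcongr; exact Finset.card_union_le _ _
  have h5 : (W \ rootVerts b).card ≤ (W \ Y).card + ((W ∩ Y) \ rootVerts b).card := by
    refine (Finset.card_le_card (t := (W \ Y ∪ (W ∩ Y) \ rootVerts b))
      fun x hx => ?_).trans ((Finset.card_union_le _ _))
    simp at hx ⊢; tauto
  simp only [stepExp]
  have h6 : ((j * d : ℕ) : ℤ) = j * d := by push_cast; rfl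
  generalize j * d = jd at *
  omega

/-- The step estimate gains a factor `n` if a known vertex of the booster lies outside `V₀`. -/
lemma stepExp_booster_lt {r d j : ℕ} {b : RootedBooster V} {W V₀ Y : Finset V} {x : V}
    (hWb : W ⊆ boosterVerts b) (hWV : W ⊆ V₀) (hW : j * d + r ≤ W.card)
    (h : (rootVerts b ∩ Y).card ≤ r) (hxY : x ∈ Y) (hxb : x ∈ boosterVerts b) (hxV : x ∉ V₀) :
    stepExp r (.inl b) Y + (V₀ \ (Y ∪ boosterVerts b)).card + j * d + 1 ≤ (V₀ \ Y).card := by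
  have h1 : (V₀ \ Y).card = (V₀ \ (Y ∪ boosterVerts b)).card + ((V₀ ∩ boosterVerts b) \ Y).card := by
    rw [← Finset.card_union_of_disjoint]
    · congr 1; ext x; simp; tauto
    · rw [Finset.disjoint_left]; intro x; simp; tauto
  have h2 : (W \ Y).card ≤ ((V₀ ∩ boosterVerts b) \ Y).card := Finset.card_le_card fun x => by
    simp only [Finset.mem_sdiff, Finset.mem_inter]
    exact fun hx => ⟨⟨hWV hx.1, hWb hx.1⟩, hx.2⟩
  have hxW : x ∉ W := fun h => hxV (hWV h)
  have h3 : (insert x W).card ≤ (W \ Y).card + ((boosterVerts b ∩ Y) \ rootVerts b).card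
      + (rootVerts b ∩ Y).card := by
    refine (Finset.card_le_card (t := (W \ Y ∪ (boosterVerts b ∩ Y) \ rootVerts b) ∪
      (rootVerts b ∩ Y)) fun y hy => ?_).trans ((Finset.card_union_le _ _).trans ?_)
    · rcases Finset.mem_insert.1 hy with rfl | hy
      · simp [hxY, hxb]; tauto
      · simp [hy, hWb hy]; tauto
    · gcongr; exact Finset.card_union_le _ _
  rw [Finset.card_insert_of_notMem hxW] at h3
  simp only [stepExp]
  have h6 : ((j * d : ℕ) : ℤ) = j * d := by push_cast; rfl
  generalize j * d = jd at *
  omega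

/-- A sequence of boosters uses up its exponent and the sizes of its parts by making vertices of
`V₀` known. -/
lemma listExp_boosters_le {r d : ℕ} (P : RootedBooster V → Finset (Set (Set V))) {V₀ : Finset V}
    (l : List (RootedBooster V)) (Y : Finset V)
    (hb : ∀ b ∈ l, spanVerts (P b) ⊆ boosterVerts b) (hV : ∀ b ∈ l, spanVerts (P b) ⊆ V₀)
    (hP : ∀ b ∈ l, (P b).card * d + r ≤ (spanVerts (P b)).card)
    (h : ∀ b ∈ l, (P b).card * d ≤ (spanVerts (P b) \ rootVerts b).card) :
    listExp r (l.map Sum.inl) Y + (V₀ \ reach (l.map Sum.inl) Y).card +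
      (l.map fun b => (P b).card).sum * d ≤ (V₀ \ Y).card := by
  induction l generalizing Y with
  | nil => simp [listExp, reach]
  | cons b l ih =>
    simp only [List.mem_cons, forall_eq_or_imp] at hb hV hP h
    have h1 := ih (Y ∪ boosterVerts b) hb.2 hV.2 hP.2 h.2
    have h2 := stepExp_booster_le (Y := Y) hb.1 hV.1 hP.1 (Or.inr h.1)
    simp only [List.map_cons, listExp, List.sum_cons, reach, List.foldl_cons, stepVerts] at h1 ⊢
    push_cast at h1 h2 ⊢
    linarith

end Exponents

/-! ### Erdős configurations that are completed by boosters -/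

lemma nodup_map_append {V : Type*} {l : List (RootedBooster V)} {m : List (Set (Set V))}
    (hl : l.Nodup) (hm : m.Nodup) : (l.map Sum.inl ++ m.map Sum.inr : List (Step V)).Nodup := by
  refine List.Nodup.append (hl.map Sum.inl_injective) (hm.map Sum.inr_injective) ?_
  intro x hx hy
  simp only [List.mem_map] at hx hy
  obtain ⟨b, -, rfl⟩ := hx
  obtain ⟨c, -, hc⟩ := hy
  cases hc

lemma toFinset_map_append {V : Type*} (l : List (RootedBooster V)) (m : List (Set (Set V))) :
    (l.map Sum.inl ++ m.map Sum.inr : List (Step V)).toFinset =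
      l.toFinset.disjSum m.toFinset := by
  ext x
  cases x <;> simp

section Extensions
variable {V : Type*} [Fintype V]

/-- `S` is an Erdős configuration of `K_{r+d}^r`s that consists of the family `F` and of nonempty
parts `P b` of the packings of boosters `b ∈ I`. The last two fields are what is needed to know
about `P b`: the booster contains it, and it has large rooted girth. -/
structure IsExtension (d r g : ℕ) (I : Finset (RootedBooster V)) (F S : Finset (Set (Set V)))
    (P : RootedBooster V → Finset (Set (Set V))) : Prop where
  three_le : 3 ≤ S.card
  card_le : S.card ≤ g
  card_cliqueVerts : ∀ K ∈ S, (cliqueVerts K).card = d + r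
  span_le : (spanVerts S).card ≤ S.card * d + r
  lt_span : ∀ Z ⊆ S, 2 ≤ Z.card → Z.card < S.card → Z.card * d + r < (spanVerts Z).card
  subset : F ⊆ S
  sdiff_eq : S \ F = I.biUnion P
  disjoint : (I : Set (RootedBooster V)).PairwiseDisjoint P
  nonempty : ∀ b ∈ I, (P b).Nonempty
  span_subset : ∀ b ∈ I, spanVerts (P b) ⊆ boosterVerts b
  rooted_girth : ∀ b ∈ I, (P b).card + 1 < g →
    (P b).card * d ≤ (spanVerts (P b) \ rootVerts b).card

variable {d r g : ℕ} {I : Finset (RootedBooster V)} {F S : Finset (Set (Set V))}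
    {P : RootedBooster V → Finset (Set (Set V))}

namespace IsExtension

lemma part_subset (h : IsExtension d r g I F S P) {A : Finset (RootedBooster V)} (hA : A ⊆ I) :
    A.biUnion P ⊆ S \ F :=
  h.sdiff_eq ▸ Finset.biUnion_subset_biUnion_of_subset_left _ hA

lemma card_part (h : IsExtension d r g I F S P) {A : Finset (RootedBooster V)} (hA : A ⊆ I) :
    (A.biUnion P).card = ∑ b ∈ A, (P b).card :=
  Finset.card_biUnion fun _ hx _ hy hxy => h.disjoint (hA hx) (hA hy) hxy

lemma card_eq (h : IsExtension d r g I F S P) : S.card = F.card + ∑ b ∈ I, (P b).card := by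
  rw [← h.card_part subset_rfl, ← h.sdiff_eq, Finset.card_sdiff_of_subset h.subset]
  have := Finset.card_le_card h.subset
  omega

lemma le_span (h : IsExtension d r g I F S P) {Z : Finset (Set (Set V))} (hZ : Z ⊆ S)
    (hne : Z.Nonempty) (hlt : Z.card < S.card) : Z.card * d + r ≤ (spanVerts Z).card := by
  rcases Nat.lt_or_ge Z.card 2 with h2 | h2
  · obtain ⟨K, rfl⟩ := Finset.card_eq_one.1 (by have := hne.card_pos; omega : Z.card = 1)
    have := h.card_cliqueVerts K (hZ (by simp))
    simp [spanVerts_singleton, this]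
  · exact (h.lt_span Z hZ h2 hlt).le

/-- A part of the configuration is proper, as it does not contain `F`. -/
lemma le_span_part (h : IsExtension d r g I F S P) (hF : F.Nonempty) {b : RootedBooster V}
    (hb : b ∈ I) : (P b).card * d + r ≤ (spanVerts (P b)).card := by
  refine h.le_span ?_ (h.nonempty b hb) ?_
  · have := h.part_subset (A := {b}) (by simpa)
    simp only [Finset.singleton_biUnion] at this
    exact this.trans Finset.sdiff_subset
  · have := h.card_eq
    have := Finset.single_le_sum (f := fun b => (P b).card) (fun _ _ => Nat.zero_le _) hb
    have := hF.card_pos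
    omega

lemma span_part_subset (h : IsExtension d r g I F S P) {b : RootedBooster V} (hb : b ∈ I) :
    spanVerts (P b) ⊆ spanVerts S := by
  have := h.part_subset (A := {b}) (by simpa)
  simp only [Finset.singleton_biUnion] at this
  exact spanVerts_mono (this.trans Finset.sdiff_subset)

lemma span_union_subset (h : IsExtension d r g I F S P) {A : Finset (RootedBooster V)}
    (hA : A ⊆ I) {U : Finset (Set (Set V))} {Y : Finset V} (hU : spanVerts U ⊆ Y)
    (hAY : A.biUnion boosterVerts ⊆ Y) : spanVerts (U ∪ A.biUnion P) ⊆ Y := by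
  rw [spanVerts_union]
  refine Finset.union_subset hU (Finset.Subset.trans ?_ hAY)
  intro x hx
  simp only [spanVerts, Finset.mem_biUnion] at hx ⊢
  obtain ⟨K, ⟨b, hb, hK⟩, hx⟩ := hx
  exact ⟨b, hb, h.span_subset b (hA hb) (cliqueVerts_subset_spanVerts hK hx)⟩

lemma card_union_part (h : IsExtension d r g I F S P) {A : Finset (RootedBooster V)}
    (hA : A ⊆ I) {U : Finset (Set (Set V))} (hU : U ⊆ F) :
    (U ∪ A.biUnion P).card = U.card + ∑ b ∈ A, (P b).card := by
  rw [← h.card_part hA, Finset.card_union_of_disjoint]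
  rw [Finset.disjoint_left]
  intro K hK hK'
  exact (Finset.mem_sdiff.1 (h.part_subset hA hK')).2 (hU hK)

lemma union_part_subset (h : IsExtension d r g I F S P) {A : Finset (RootedBooster V)}
    (hA : A ⊆ I) {U : Finset (Set (Set V))} (hU : U ⊆ F) : U ∪ A.biUnion P ⊆ S :=
  Finset.union_subset (hU.trans h.subset) ((h.part_subset hA).trans Finset.sdiff_subset)

/-- The exponent of a sequence of boosters of `I`. Every booster makes up for its part of `S`, so
that only the known part of `S` (of size at least `z`) and the remaining `f` cliques count. -/
lemma listExp_le (h : IsExtension d r g I F S P) (hF : F.Nonempty) {l : List (RootedBooster V)}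
    (hl : l.Nodup) (hlI : ∀ b ∈ l, b ∈ I) (hroot : ∀ b ∈ l, (P b).card + 2 ≤ S.card)
    {z f γ : ℕ} {Y : Finset V} (hcard : S.card ≤ z + f + ∑ b ∈ l.toFinset, (P b).card)
    (hY : z * d + r + γ ≤ (spanVerts S ∩ Y).card) :
    listExp r (l.map Sum.inl) Y + (spanVerts S \ reach (l.map Sum.inl) Y).card + γ ≤ f * d := by
  have h1 := listExp_boosters_le (r := r) (d := d) P (V₀ := spanVerts S) l Y
    (fun b hb => h.span_subset b (hlI b hb)) (fun b hb => h.span_part_subset (hlI b hb))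
    (fun b hb => h.le_span_part hF (hlI b hb))
    (fun b hb => h.rooted_girth b (hlI b hb) (by have := hroot b hb; have := h.card_le; omega))
  rw [← List.sum_toFinset _ hl] at h1
  have h2 : (spanVerts S ∩ Y).card + (spanVerts S \ Y).card = (spanVerts S).card :=
    Finset.card_inter_add_card_sdiff _ _
  have h3 := h.span_le
  have h4 : S.card * d ≤ (z + f + ∑ b ∈ l.toFinset, (P b).card) * d := Nat.mul_le_mul_right _ hcard
  zify at h2 h3 h4 hY h1
  linarith

/-- The rooted girth controls a part if at least two cliques of the configuration lie outside it. -/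
lemma part_card_add_two_le (h : IsExtension d r g I F S P) {A : Finset (RootedBooster V)}
    (hA : A ⊆ I) (hF : 2 ≤ F.card ∨ F.Nonempty ∧ A.Nonempty) {b : RootedBooster V}
    (hb : b ∈ I \ A) : (P b).card + 2 ≤ S.card := by
  have h1 := h.card_eq
  rw [Finset.mem_sdiff] at hb
  rcases hF with hF | ⟨hF, a, ha⟩
  · have := Finset.single_le_sum (f := fun b => (P b).card) (fun _ _ => Nat.zero_le _) hb.1
    omega
  · have hne : a ≠ b := fun h => hb.2 (h ▸ ha)
    have h2 : ∑ x ∈ ({a, b} : Finset _), (P x).card ≤ ∑ x ∈ I, (P x).card :=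
      Finset.sum_le_sum_of_subset (by
        intro x hx; simp only [Finset.mem_insert, Finset.mem_singleton] at hx
        rcases hx with rfl | rfl
        exacts [hA ha, hb.1])
    rw [Finset.sum_pair hne] at h2
    have := (h.nonempty a (hA ha)).card_pos
    have := hF.card_pos
    omega

end IsExtension

/-- The boosters `J` and the cliques `F` can be ordered such that the exponent, with `Y` known at
the beginning, is at most `E`. -/
def HasOrder (r : ℕ) (J : Finset (RootedBooster V)) (F : Finset (Set (Set V))) (Y : Finset V)
    (E : ℤ) : Prop :=
  ∃ l : List (Step V), l.Nodup ∧ l.toFinset = J.disjSum F ∧ listExp r l Y ≤ E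

/-- As `HasOrder`, with a first booster whose root has less than `r` known vertices. The choice of
such a root is by one of the few edges of the reserve and the absorber. -/
def HasSparseOrder (r : ℕ) (J : Finset (RootedBooster V)) (F : Finset (Set (Set V)))
    (Y : Finset V) (E : ℤ) : Prop :=
  ∃ (b : RootedBooster V) (l : List (Step V)), (Sum.inl b :: l).Nodup ∧
    (Sum.inl b :: l).toFinset = J.disjSum F ∧ (rootVerts b ∩ Y).card < r ∧
    listExp r (Sum.inl b :: l) Y ≤ E

namespace IsExtension

/-- The exponent if the cliques `U ⊆ F` and the boosters `A ⊆ I` are known. It has a gain of `γ`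
if the known part of the configuration spans `γ` more vertices than is usual. -/
lemma hasOrder (h : IsExtension d r g I F S P) {A : Finset (RootedBooster V)} (hA : A ⊆ I)
    (hF : 2 ≤ F.card ∨ F.Nonempty ∧ A.Nonempty) {U : Finset (Set (Set V))} (hU : U ⊆ F)
    {Y : Finset V} {γ : ℕ}
    (hY : (U.card + ∑ b ∈ A, (P b).card) * d + r + γ ≤ (spanVerts S ∩ Y).card) :
    HasOrder r (I \ A) (F \ U) Y ((F \ U).card * d - γ) := by
  have hFne : F.Nonempty := hF.elim (fun h => Finset.card_pos.1 (by omega)) And.left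
  refine ⟨(I \ A).toList.map Sum.inl ++ (F \ U).toList.map Sum.inr,
    nodup_map_append (Finset.nodup_toList _) (Finset.nodup_toList _), ?_, ?_⟩
  · rw [toFinset_map_append]; simp
  · have h1 := h.listExp_le hFne (Finset.nodup_toList (I \ A)) (fun b hb => by simp at hb; exact hb.1)
      (fun b hb => h.part_card_add_two_le hA hF (by simpa using hb))
      (z := U.card + ∑ b ∈ A, (P b).card) (f := (F \ U).card) ?_ hY
    · rw [listExp_append, listExp_cliques, Finset.toList_toFinset]
      have h2 : (spanVerts (F \ U) \ reach ((I \ A).toList.map Sum.inl) Y).card ≤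
          (spanVerts S \ reach ((I \ A).toList.map Sum.inl) Y).card :=
        Finset.card_le_card (Finset.sdiff_subset_sdiff
          (spanVerts_mono (Finset.sdiff_subset.trans h.subset)) subset_rfl)
      zify at h2
      linarith
    · rw [Finset.toList_toFinset, h.card_eq, ← Finset.sum_sdiff hA, Finset.card_sdiff_of_subset hU]
      have := Finset.card_le_card hU
      omega

/-- The gain if at least two cliques of the configuration, but not all of them, are known. -/
lemma hasOrder_sub_one (h : IsExtension d r g I F S P) {A : Finset (RootedBooster V)} (hA : A ⊆ I)
    (hF : 2 ≤ F.card) {U : Finset (Set (Set V))} (hU : U ⊂ F)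
    (hUA : 2 ≤ U.card ∨ U.Nonempty ∧ A.Nonempty) {Y : Finset V} (hUY : spanVerts U ⊆ Y)
    (hAY : A.biUnion boosterVerts ⊆ Y) :
    HasOrder r (I \ A) (F \ U) Y ((F \ U).card * d - 1) := by
  refine h.hasOrder hA (Or.inl hF) hU.1 (γ := 1) ?_
  rw [← h.card_union_part hA hU.1]
  refine Nat.succ_le_of_lt ((h.lt_span _ (h.union_part_subset hA hU.1) ?_ ?_).trans_le ?_)
  · rw [h.card_union_part hA hU.1]
    rcases hUA with h1 | ⟨h1, a, ha⟩
    · omega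
    · have := h1.card_pos
      have := Finset.single_le_sum (f := fun b => (P b).card) (fun _ _ => Nat.zero_le _) ha
      have := (h.nonempty a (hA ha)).card_pos
      omega
  · rw [h.card_union_part hA hU.1, h.card_eq]
    have := Finset.card_lt_card hU
    have := Finset.sum_le_sum_of_subset (f := fun b => (P b).card) hA
    omega
  · exact Finset.card_le_card (Finset.subset_inter (spanVerts_mono (h.union_part_subset hA hU.1))
      (h.span_union_subset hA hUY hAY))

end IsExtension
end Extensions

section Extensions
variable {V : Type*} [Fintype V] {d r g : ℕ} {I : Finset (RootedBooster V)}
  {F S : Finset (Set (Set V))} {P : RootedBooster V → Finset (Set (Set V))}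

namespace IsExtension

/-- One clique `K` is known. Either the first root has less than `r` vertices in `K`, or the first
booster comes at no cost and then two cliques of the configuration are known. -/
lemma hasSparseOrder_or_hasOrder (h : IsExtension d r g I F S P) (hI : I.Nonempty)
    {K : Set (Set V)} (hK : K ∈ F)
    (hF : 2 ≤ F.card ∨ ∀ b ∈ I, (rootVerts b ∩ cliqueVerts K).card ≤ r) :
    HasSparseOrder r I (F \ {K}) (cliqueVerts K) ((F \ {K}).card * d) ∨
      HasOrder r I (F \ {K}) (cliqueVerts K) ((F \ {K}).card * d - 1) := by
  obtain ⟨b, hb⟩ := hI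
  have hFne : F.Nonempty := ⟨K, hK⟩
  have hKS : cliqueVerts K ⊆ spanVerts S := cliqueVerts_subset_spanVerts (h.subset hK)
  have hKc := h.card_cliqueVerts K (h.subset hK)
  have hS := h.card_eq
  rw [← Finset.add_sum_erase _ _ hb] at hS
  have hf : (F \ {K}).card + 1 = F.card := by
    rw [Finset.card_sdiff_of_subset (by simpa), Finset.card_singleton]
    have := hFne.card_pos
    omega
  have hbl : ∀ b' ∈ (I.erase b).toList, b' ∈ I := fun b' hb' => by
    simp at hb'; exact hb'.2
  have hroot : ∀ b' ∈ (I.erase b).toList, (P b').card + 2 ≤ S.card := fun b' hb' =>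
    h.part_card_add_two_le (A := {b}) (by simpa) (Or.inr ⟨hFne, by simp⟩)
      (by simpa [and_comm] using hb')
  have hnodup : (((b :: (I.erase b).toList).map Sum.inl ++ (F \ {K}).toList.map Sum.inr) :
      List (Step V)).Nodup :=
    nodup_map_append (by simp [Finset.nodup_toList]) (Finset.nodup_toList _)
  have htoF : (((b :: (I.erase b).toList).map Sum.inl ++ (F \ {K}).toList.map Sum.inr) :
      List (Step V)).toFinset = I.disjSum (F \ {K}) := by
    rw [toFinset_map_append]
    simp [Finset.insert_erase hb]
  have hexp : ∀ Y, listExp r ((b :: (I.erase b).toList).map Sum.inl ++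
      (F \ {K}).toList.map Sum.inr) Y ≤ stepExp r (.inl b) Y +
      listExp r ((I.erase b).toList.map Sum.inl) (Y ∪ boosterVerts b) + (spanVerts S \
        reach ((I.erase b).toList.map Sum.inl) (Y ∪ boosterVerts b)).card := by
    intro Y
    rw [listExp_append, listExp_cliques, Finset.toList_toFinset]
    simp only [List.map_cons, listExp, reach, List.foldl_cons, stepVerts]
    gcongr
    exact spanVerts_mono (Finset.sdiff_subset.trans h.subset)
  have hj := (h.nonempty b hb).card_pos
  rcases Nat.lt_or_ge (rootVerts b ∩ cliqueVerts K).card r with hs | hs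
  · left
    refine ⟨b, (I.erase b).toList.map Sum.inl ++ (F \ {K}).toList.map Sum.inr, by simpa using hnodup,
      by simpa using htoF, hs, le_trans (by simpa using hexp (cliqueVerts K)) ?_⟩
    have h1 := stepExp_booster_le (V₀ := spanVerts S) (h.span_subset b hb) (h.span_part_subset hb)
      (h.le_span_part hFne hb) (Or.inl hs.le)
    have h2 := listExp_boosters_le (r := r) (d := d) P (V₀ := spanVerts S) (I.erase b).toList
      (cliqueVerts K ∪ boosterVerts b)
      (fun b hb => h.span_subset b (hbl b hb)) (fun b hb => h.span_part_subset (hbl b hb))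
      (fun b hb => h.le_span_part hFne (hbl b hb))
      (fun b hb => h.rooted_girth b (hbl b hb) (by have := hroot b hb; have := h.card_le; omega))
    rw [← List.sum_toFinset _ (Finset.nodup_toList _), Finset.toList_toFinset] at h2
    have h3 : (spanVerts S \ cliqueVerts K).card + (d + r) = (spanVerts S).card := by
      rw [← hKc]; exact Finset.card_sdiff_add_card_eq_card hKS
    have h4 := h.span_le
    rw [hS, ← hf] at h4
    zify at h3 h4
    push_cast at h2 h4
    linarith
  · right
    refine ⟨_, hnodup, htoF, (hexp _).trans ?_⟩
    by_cases hcase : F.card = 1 ∧ I.erase b = ∅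
    · -- the configuration is `{K} ∪ P b`, so `P b` meets `K` in more than `r` vertices, one of
      -- which is not a root vertex
      obtain ⟨hF1, hI1⟩ := hcase
      have hs' := hF.resolve_left (by omega) b hb
      have hZ := h.lt_span (P b) (by
        have := h.part_subset (A := {b}) (by simpa)
        simp only [Finset.singleton_biUnion] at this
        exact this.trans Finset.sdiff_subset) (by
          have := h.three_le; rw [hI1] at hS; simp at hS; omega)
          (by rw [hI1] at hS; simp at hS; omega)
      have h1 := Finset.card_union_add_card_inter (spanVerts (P b)) (cliqueVerts K)
      have h2 := Finset.card_le_card (Finset.union_subset (h.span_part_subset hb) hKS)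
      have h3 := h.span_le
      rw [hI1] at hS
      simp only [Finset.sum_empty, add_zero, hF1] at hS
      rw [hS, add_mul, one_mul] at h3
      have h4 : (spanVerts (P b) ∩ cliqueVerts K).card ≤
          ((boosterVerts b ∩ cliqueVerts K) \ rootVerts b).card +
            (rootVerts b ∩ cliqueVerts K).card := by
        refine (Finset.card_le_card fun x hx => ?_).trans (Finset.card_union_le _ _)
        have := h.span_subset b hb (Finset.mem_inter.1 hx).1
        simp only [Finset.mem_union, Finset.mem_sdiff, Finset.mem_inter] at hx ⊢
        tauto
      have h5 : spanVerts S \ (cliqueVerts K ∪ boosterVerts b) = ∅ := by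
        have : S = F ∪ P b := by
          rw [← Finset.union_sdiff_of_subset h.subset, h.sdiff_eq, ← Finset.insert_erase hb, hI1]
          simp
        obtain ⟨K', rfl⟩ := Finset.card_eq_one.1 hF1
        obtain rfl : K = K' := by simpa using hK
        rw [Finset.sdiff_eq_empty_iff_subset, this, spanVerts_union, spanVerts_singleton]
        exact Finset.union_subset_union subset_rfl (h.span_subset b hb)
      have h6 : (F \ {K}).card = 0 := by omega
      rw [hI1, h6]
      simp only [Finset.toList_empty, List.map_nil, listExp, reach, List.foldl_nil, h5, stepExp]
      simp only [Finset.card_empty]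
      push_cast
      omega
    · -- `{K} ∪ P b` is a proper part of the configuration
      have h1 := h.listExp_le hFne (Finset.nodup_toList (I.erase b)) hbl hroot
        (z := 1 + (P b).card) (f := (F \ {K}).card) (γ := 1)
        (Y := cliqueVerts K ∪ boosterVerts b)
        (by rw [Finset.toList_toFinset]; omega) ?_
      · have h2 : stepExp r (.inl b) (cliqueVerts K) ≤ 0 := by
          simp only [stepExp]; omega
        push_cast at h1
        linarith
      · have h2 := h.card_union_part (A := {b}) (by simpa) (U := {K}) (by simpa)
        have h3 := h.union_part_subset (A := {b}) (by simpa) (U := {K}) (by simpa)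
        rw [Finset.sum_singleton, Finset.card_singleton] at h2
        rw [← h2]
        refine Nat.succ_le_of_lt ((h.lt_span _ h3 (by omega) ?_).trans_le ?_)
        · rw [h2]
          by_contra hcon
          have h4 : ∑ x ∈ I.erase b, (P x).card = 0 := by omega
          refine hcase ⟨by omega, Finset.eq_empty_of_forall_notMem fun x hx => ?_⟩
          have := (Finset.sum_eq_zero_iff.1 h4) x hx
          have := (h.nonempty x (Finset.mem_of_mem_erase hx)).card_pos
          omega
        · refine Finset.card_le_card (Finset.subset_inter (spanVerts_mono h3)
            (h.span_union_subset (by simpa) ?_ (by simp)))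
          rw [spanVerts_singleton]
          exact Finset.subset_union_left

/-- At least one booster is known, and an edge `x` of the only clique of `F`. -/
lemma hasOrder_of_edge (h : IsExtension d r g I F S P) {K : Set (Set V)} (hFK : F = {K})
    {A : Finset (RootedBooster V)} (hA : A ⊆ I) (hAne : A.Nonempty) {x : Finset V}
    (hx : x.card = r) (hxK : x ⊆ cliqueVerts K) {Y : Finset V} (hxY : x ⊆ Y)
    (hAY : A.biUnion boosterVerts ⊆ Y) :
    HasOrder r (I \ A) F Y (d - 1) := by
  subst hFK
  have hKS := h.subset (Finset.mem_singleton_self K)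
  have h1 := h.hasOrder hA (Or.inr ⟨by simp, hAne⟩) (U := ∅) (by simp) (Y := Y) (γ := 1) ?_
  · simpa using h1
  have hZ := h.union_part_subset hA (U := ∅) (by simp)
  have hZc := h.card_union_part hA (U := ∅) (by simp)
  have hZY := h.span_union_subset hA (U := ∅) (Y := Y) (by simp [spanVerts]) hAY
  have hKZ : K ∉ ∅ ∪ A.biUnion P := fun hK => by
    rw [Finset.empty_union] at hK
    simpa using (Finset.mem_sdiff.1 (h.part_subset hA hK)).2
  rw [← hZc]
  rw [Finset.card_empty] at hZc
  generalize ∅ ∪ A.biUnion P = Z at *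
  have hZlt : Z.card < S.card := Finset.card_lt_card ⟨hZ, fun hs => hKZ (hs hKS)⟩
  have hsub : spanVerts Z ⊆ spanVerts S ∩ Y := Finset.subset_inter (spanVerts_mono hZ) hZY
  have hZpos : 1 ≤ Z.card := by
    obtain ⟨a, ha⟩ := hAne
    have := Finset.single_le_sum (f := fun b => (P b).card) (fun _ _ => Nat.zero_le _) ha
    have := (h.nonempty a (hA ha)).card_pos
    omega
  rcases Nat.lt_or_ge Z.card 2 with h2 | h2
  · -- the only known clique shares less than `r` vertices with `K`, so that it misses part of `x`
    obtain ⟨K₁, rfl⟩ := Finset.card_eq_one.1 (by omega : Z.card = 1)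
    have hK₁ : K₁ ∈ S := hZ (by simp)
    have hne : K ≠ K₁ := by simpa using hKZ
    have h3 := h.lt_span {K, K₁} (by simp [Finset.insert_subset_iff, hKS, hK₁])
      (by rw [Finset.card_pair hne]) (by rw [Finset.card_pair hne]; have := h.three_le; omega)
    have h4 : spanVerts {K, K₁} = cliqueVerts K ∪ cliqueVerts K₁ := by simp [spanVerts]
    rw [h4, Finset.card_pair hne] at h3
    have h5 := Finset.card_union_add_card_inter (cliqueVerts K) (cliqueVerts K₁)
    rw [h.card_cliqueVerts K hKS, h.card_cliqueVerts K₁ hK₁] at h5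
    have h6 : ¬ x ⊆ cliqueVerts K₁ := fun hx' => by
      have := Finset.card_le_card (Finset.subset_inter hxK hx')
      omega
    obtain ⟨y, hyx, hy⟩ := Finset.not_subset.1 h6
    have h7 : (insert y (cliqueVerts K₁)).card ≤ (spanVerts S ∩ Y).card := by
      refine Finset.card_le_card (Finset.insert_subset ?_ ?_)
      · simp [hxY hyx, cliqueVerts_subset_spanVerts hKS (hxK hyx)]
      · simpa [spanVerts_singleton] using hsub
    rw [Finset.card_insert_of_notMem hy, h.card_cliqueVerts K₁ hK₁] at h7
    simp
    omega
  · exact Nat.succ_le_of_lt ((h.lt_span Z hZ h2 hZlt).trans_le (Finset.card_le_card hsub))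

/-- A clique `K` and vertices `x` of a second clique that do not all belong to `K` are known. -/
lemma hasOrder_of_clique_of_edge (h : IsExtension d r g I F S P) {K K' : Set (Set V)}
    (hFK : F = {K, K'}) (hne : K ≠ K') {A : Finset (RootedBooster V)} (hA : A ⊆ I) {x : Finset V}
    (hxK' : x ⊆ cliqueVerts K') (hxK : ¬ x ⊆ cliqueVerts K) {Y : Finset V} (hxY : x ⊆ Y)
    (hKY : cliqueVerts K ⊆ Y) (hAY : A.biUnion boosterVerts ⊆ Y) :
    HasOrder r (I \ A) {K'} Y (d - 1) := by
  have hF : F.card = 2 := by rw [hFK, Finset.card_pair hne]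
  have hFs : F \ {K} = {K'} := by
    rw [hFK]; ext z; simp only [Finset.mem_sdiff, Finset.mem_insert, Finset.mem_singleton]
    constructor
    · tauto
    · rintro rfl; exact ⟨Or.inr rfl, hne.symm⟩
  have hU : {K} ⊂ F := by
    refine ⟨by simp [hFK], fun hs => hne ?_⟩
    exact (Finset.mem_singleton.1 (hs (show K' ∈ F by simp [hFK]))).symm
  rw [← hFs]
  rcases A.eq_empty_or_nonempty with rfl | hAne
  · have h1 := h.hasOrder hA (Or.inl hF.ge) hU.1 (Y := Y) (γ := 1) ?_
    · rw [hFs] at h1 ⊢; simpa using h1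
    · obtain ⟨y, hyx, hy⟩ := Finset.not_subset.1 hxK
      have hKS : K ∈ S := h.subset (by simp [hFK])
      have hKS' : K' ∈ S := h.subset (by simp [hFK])
      have h7 : (insert y (cliqueVerts K)).card ≤ (spanVerts S ∩ Y).card := by
        refine Finset.card_le_card (Finset.insert_subset ?_ ?_)
        · simp [hxY hyx, cliqueVerts_subset_spanVerts hKS' (hxK' hyx)]
        · exact Finset.subset_inter (cliqueVerts_subset_spanVerts hKS) hKY
      rw [Finset.card_insert_of_notMem hy, h.card_cliqueVerts K hKS] at h7
      simpa using h7
  · have h1 := h.hasOrder_sub_one hA hF.ge hU (Or.inr ⟨by simp, hAne⟩) (Y := Y)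
      (by rwa [spanVerts_singleton]) hAY
    rw [hFs] at h1 ⊢; simpa using h1

end IsExtension
end Extensions

section Extensions
variable {V : Type*} [Fintype V] {d r g : ℕ} {I₁ I₂ : Finset (RootedBooster V)}
  {S₁ S₂ : Finset (Set (Set V))} {P₁ P₂ : RootedBooster V → Finset (Set (Set V))}
  {u v w : Set (Set V)}

namespace IsExtension

/-- The exponent of two extensions with the common clique `w`, where the boosters of the first
extension come first, then `w`, then the other boosters of the second extension. -/
lemma hasOrder_common_of_list (h₁ : IsExtension d r g I₁ {u, w} S₁ P₁)
    (h₂ : IsExtension d r g I₂ {v, w} S₂ P₂) (hvw : v ≠ w) {A : Finset (RootedBooster V)}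
    {l : List (RootedBooster V)} (hl : l.Nodup) (hlA : l.toFinset = I₁ \ A) {Y : Finset V}
    (hvY : cliqueVerts v ⊆ Y) (hAY : A.biUnion boosterVerts ⊆ Y) {γ₁ γ₂ : ℕ}
    (h : listExp r (l.map Sum.inl) Y + (spanVerts S₁ \ reach (l.map Sum.inl) Y).card + γ₁ ≤ d)
    (hγ : γ₂ = 0 ∨ γ₂ = 1 ∧ ¬ I₂ ⊆ I₁ ∪ A) :
    HasOrder r ((I₁ ∪ I₂) \ A) {w} Y (d - (γ₁ + γ₂ : ℕ)) := by
  set Y₂ := reach (l.map Sum.inl) Y ∪ cliqueVerts w with hY₂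
  have hYY₂ : Y ⊆ Y₂ := (subset_reach _ _).trans Finset.subset_union_left
  have hF : (({v, w} : Finset (Set (Set V)))).card = 2 := Finset.card_pair hvw
  -- the second stage costs nothing, and gains a factor `n` unless nothing is left to choose
  have hstage : listExp r ((I₂ \ (I₁ ∪ A)).toList.map Sum.inl) Y₂ + γ₂ ≤ 0 := by
    by_cases hsub : I₂ ⊆ I₁ ∪ A
    · have : γ₂ = 0 := hγ.resolve_right fun hh => hh.2 hsub
      rw [Finset.sdiff_eq_empty_iff_subset.2 hsub, this]
      simp [listExp]
    set B := I₂ ∩ (I₁ ∪ A) with hB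
    have hBI : B ⊆ I₂ := Finset.inter_subset_left
    have hBne : B ≠ I₂ := fun hh => hsub (hh ▸ Finset.inter_subset_right)
    have hBs : I₂ \ (I₁ ∪ A) = I₂ \ B := by rw [hB, Finset.sdiff_inter_self_left]
    have hBY : B.biUnion boosterVerts ⊆ Y₂ := by
      refine Finset.biUnion_subset.2 fun b hb => ?_
      rw [hB, Finset.mem_inter, Finset.mem_union] at hb
      by_cases hbA : b ∈ A
      · exact ((Finset.subset_biUnion_of_mem boosterVerts hbA).trans hAY).trans hYY₂
      · refine Finset.Subset.trans ?_ Finset.subset_union_left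
        refine stepVerts_subset_reach (σ := Sum.inl b) ?_ _
        have : b ∈ l.toFinset := by rw [hlA]; simp [hbA]; tauto
        simpa using this
    have hvwY : spanVerts {v, w} ⊆ Y₂ := by
      have : spanVerts {v, w} = cliqueVerts v ∪ cliqueVerts w := by simp [spanVerts]
      rw [this]
      exact Finset.union_subset (hvY.trans hYY₂) Finset.subset_union_right
    have h1 := h₂.card_union_part hBI (U := {v, w}) subset_rfl
    have h2 := h₂.union_part_subset hBI (U := {v, w}) subset_rfl
    have h3 : spanVerts ({v, w} ∪ B.biUnion P₂) ⊆ spanVerts S₂ ∩ Y₂ :=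
      Finset.subset_inter (spanVerts_mono h2) (h₂.span_union_subset hBI hvwY hBY)
    have h4 : ({v, w} ∪ B.biUnion P₂).card < S₂.card := by
      obtain ⟨x, hx, hxB⟩ := Finset.exists_of_ssubset (hBI.ssubset_of_ne hBne)
      have h4 := h₂.card_eq
      have h5 : ∑ b ∈ insert x B, (P₂ b).card ≤ ∑ b ∈ I₂, (P₂ b).card :=
        Finset.sum_le_sum_of_subset (Finset.insert_subset hx hBI)
      rw [Finset.sum_insert hxB] at h5
      have := (h₂.nonempty x hx).card_pos
      omega
    have h5 := h₂.listExp_le (by simp) (Finset.nodup_toList (I₂ \ B))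
      (fun b hb => by simp at hb; exact hb.1)
      (fun b hb => h₂.part_card_add_two_le hBI (Or.inl hF.ge) (by simpa using hb))
      (z := 2 + ∑ b ∈ B, (P₂ b).card) (f := 0) (γ := 1) (Y := Y₂)
      (by rw [Finset.toList_toFinset, h₂.card_eq, ← Finset.sum_sdiff hBI, hF]; omega)
      (by
        rw [← hF, ← h1]
        exact Nat.succ_le_of_lt ((h₂.lt_span _ h2 (by omega) h4).trans_le
          (Finset.card_le_card h3)))
    rw [hBs]
    have : γ₂ ≤ 1 := by omega
    omega
  refine ⟨l.map Sum.inl ++ (Sum.inr w :: (I₂ \ (I₁ ∪ A)).toList.map Sum.inl), ?_, ?_, ?_⟩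
  · refine List.Nodup.append (hl.map Sum.inl_injective) ?_ ?_
    · refine List.nodup_cons.2 ⟨by simp, (Finset.nodup_toList _).map Sum.inl_injective⟩
    · intro x hx hy
      simp only [List.mem_map, List.mem_cons, Finset.mem_toList] at hx hy
      obtain ⟨b, hb, rfl⟩ := hx
      have hb' : b ∈ l.toFinset := by simpa using hb
      rw [hlA] at hb'
      simp at hy hb'
      tauto
  · have hlA' : ∀ b, b ∈ l ↔ b ∈ I₁ ∧ b ∉ A := fun b => by
      rw [← List.mem_toFinset, hlA, Finset.mem_sdiff]
    ext x
    cases x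
    · simp [hlA']; tauto
    · simp
  · rw [listExp_append]
    simp only [listExp, stepExp, stepVerts]
    have h6 : (cliqueVerts w \ reach (l.map Sum.inl) Y).card ≤
        (spanVerts S₁ \ reach (l.map Sum.inl) Y).card :=
      Finset.card_le_card (Finset.sdiff_subset_sdiff
        (cliqueVerts_subset_spanVerts (h₁.subset (by simp))) subset_rfl)
    rw [← hY₂]
    push_cast
    omega

/-- Some booster of the first extension is known. -/
lemma hasOrder_common_of_inter (h₁ : IsExtension d r g I₁ {u, w} S₁ P₁)
    (h₂ : IsExtension d r g I₂ {v, w} S₂ P₂) (huw : u ≠ w) (hvw : v ≠ w)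
    {A : Finset (RootedBooster V)} (hAI : (I₁ ∩ A).Nonempty) {Y : Finset V}
    (huY : cliqueVerts u ⊆ Y) (hvY : cliqueVerts v ⊆ Y) (hAY : A.biUnion boosterVerts ⊆ Y) :
    HasOrder r ((I₁ ∪ I₂) \ A) {w} Y (d - 1) := by
  have hF : (({u, w} : Finset (Set (Set V)))).card = 2 := Finset.card_pair huw
  have hBI : I₁ ∩ A ⊆ I₁ := Finset.inter_subset_left
  have hAs : I₁ \ A = I₁ \ (I₁ ∩ A) := by rw [Finset.sdiff_inter_self_left]
  have h1 := h₁.card_union_part hBI (U := {u}) (by simp)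
  have h2 := h₁.union_part_subset hBI (U := {u}) (by simp)
  have h3 : spanVerts ({u} ∪ (I₁ ∩ A).biUnion P₁) ⊆ spanVerts S₁ ∩ Y :=
    Finset.subset_inter (spanVerts_mono h2) (h₁.span_union_subset hBI
      (by rwa [spanVerts_singleton]) ((Finset.biUnion_subset_biUnion_of_subset_left _
        Finset.inter_subset_right).trans hAY))
  rw [Finset.card_singleton] at h1
  have h4 : 1 ≤ ∑ b ∈ I₁ ∩ A, (P₁ b).card := by
    obtain ⟨a, ha⟩ := hAI
    have := Finset.single_le_sum (f := fun b => (P₁ b).card) (fun _ _ => Nat.zero_le _) ha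
    have := (h₁.nonempty a (hBI ha)).card_pos
    omega
  have h5 := h₁.card_eq
  rw [← Finset.sum_sdiff hBI, hF] at h5
  have h6 := h₁.listExp_le (by simp) (Finset.nodup_toList (I₁ \ A))
      (fun b hb => by simp at hb; exact hb.1)
      (fun b hb => h₁.part_card_add_two_le hBI (Or.inl hF.ge) (by
        rw [← hAs]; simpa using hb))
      (z := 1 + ∑ b ∈ I₁ ∩ A, (P₁ b).card) (f := 1) (γ := 1) (Y := Y)
      (by rw [Finset.toList_toFinset, hAs]; omega)
      (by
        rw [← h1]
        exact Nat.succ_le_of_lt ((h₁.lt_span _ h2 (by omega) (by omega)).trans_le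
          (Finset.card_le_card h3)))
  have h7 := hasOrder_common_of_list h₁ h₂ hvw (Finset.nodup_toList (I₁ \ A)) (by simp)
    hvY hAY (γ₁ := 1) (γ₂ := 0) (by simpa using h6) (Or.inl rfl)
  simpa using h7

/-- No booster is known, and the boosters of the second extension all occur in the first one. As
`u` and `v` have less than `r` common vertices, a vertex of `v` outside `u` lies in `w` or in a
booster of the first extension. -/
lemma hasOrder_common_of_subset (h₁ : IsExtension d r g I₁ {u, w} S₁ P₁)
    (h₂ : IsExtension d r g I₂ {v, w} S₂ P₂) (huw : u ≠ w) (hvw : v ≠ w)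
    (huv : (cliqueVerts u ∩ cliqueVerts v).card < r) (hI : I₂ ⊆ I₁) {Y : Finset V}
    (huY : cliqueVerts u ⊆ Y) (hvY : cliqueVerts v ⊆ Y) :
    HasOrder r (I₁ ∪ I₂) {w} Y (d - 1) := by
  have hF₁ : (({u, w} : Finset (Set (Set V)))).card = 2 := Finset.card_pair huw
  have hF₂ : (({v, w} : Finset (Set (Set V)))).card = 2 := Finset.card_pair hvw
  have huS : u ∈ S₁ := h₁.subset (by simp)
  have hvS : v ∈ S₂ := h₂.subset (by simp)
  have huc := h₁.card_cliqueVerts u huS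
  -- a vertex of `v` outside `u` that becomes known again
  obtain ⟨x, hxv, hxu, hx⟩ : ∃ x ∈ cliqueVerts v, x ∉ cliqueVerts u ∧
      (x ∈ cliqueVerts w ∨ ∃ b ∈ I₁, x ∈ boosterVerts b) := by
    have h1 := h₂.lt_span (S₂.erase v) (Finset.erase_subset _ _)
      (by rw [Finset.card_erase_of_mem hvS]; have := h₂.three_le; omega)
      (by rw [Finset.card_erase_of_mem hvS]; have := h₂.three_le; omega)
    have h2 : spanVerts S₂ = spanVerts (S₂.erase v) ∪ cliqueVerts v := by
      rw [← spanVerts_singleton v, ← spanVerts_union]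
      congr 1
      ext K; simp; constructor
      · tauto
      · rintro (h | h)
        exacts [h ▸ hvS, h.2]
    have h3 := h₂.span_le
    have h4 := Finset.card_union_add_card_inter (spanVerts (S₂.erase v)) (cliqueVerts v)
    rw [← h2, h₂.card_cliqueVerts v hvS] at h4
    have h5 : (S₂.erase v).card + 1 = S₂.card := Finset.card_erase_add_one hvS
    rw [← h5, add_mul, one_mul] at h3
    have h6 : ¬ spanVerts (S₂.erase v) ∩ cliqueVerts v ⊆ cliqueVerts u ∩ cliqueVerts v :=
      fun hs => by have := Finset.card_le_card hs; omega
    obtain ⟨x, hx, hxu⟩ := Finset.not_subset.1 h6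
    rw [Finset.mem_inter] at hx hxu
    refine ⟨x, hx.2, fun h => hxu ⟨h, hx.2⟩, ?_⟩
    obtain ⟨K, hK, hxK⟩ := Finset.mem_biUnion.1 hx.1
    rw [Finset.mem_erase] at hK
    by_cases hKF : K ∈ ({v, w} : Finset (Set (Set V)))
    · simp only [Finset.mem_insert, Finset.mem_singleton, hK.1, false_or] at hKF
      exact Or.inl (hKF ▸ hxK)
    · have : K ∈ S₂ \ {v, w} := Finset.mem_sdiff.2 ⟨hK.2, hKF⟩
      rw [h₂.sdiff_eq] at this
      obtain ⟨b, hb, hKb⟩ := Finset.mem_biUnion.1 this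
      exact Or.inr ⟨b, hI hb, h₂.span_subset b hb (cliqueVerts_subset_spanVerts hKb hxK)⟩
  have hxY := hvY hxv
  -- it suffices to order the boosters of the first extension with a gain
  suffices h : ∃ l : List (RootedBooster V), l.Nodup ∧ l.toFinset = I₁ ∧
      listExp r (l.map Sum.inl) Y + (spanVerts S₁ \ reach (l.map Sum.inl) Y).card + 1 ≤ d by
    obtain ⟨l, hl, hlI, hle⟩ := h
    have h7 := hasOrder_common_of_list h₁ h₂ hvw (A := ∅) hl (by simpa using hlI) hvY (by simp)
      (γ₁ := 1) (γ₂ := 0) hle (Or.inl rfl)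
    simpa using h7
  have huSp := cliqueVerts_subset_spanVerts huS
  have hroot : ∀ b ∈ I₁, (P₁ b).card + 2 ≤ S₁.card := fun b hb =>
    h₁.part_card_add_two_le (A := ∅) (by simp) (Or.inl hF₁.ge) (by simpa)
  by_cases hxS : x ∈ spanVerts S₁
  · -- `u` and `x` are known vertices of the first configuration
    refine ⟨I₁.toList, Finset.nodup_toList _, by simp, ?_⟩
    have h6 := h₁.listExp_le (by simp) (Finset.nodup_toList I₁) (fun b hb => by simpa using hb)
      (fun b hb => hroot b (by simpa using hb)) (z := 1) (f := 1) (γ := 1) (Y := Y)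
      (by rw [Finset.toList_toFinset, h₁.card_eq, hF₁])
      (by
        have : (insert x (cliqueVerts u)).card ≤ (spanVerts S₁ ∩ Y).card :=
          Finset.card_le_card (Finset.insert_subset (by simp [hxS, hxY])
            (Finset.subset_inter huSp huY))
        rw [Finset.card_insert_of_notMem hxu, huc] at this
        omega)
    simpa using h6
  have hxw : x ∉ cliqueVerts w := fun hw =>
    hxS (cliqueVerts_subset_spanVerts (h₁.subset (by simp)) hw)
  obtain ⟨b, hb, hxb⟩ := hx.resolve_left hxw
  refine ⟨b :: (I₁.erase b).toList, by simp [Finset.nodup_toList], by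
    simp [Finset.insert_erase hb], ?_⟩
  have hS := h₁.card_eq
  rw [← Finset.add_sum_erase _ _ hb, hF₁] at hS
  have hj := (h₁.nonempty b hb).card_pos
  have hbl : ∀ b' ∈ (I₁.erase b).toList, b' ∈ I₁ := fun b' hb' => by
    simp at hb'; exact hb'.2
  simp only [List.map_cons, listExp, reach_cons, stepVerts_inl]
  rcases Nat.lt_or_ge (rootVerts b ∩ Y).card r with hs | hs
  · -- `x` is a known vertex of `b` that does not count for the first configuration
    have h1 := stepExp_booster_lt (V₀ := spanVerts S₁) (h₁.span_subset b hb)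
      (h₁.span_part_subset hb) (h₁.le_span_part (by simp) hb) hs.le hxY hxb hxS
    have h2 := listExp_boosters_le (r := r) (d := d) P₁ (V₀ := spanVerts S₁) (I₁.erase b).toList
      (Y ∪ boosterVerts b)
      (fun b hb => h₁.span_subset b (hbl b hb)) (fun b hb => h₁.span_part_subset (hbl b hb))
      (fun b hb => h₁.le_span_part (by simp) (hbl b hb))
      (fun b' hb' => h₁.rooted_girth b' (hbl b' hb') (by
        have := hroot b' (hbl b' hb'); have := h₁.card_le; omega))
    rw [← List.sum_toFinset _ (Finset.nodup_toList _), Finset.toList_toFinset] at h2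
    have h3 : (spanVerts S₁ \ Y).card + (d + r) ≤ (spanVerts S₁).card := by
      rw [← huc, ← Finset.card_sdiff_add_card_eq_card huSp]
      gcongr
    have h4 := h₁.span_le
    rw [hS] at h4
    zify at h3 h4
    push_cast at h2 h4
    linarith
  · -- `b` comes at no cost, and then `{u} ∪ P₁ b` is known
    have h1 := h₁.card_union_part (A := {b}) (by simpa) (U := {u}) (by simp)
    have h2 := h₁.union_part_subset (A := {b}) (by simpa) (U := {u}) (by simp)
    rw [Finset.sum_singleton, Finset.card_singleton] at h1
    have h3 := h₁.listExp_le (by simp) (Finset.nodup_toList (I₁.erase b)) hbl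
      (fun b' hb' => hroot b' (hbl b' hb')) (z := 1 + (P₁ b).card) (f := 1) (γ := 1)
      (Y := Y ∪ boosterVerts b) (by rw [Finset.toList_toFinset]; omega) (by
        rw [← h1]
        refine Nat.succ_le_of_lt ((h₁.lt_span _ h2 (by omega) (by omega)).trans_le ?_)
        refine Finset.card_le_card (Finset.subset_inter (spanVerts_mono h2)
          (h₁.span_union_subset (by simpa) ?_ (by simp)))
        rw [spanVerts_singleton]
        exact huY.trans Finset.subset_union_left)
    have h4 : stepExp r (.inl b) Y ≤ 0 := by
      simp only [stepExp]; omega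
    push_cast at h3
    linarith

/-- Two extensions of `{u, w}` and `{v, w}`, where `u` and `v` are known and share less than `r`
vertices, always gain a factor `n`. -/
lemma hasOrder_common (h₁ : IsExtension d r g I₁ {u, w} S₁ P₁)
    (h₂ : IsExtension d r g I₂ {v, w} S₂ P₂) (huw : u ≠ w) (hvw : v ≠ w)
    (huv : (cliqueVerts u ∩ cliqueVerts v).card < r) {A : Finset (RootedBooster V)}
    (hA : A ⊆ I₁ ∪ I₂) {Y : Finset V} (huY : cliqueVerts u ⊆ Y) (hvY : cliqueVerts v ⊆ Y)
    (hAY : A.biUnion boosterVerts ⊆ Y) :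
    HasOrder r ((I₁ ∪ I₂) \ A) {w} Y (d - 1) := by
  rcases A.eq_empty_or_nonempty with rfl | ⟨a, ha⟩
  · rw [Finset.sdiff_empty]
    by_cases hI : I₂ ⊆ I₁
    · exact hasOrder_common_of_subset h₁ h₂ huw hvw huv hI huY hvY
    · -- the gain comes from the boosters that only the second extension uses
      have hF₁ : (({u, w} : Finset (Set (Set V)))).card = 2 := Finset.card_pair huw
      have h6 := h₁.listExp_le (by simp) (Finset.nodup_toList I₁) (fun b hb => by simpa using hb)
        (fun b hb => h₁.part_card_add_two_le (A := ∅) (by simp) (Or.inl hF₁.ge)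
          (by simpa using hb)) (z := 1) (f := 1) (γ := 0) (Y := Y)
        (by rw [Finset.toList_toFinset, h₁.card_eq, hF₁])
        (by
          rw [one_mul, add_zero, ← h₁.card_cliqueVerts u (h₁.subset (by simp))]
          exact Finset.card_le_card (Finset.subset_inter
            (cliqueVerts_subset_spanVerts (h₁.subset (by simp))) huY))
      have h7 := hasOrder_common_of_list h₁ h₂ hvw (A := ∅) (Finset.nodup_toList I₁) (by simp)
        hvY (by simp) (γ₁ := 0) (γ₂ := 1) (by simpa using h6) (Or.inr ⟨rfl, by simpa⟩)
      simpa using h7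
  · rcases Finset.mem_union.1 (hA ha) with h | h
    · exact hasOrder_common_of_inter h₁ h₂ huw hvw ⟨a, by simp [h, ha]⟩ huY hvY hAY
    · rw [Finset.union_comm]
      exact hasOrder_common_of_inter h₂ h₁ hvw huw ⟨a, by simp [h, ha]⟩ hvY huY hAY

end IsExtension
end Extensions

/-! ### Weighted sums over sequences of steps -/

section Sums
variable {V : Type*}

/-- The probability that the object of a step is present: boosters are retained with probability
`p`, cliques are always there. -/
def stepProb (p : ℝ) : Step V → ℝ
  | .inl _ => p
  | .inr _ => 1

/-- The lists of length `k` with entries in `T`. -/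
def listsOf {σ : Type*} (T : Finset σ) : ℕ → Finset (List σ)
  | 0 => {[]}
  | k + 1 => (T ×ˢ listsOf T k).image fun x => x.1 :: x.2

lemma mem_listsOf {σ : Type*} (T : Finset σ) (k : ℕ) (l : List σ) :
    l ∈ listsOf T k ↔ l.length = k ∧ ∀ x ∈ l, x ∈ T := by
  induction k generalizing l with
  | zero => simp [listsOf]; rintro rfl; simp
  | succ k ih =>
    cases l with
    | nil => simp [listsOf]
    | cons x l => simp [listsOf, ih]; tauto

lemma sum_listsOf_succ {σ : Type*} (T : Finset σ) (k : ℕ) (f : List σ → ℝ) :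
    ∑ l ∈ listsOf T (k + 1), f l = ∑ x ∈ T, ∑ l ∈ listsOf T k, f (x :: l) := by
  rw [listsOf, Finset.sum_image, Finset.sum_product]
  rintro ⟨x, l⟩ - ⟨y, m⟩ - h
  simpa using h

lemma prod_stepProb {p : ℝ} {J : Finset (RootedBooster V)} {F : Finset (Set (Set V))} {l : List (Step V)}
    (hl : l.Nodup) (hlJ : l.toFinset = J.disjSum F) :
    (l.map (stepProb p)).prod = p ^ J.card := by
  rw [← List.prod_toFinset _ hl, hlJ, Finset.prod_disjSum]
  simp [stepProb]

lemma length_eq {J : Finset (RootedBooster V)} {F : Finset (Set (Set V))} {l : List (Step V)}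
    (hl : l.Nodup) (hlJ : l.toFinset = J.disjSum F) : l.length = J.card + F.card := by
  rw [← List.toFinset_card_of_nodup hl, hlJ, Finset.card_disjSum]

/-- A structure `(I, F)` is given by an ordering of `(I \ A, F)`. -/
lemma eq_of_toFinset_eq {e e' : Finset (RootedBooster V) × Finset (Set (Set V))}
    {A : Finset (RootedBooster V)} (he : A ⊆ e.1) (he' : A ⊆ e'.1)
    (h : (e.1 \ A).disjSum e.2 = (e'.1 \ A).disjSum e'.2) : e = e' := by
  have h1 : e.1 \ A = e'.1 \ A := by
    ext b; simpa using congrArg (fun s => Sum.inl b ∈ s) h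
  have h2 : e.2 = e'.2 := by
    ext b; simpa using congrArg (fun s => Sum.inr b ∈ s) h
  refine Prod.ext ?_ h2
  rw [← Finset.union_sdiff_of_subset he, h1, Finset.union_sdiff_of_subset he']

variable [Fintype V]

/-- Bounds for the expected number of choices in one step. The boosters are in `ℬ` and the cliques
in `𝒦`, `N` is the number of vertices, `B` bounds the number of choices in a step relative to
`N ^ stepExp`, and `B₀` bounds it for the boosters whose root has less than `r` known vertices. -/
structure StepBounds (r : ℕ) (ℬ : Finset (RootedBooster V)) (𝒦 : Finset (Set (Set V)))
    (p N B B₀ : ℝ) (L v₀ : ℕ) : Prop where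
  p_nonneg : 0 ≤ p
  one_le_N : 1 ≤ N
  one_le_B : 1 ≤ B
  B₀_nonneg : 0 ≤ B₀
  card_booster : ∀ b ∈ ℬ, (boosterVerts b).card ≤ v₀
  card_clique : ∀ K ∈ 𝒦, (cliqueVerts K).card ≤ v₀
  sum_le : ∀ Y : Finset V, Y.card ≤ L →
    ∑ σ ∈ ℬ.disjSum 𝒦, stepProb p σ * N ^ (-stepExp r σ Y) ≤ B
  sum_sparse_le : ∀ Y : Finset V, Y.card ≤ L →
    ∑ b ∈ ℬ with (rootVerts b ∩ Y).card < r, p * N ^ (-stepExp r (.inl b) Y) ≤ B₀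

namespace StepBounds

variable {r : ℕ} {ℬ : Finset (RootedBooster V)} {𝒦 : Finset (Set (Set V))} {p N B B₀ : ℝ}
  {L v₀ : ℕ}

lemma stepProb_nonneg (h : StepBounds r ℬ 𝒦 p N B B₀ L v₀) (σ : Step V) : 0 ≤ stepProb p σ := by
  cases σ
  exacts [h.p_nonneg, zero_le_one]

/-- The weight of a sequence of steps. -/
def listWeight (r : ℕ) (p N : ℝ) (l : List (Step V)) (Y : Finset V) : ℝ :=
  (l.map (stepProb p)).prod * N ^ (-listExp r l Y)

lemma listWeight_nonneg (h : StepBounds r ℬ 𝒦 p N B B₀ L v₀) (l : List (Step V)) (Y : Finset V) :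
    0 ≤ listWeight r p N l Y := by
  refine mul_nonneg (List.prod_nonneg ?_) (zpow_nonneg (by linarith [h.one_le_N]) _)
  simp only [List.mem_map]
  rintro _ ⟨σ, -, rfl⟩
  exact h.stepProb_nonneg σ

lemma listWeight_cons (h : StepBounds r ℬ 𝒦 p N B B₀ L v₀) (σ : Step V) (l : List (Step V))
    (Y : Finset V) : listWeight r p N (σ :: l) Y =
      stepProb p σ * N ^ (-stepExp r σ Y) * listWeight r p N l (Y ∪ stepVerts σ) := by
  have hN : N ≠ 0 := by linarith [h.one_le_N]
  simp only [listWeight, List.map_cons, List.prod_cons, listExp, neg_add, zpow_add₀ hN]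
  ring

lemma card_stepVerts_le (h : StepBounds r ℬ 𝒦 p N B B₀ L v₀) {σ : Step V}
    (hσ : σ ∈ ℬ.disjSum 𝒦) : (stepVerts σ).card ≤ v₀ := by
  rcases Finset.mem_disjSum.1 hσ with ⟨b, hb, rfl⟩ | ⟨K, hK, rfl⟩
  exacts [h.card_booster b hb, h.card_clique K hK]

lemma sum_listWeight_le (h : StepBounds r ℬ 𝒦 p N B B₀ L v₀) (k : ℕ) (Y : Finset V)
    (hY : Y.card + k * v₀ ≤ L) :
    ∑ l ∈ listsOf (ℬ.disjSum 𝒦) k, listWeight r p N l Y ≤ B ^ k := by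
  induction k generalizing Y with
  | zero => simp [listsOf, listWeight, listExp]
  | succ k ih =>
    rw [sum_listsOf_succ]
    calc _ ≤ ∑ σ ∈ ℬ.disjSum 𝒦, stepProb p σ * N ^ (-stepExp r σ Y) * B ^ k := by
          refine Finset.sum_le_sum fun σ hσ => ?_
          simp_rw [h.listWeight_cons, ← Finset.mul_sum]
          refine mul_le_mul_of_nonneg_left (ih _ ?_) (mul_nonneg (h.stepProb_nonneg σ)
            (zpow_nonneg (by linarith [h.one_le_N]) _))
          have := Finset.card_union_le Y (stepVerts σ)
          have := h.card_stepVerts_le hσ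
          rw [add_mul, one_mul] at hY
          omega
      _ ≤ B * B ^ k := by
          rw [← Finset.sum_mul]
          exact mul_le_mul_of_nonneg_right (h.sum_le Y (by omega))
            (pow_nonneg (by linarith [h.one_le_B]) _)
      _ = _ := by ring

lemma sum_listWeight_sparse_le (h : StepBounds r ℬ 𝒦 p N B B₀ L v₀) (k : ℕ) (Y : Finset V)
    (hY : Y.card + (k + 1) * v₀ ≤ L) :
    ∑ b ∈ ℬ with (rootVerts b ∩ Y).card < r, ∑ l ∈ listsOf (ℬ.disjSum 𝒦) k,
      listWeight r p N (.inl b :: l) Y ≤ B₀ * B ^ k := by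
  calc _ ≤ ∑ b ∈ ℬ with (rootVerts b ∩ Y).card < r,
        p * N ^ (-stepExp r (.inl b) Y) * B ^ k := by
        refine Finset.sum_le_sum fun b hb => ?_
        simp_rw [h.listWeight_cons, ← Finset.mul_sum]
        refine mul_le_mul_of_nonneg_left (h.sum_listWeight_le _ _ ?_) (mul_nonneg h.p_nonneg
          (zpow_nonneg (by linarith [h.one_le_N]) _))
        have := Finset.card_union_le Y (boosterVerts b)
        have := h.card_booster b (Finset.mem_filter.1 hb).1
        rw [add_mul, one_mul] at hY
        rw [stepVerts_inl]
        omega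
    _ ≤ B₀ * B ^ k := by
        rw [← Finset.sum_mul]
        exact mul_le_mul_of_nonneg_right (h.sum_sparse_le Y (by omega))
          (pow_nonneg (by linarith [h.one_le_B]) _)

/-- The expected number of structures, given that the boosters `A` are retained. -/
lemma sum_le_of_hasOrder (h : StepBounds r ℬ 𝒦 p N B B₀ L v₀)
    (𝓔 : Finset (Finset (RootedBooster V) × Finset (Set (Set V))))
    {A : Finset (RootedBooster V)} {Y : Finset V} {E : ℤ} {m : ℕ}
    (hA : ∀ e ∈ 𝓔, A ⊆ e.1) (hℬ : ∀ e ∈ 𝓔, e.1 ⊆ ℬ) (h𝒦 : ∀ e ∈ 𝓔, e.2 ⊆ 𝒦)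
    (hm : ∀ e ∈ 𝓔, e.1.card + e.2.card ≤ m) (hY : Y.card + m * v₀ ≤ L)
    (hE : ∀ e ∈ 𝓔, HasOrder r (e.1 \ A) e.2 Y E) :
    ∑ e ∈ 𝓔, p ^ (e.1 \ A).card ≤ (m + 1) * B ^ m * N ^ E := by
  have hN : 0 < N := by linarith [h.one_le_N]
  choose! f hf1 hf2 hf3 using hE
  have hfm : ∀ e ∈ 𝓔, f e ∈ (Finset.range (m + 1)).biUnion fun k =>
      listsOf (ℬ.disjSum 𝒦) k := by
    intro e he
    rw [Finset.mem_biUnion]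
    refine ⟨(f e).length, ?_, (mem_listsOf _ _ _).2 ⟨rfl, fun x hx => ?_⟩⟩
    · rw [length_eq (hf1 e he) (hf2 e he), Finset.mem_range]
      have := Finset.card_le_card (Finset.sdiff_subset (s := e.1) (t := A))
      have := hm e he
      omega
    · have : x ∈ (f e).toFinset := by simpa using hx
      rw [hf2 e he] at this
      exact Finset.disjSum_mono (Finset.sdiff_subset.trans (hℬ e he)) (h𝒦 e he) this
  have hinj : Set.InjOn f 𝓔 := fun e he e' he' hee => eq_of_toFinset_eq (hA e he) (hA e' he')
    (by rw [← hf2 e he, ← hf2 e' he', hee])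
  calc ∑ e ∈ 𝓔, p ^ (e.1 \ A).card ≤ ∑ e ∈ 𝓔, listWeight r p N (f e) Y * N ^ E := by
        refine Finset.sum_le_sum fun e he => ?_
        rw [listWeight, prod_stepProb (hf1 e he) (hf2 e he), mul_assoc, ← zpow_add₀ hN.ne']
        refine le_mul_of_one_le_right (pow_nonneg h.p_nonneg _) (one_le_zpow₀ h.one_le_N ?_)
        linarith [hf3 e he]
    _ = ∑ l ∈ 𝓔.image f, listWeight r p N l Y * N ^ E := by rw [Finset.sum_image hinj]
    _ ≤ ∑ l ∈ (Finset.range (m + 1)).biUnion fun k => listsOf (ℬ.disjSum 𝒦) k,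
          listWeight r p N l Y * N ^ E := by
        refine Finset.sum_le_sum_of_subset_of_nonneg (Finset.image_subset_iff.2 hfm) fun _ _ _ => ?_
        exact mul_nonneg (h.listWeight_nonneg _ _) (zpow_nonneg hN.le _)
    _ = (∑ k ∈ Finset.range (m + 1), ∑ l ∈ listsOf (ℬ.disjSum 𝒦) k,
          listWeight r p N l Y) * N ^ E := by
        rw [Finset.sum_biUnion, Finset.sum_mul]
        · simp_rw [Finset.sum_mul]
        · intro k _ k' _ hkk
          refine Finset.disjoint_left.2 fun l hl hl' => hkk ?_
          rw [← ((mem_listsOf _ _ _).1 hl).1, ((mem_listsOf _ _ _).1 hl').1]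
    _ ≤ _ := by
        refine mul_le_mul_of_nonneg_right ?_ (zpow_nonneg hN.le _)
        calc _ ≤ ∑ k ∈ Finset.range (m + 1), B ^ m := by
              refine Finset.sum_le_sum fun k hk => ?_
              have hk' : k ≤ m := by simpa [Nat.lt_succ_iff] using hk
              refine (h.sum_listWeight_le k Y ?_).trans (pow_le_pow_right₀ h.one_le_B hk')
              have := Nat.mul_le_mul_right v₀ hk'
              omega
          _ = _ := by simp

/-- The expected number of structures whose first booster has a root with less than `r` known
vertices. -/
lemma sum_le_of_hasSparseOrder (h : StepBounds r ℬ 𝒦 p N B B₀ L v₀)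
    (𝓔 : Finset (Finset (RootedBooster V) × Finset (Set (Set V))))
    {Y : Finset V} {E : ℤ} {m : ℕ}
    (hℬ : ∀ e ∈ 𝓔, e.1 ⊆ ℬ) (h𝒦 : ∀ e ∈ 𝓔, e.2 ⊆ 𝒦)
    (hm : ∀ e ∈ 𝓔, e.1.card + e.2.card ≤ m + 1) (hY : Y.card + (m + 1) * v₀ ≤ L)
    (hE : ∀ e ∈ 𝓔, HasSparseOrder r e.1 e.2 Y E) :
    ∑ e ∈ 𝓔, p ^ e.1.card ≤ (m + 1) * (B₀ * B ^ m) * N ^ E := by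
  have hN : 0 < N := by linarith [h.one_le_N]
  have : Nonempty (RootedBooster V) := ⟨⟨∅, ∅, ∅, ∅, ∅⟩⟩
  choose! b f hf1 hf2 hf3 hf4 using hE
  have hmem : ∀ e ∈ 𝓔, ∀ x ∈ Sum.inl (b e) :: f e, x ∈ ℬ.disjSum 𝒦 := by
    intro e he x hx
    have : x ∈ (Sum.inl (b e) :: f e).toFinset := by simpa using hx
    rw [hf2 e he] at this
    exact Finset.disjSum_mono (hℬ e he) (h𝒦 e he) this
  set T := (ℬ.filter fun b => (rootVerts b ∩ Y).card < r) ×ˢ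
    ((Finset.range (m + 1)).biUnion fun k => listsOf (ℬ.disjSum 𝒦) k) with hT
  have hfm : ∀ e ∈ 𝓔, (b e, f e) ∈ T := by
    intro e he
    rw [hT, Finset.mem_product, Finset.mem_filter, Finset.mem_biUnion]
    refine ⟨⟨by simpa using hmem e he (Sum.inl (b e)) (by simp), hf3 e he⟩, (f e).length, ?_,
      (mem_listsOf _ _ _).2 ⟨rfl, fun x hx => hmem e he x (by simp [hx])⟩⟩
    have h1 := length_eq (hf1 e he) (hf2 e he)
    rw [List.length_cons] at h1
    have := hm e he
    rw [Finset.mem_range]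
    omega
  have hinj : Set.InjOn (fun e => (b e, f e)) 𝓔 := fun e he e' he' hee => by
    simp only [Prod.mk.injEq] at hee
    refine eq_of_toFinset_eq (A := ∅) (by simp) (by simp) ?_
    rw [Finset.sdiff_empty, Finset.sdiff_empty, ← hf2 e he, ← hf2 e' he', hee.1, hee.2]
  calc ∑ e ∈ 𝓔, p ^ e.1.card ≤
        ∑ e ∈ 𝓔, listWeight r p N (Sum.inl (b e) :: f e) Y * N ^ E := by
        refine Finset.sum_le_sum fun e he => ?_
        rw [listWeight, prod_stepProb (hf1 e he) (hf2 e he), mul_assoc, ← zpow_add₀ hN.ne']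
        refine le_mul_of_one_le_right (pow_nonneg h.p_nonneg _) (one_le_zpow₀ h.one_le_N ?_)
        linarith [hf4 e he]
    _ = ∑ x ∈ 𝓔.image (fun e => (b e, f e)),
          listWeight r p N (Sum.inl x.1 :: x.2) Y * N ^ E := by rw [Finset.sum_image hinj]
    _ ≤ ∑ x ∈ T, listWeight r p N (Sum.inl x.1 :: x.2) Y * N ^ E := by
        refine Finset.sum_le_sum_of_subset_of_nonneg (Finset.image_subset_iff.2 hfm) fun _ _ _ => ?_
        exact mul_nonneg (h.listWeight_nonneg _ _) (zpow_nonneg hN.le _)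
    _ = (∑ k ∈ Finset.range (m + 1), ∑ b ∈ ℬ with (rootVerts b ∩ Y).card < r,
          ∑ l ∈ listsOf (ℬ.disjSum 𝒦) k, listWeight r p N (Sum.inl b :: l) Y) * N ^ E := by
        rw [← Finset.sum_mul, hT, Finset.sum_product, Finset.sum_comm' (t' := ℬ.filter fun b =>
          (rootVerts b ∩ Y).card < r) (s' := fun _ => Finset.range (m + 1)) (by simp)]
        congr 1
        refine Finset.sum_congr rfl fun b _ => ?_
        rw [Finset.sum_biUnion]
        intro k _ k' _ hkk
        refine Finset.disjoint_left.2 fun l hl hl' => hkk ?_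
        rw [← ((mem_listsOf _ _ _).1 hl).1, ((mem_listsOf _ _ _).1 hl').1]
    _ ≤ _ := by
        refine mul_le_mul_of_nonneg_right ?_ (zpow_nonneg hN.le _)
        calc _ ≤ ∑ k ∈ Finset.range (m + 1), B₀ * B ^ m := by
              refine Finset.sum_le_sum fun k hk => ?_
              have hk' : k ≤ m := by simpa [Nat.lt_succ_iff] using hk
              refine (h.sum_listWeight_sparse_le k Y ?_).trans
                (mul_le_mul_of_nonneg_left (pow_le_pow_right₀ h.one_le_B hk') h.B₀_nonneg)
              have := Nat.mul_le_mul_right v₀ (Nat.succ_le_succ hk')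
              simp only [Nat.succ_eq_add_one] at this
              omega
          _ = _ := by simp

end StepBounds
end Sums

/-! ### Counting cliques and boosters -/

section Counting
variable {V : Type*}

lemma encard_coe_eq {s : Finset V} {k : ℕ} : (s : Set V).encard = k ↔ s.card = k := by
  rw [Set.encard_coe_eq_coe_finsetCard]; norm_cast

lemma sUnion_complete {q r : ℕ} (hr : 1 ≤ r) (hqr : r ≤ q) {Q : Set V} (hQ : Q.encard = q) :
    ⋃₀ complete r Q = Q := by
  apply Set.Subset.antisymm
  · exact Set.sUnion_subset fun e he => he.1
  · intro x hx
    obtain ⟨e, hxe, heQ, he⟩ := Set.exists_superset_subset_encard_eq (s := {x}) (t := Q) (k := r)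
      (by simpa) (by simpa using hr) (by rw [hQ]; exact_mod_cast hqr)
    exact ⟨e, ⟨heQ, he⟩, hxe rfl⟩

variable [Fintype V]

lemma coe_cliqueVerts (K : Set (Set V)) : (cliqueVerts K : Set V) = ⋃₀ K := by
  simp [cliqueVerts]

lemma coe_spanVerts (S : Finset (Set (Set V))) : (spanVerts S : Set V) = spanned (S : Set _) := by
  ext x
  simp only [spanVerts, Finset.coe_biUnion, coe_cliqueVerts, spanned, Set.mem_iUnion,
    Set.mem_sUnion, Finset.mem_coe, exists_prop]
  constructor
  · rintro ⟨K, hK, e, he, hx⟩; exact ⟨e, ⟨K, hK, he⟩, hx⟩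
  · rintro ⟨e, ⟨K, hK, he⟩, hx⟩; exact ⟨K, hK, e, he, hx⟩

lemma IsClique.eq_complete {q r : ℕ} (hr : 1 ≤ r) (hqr : r ≤ q) {K : Set (Set V)}
    (hK : IsClique q r K) : K = complete r (cliqueVerts K : Set V) := by
  obtain ⟨Q, hQ, rfl⟩ := hK
  rw [coe_cliqueVerts, sUnion_complete hr hqr hQ]

lemma IsClique.card_cliqueVerts {q r : ℕ} (hr : 1 ≤ r) (hqr : r ≤ q) {K : Set (Set V)}
    (hK : IsClique q r K) : (cliqueVerts K).card = q := by
  obtain ⟨Q, hQ, rfl⟩ := hK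
  rwa [← encard_coe_eq, coe_cliqueVerts, sUnion_complete hr hqr hQ]

lemma IsClique.mem_iff {q r : ℕ} (hr : 1 ≤ r) (hqr : r ≤ q) {K : Set (Set V)}
    (hK : IsClique q r K) {e : Finset V} : (e : Set V) ∈ K ↔ e ⊆ cliqueVerts K ∧ e.card = r := by
  conv_lhs => rw [hK.eq_complete hr hqr]
  rw [complete, Set.mem_ofPred_eq, encard_coe_eq, Finset.coe_subset]

lemma IsClique.injOn_cliqueVerts {q r : ℕ} (hr : 1 ≤ r) (hqr : r ≤ q) :
    Set.InjOn (cliqueVerts (V := V)) {K | IsClique q r K} := fun K hK K' hK' h => by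
  rw [IsClique.eq_complete hr hqr hK, h, ← IsClique.eq_complete hr hqr hK']

/-- The number of `k`-sets that contain a given set. -/
lemma card_supersets_le (T : Finset V) (k : ℕ) :
    ((Finset.powersetCard k Finset.univ).filter fun S => T ⊆ S).card ≤
      Fintype.card V ^ (k - T.card) := by
  refine (Finset.card_le_card_of_injOn (t := Finset.powersetCard (k - T.card) Finset.univ)
    (fun S => S \ T) ?_ ?_).trans ?_
  · intro S hS
    simp only [Finset.coe_filter, Finset.mem_powersetCard, Finset.subset_univ, true_and,
      Set.mem_ofPred_eq, Finset.mem_coe] at hS ⊢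
    rw [Finset.card_sdiff_of_subset hS.2, hS.1]
  · intro S hS S' hS' h
    simp only [Finset.coe_filter, Set.mem_ofPred_eq] at hS hS' h
    rw [← Finset.union_sdiff_of_subset hS.2, h, Finset.union_sdiff_of_subset hS'.2]
  · rw [Finset.card_powersetCard, Finset.card_univ]
    exact Nat.choose_le_pow _ _

/-- The expected number of choices of a clique, relative to `N ^ stepExp`. -/
lemma sum_clique_le {q r : ℕ} (hr : 1 ≤ r) (hqr : r ≤ q) (𝒦 : Finset (Set (Set V)))
    (h𝒦 : ∀ K ∈ 𝒦, IsClique q r K) (hN : 1 ≤ Fintype.card V) (Y : Finset V) :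
    ∑ K ∈ 𝒦, (Fintype.card V : ℝ) ^ (-stepExp 0 (.inr K) Y) ≤ 2 ^ Y.card := by
  have hN0 : (0 : ℝ) < Fintype.card V := by exact_mod_cast hN
  rw [← Finset.sum_fiberwise_of_maps_to (t := Y.powerset) (g := fun K => cliqueVerts K ∩ Y)
    (by simp)]
  refine (Finset.sum_le_card_nsmul _ _ 1 fun T hT => ?_).trans (by simp)
  calc _ = ∑ K ∈ 𝒦 with cliqueVerts K ∩ Y = T, (Fintype.card V : ℝ) ^ (-((q - T.card : ℕ) : ℤ)) := by
        refine Finset.sum_congr rfl fun K hK => ?_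
        rw [Finset.mem_filter] at hK
        have h1 := Finset.card_inter_add_card_sdiff (cliqueVerts K) Y
        rw [(h𝒦 K hK.1).card_cliqueVerts hr hqr, hK.2] at h1
        have h2 : (cliqueVerts K \ Y).card = q - T.card := by omega
        rw [stepExp, h2]
    _ ≤ (Fintype.card V : ℝ) ^ (q - T.card) * (Fintype.card V : ℝ) ^ (-((q - T.card : ℕ) : ℤ)) := by
        rw [Finset.sum_const, nsmul_eq_mul]
        refine mul_le_mul_of_nonneg_right ?_ (zpow_nonneg hN0.le _)
        norm_cast
        refine (Finset.card_le_card_of_injOn cliqueVerts ?_ ?_).trans (card_supersets_le T q)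
        · intro K hK
          simp only [Finset.coe_filter, Set.mem_ofPred_eq, Finset.mem_powersetCard,
            Finset.subset_univ, true_and] at hK ⊢
          exact ⟨(h𝒦 K hK.1).card_cliqueVerts hr hqr, hK.2 ▸ Finset.inter_subset_left⟩
        · exact (IsClique.injOn_cliqueVerts hr hqr).mono fun K hK => h𝒦 K
            (Finset.mem_filter.1 hK).1
    _ = 1 := by
        rw [zpow_neg, zpow_natCast, mul_inv_cancel₀ (pow_ne_zero _ hN0.ne')]

/-- The boosters of the collection, from which the random sparsification chooses: they are rooted
at the members of `𝓗`, and a booster is determined by its root and its other vertices. -/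
structure BoosterFamily (q k : ℕ) (𝓗 : Finset (Set (Set V))) (ℬ : Finset (RootedBooster V)) :
    Prop where
  root_mem : ∀ b ∈ ℬ, b.root ∈ 𝓗
  card_rootVerts : ∀ b ∈ ℬ, (rootVerts b).card = q
  rootVerts_subset : ∀ b ∈ ℬ, rootVerts b ⊆ boosterVerts b
  card_boosterVerts : ∀ b ∈ ℬ, (boosterVerts b).card = q + k
  eq_of_verts : ∀ b ∈ ℬ, ∀ b' ∈ ℬ, b.root = b'.root → boosterVerts b = boosterVerts b' → b = b'

namespace BoosterFamily

variable {q k : ℕ} {𝓗 : Finset (Set (Set V))} {ℬ : Finset (RootedBooster V)}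

/-- A booster is given by its root and the set of its other vertices. -/
lemma card_le (h : BoosterFamily q k 𝓗 ℬ) (U T : Finset V) :
    (ℬ.filter fun b => U ⊆ rootVerts b ∧ T ⊆ boosterVerts b \ rootVerts b).card ≤
      (𝓗.filter fun H => U ⊆ cliqueVerts H).card * Fintype.card V ^ (k - T.card) := by
  refine (Finset.card_le_card_of_injOn (t := (𝓗.filter fun H => U ⊆ cliqueVerts H) ×ˢ
    ((Finset.powersetCard k Finset.univ).filter fun S => T ⊆ S))
    (fun b => (b.root, boosterVerts b \ rootVerts b)) ?_ ?_).trans ?_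
  · intro b hb
    simp only [Finset.coe_filter, Set.mem_ofPred_eq, Finset.coe_product, Set.mem_prod,
      Finset.mem_powersetCard, Finset.subset_univ, true_and] at hb ⊢
    refine ⟨⟨h.root_mem b hb.1, hb.2.1⟩, ?_, hb.2.2⟩
    rw [Finset.card_sdiff_of_subset (h.rootVerts_subset b hb.1), h.card_boosterVerts b hb.1,
      h.card_rootVerts b hb.1, Nat.add_sub_cancel_left]
  · intro b hb b' hb' hbb
    simp only [Finset.coe_filter, Set.mem_ofPred_eq, Prod.mk.injEq] at hb hb' hbb
    refine h.eq_of_verts b hb.1 b' hb'.1 hbb.1 ?_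
    have h1 : rootVerts b = rootVerts b' := congrArg cliqueVerts hbb.1
    rw [← Finset.union_sdiff_of_subset (h.rootVerts_subset b hb.1), hbb.2, h1,
      Finset.union_sdiff_of_subset (h.rootVerts_subset b' hb'.1)]
  · rw [Finset.card_product]
    exact Nat.mul_le_mul_left _ (card_supersets_le T k)

/-- The expected number of choices of a booster whose root meets `Y` in a member of `𝒰`, relative
to `N ^ stepExp`. -/
lemma sum_booster_le (h : BoosterFamily q k 𝓗 ℬ) {r : ℕ} {p c : ℝ} (hp : 0 ≤ p)
    (hN : 1 ≤ Fintype.card V) (Y : Finset V) (𝒰 : Finset (Finset V))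
    (hc : ∀ U ∈ 𝒰, p * (Fintype.card V : ℝ) ^ k *
      ((𝓗.filter fun H => U ⊆ cliqueVerts H).card : ℝ) ≤ c * (Fintype.card V : ℝ) ^ (r - U.card)) :
    ∑ b ∈ ℬ with rootVerts b ∩ Y ∈ 𝒰, p * (Fintype.card V : ℝ) ^ (-stepExp r (.inl b) Y) ≤
      𝒰.card * 2 ^ Y.card * c := by
  set N : ℝ := ((Fintype.card V : ℕ) : ℝ) with hNdef
  have hN0 : (0 : ℝ) < N := by rw [hNdef]; exact_mod_cast hN
  rw [← Finset.sum_fiberwise_of_maps_to (t := 𝒰 ×ˢ Y.powerset)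
    (g := fun b => (rootVerts b ∩ Y, (boosterVerts b ∩ Y) \ rootVerts b))]
  swap
  · intro b hb
    simp only [Finset.mem_filter, Finset.mem_product, Finset.mem_powerset] at hb ⊢
    exact ⟨hb.2, Finset.sdiff_subset.trans Finset.inter_subset_right⟩
  refine (Finset.sum_le_card_nsmul _ _ c fun x hx => ?_).trans (by simp)
  obtain ⟨U, T⟩ := x
  rw [Finset.mem_product] at hx
  have hcU := hc U hx.1
  simp only at hx ⊢
  set 𝒮 := (ℬ.filter fun b => rootVerts b ∩ Y ∈ 𝒰).filter fun b =>
    (rootVerts b ∩ Y, (boosterVerts b ∩ Y) \ rootVerts b) = (U, T) with h𝒮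
  have hmem : ∀ b ∈ 𝒮, b ∈ ℬ ∧ rootVerts b ∩ Y = U ∧ (boosterVerts b ∩ Y) \ rootVerts b = T := by
    intro b hb
    simp only [h𝒮, Finset.mem_filter, Prod.mk.injEq] at hb
    tauto
  rcases 𝒮.eq_empty_or_nonempty with h0 | ⟨b₀, hb₀⟩
  · rw [h0, Finset.sum_empty]
    have h1 : 0 ≤ c * N ^ (r - U.card) := le_trans (by positivity) hcU
    exact nonneg_of_mul_nonneg_left h1 (by positivity)
  have hTk : T.card ≤ k := by
    obtain ⟨hb, -, hT⟩ := hmem b₀ hb₀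
    have h1 : T ⊆ boosterVerts b₀ \ rootVerts b₀ := hT ▸
      Finset.sdiff_subset_sdiff Finset.inter_subset_left subset_rfl
    have := Finset.card_le_card h1
    rw [Finset.card_sdiff_of_subset (h.rootVerts_subset b₀ hb), h.card_boosterVerts b₀ hb,
      h.card_rootVerts b₀ hb] at this
    omega
  have hcard : (𝒮.card : ℝ) ≤ ((𝓗.filter fun H => U ⊆ cliqueVerts H).card : ℝ) *
      N ^ (k - T.card) := by
    rw [hNdef]
    norm_cast
    refine (Finset.card_le_card fun b hb => ?_).trans (h.card_le U T)
    obtain ⟨hb, hU, hT⟩ := hmem b hb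
    refine Finset.mem_filter.2 ⟨hb, hU ▸ Finset.inter_subset_left, hT ▸ ?_⟩
    exact Finset.sdiff_subset_sdiff Finset.inter_subset_left subset_rfl
  calc _ = ∑ b ∈ 𝒮, p * (N ^ T.card / N ^ (r - U.card)) := by
        refine Finset.sum_congr rfl fun b hb => ?_
        obtain ⟨-, hU, hT⟩ := hmem b hb
        rw [stepExp, hU, hT, neg_sub, zpow_sub₀ hN0.ne', zpow_natCast, zpow_natCast]
    _ = 𝒮.card * (p * (N ^ T.card / N ^ (r - U.card))) := by
        rw [Finset.sum_const, nsmul_eq_mul]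
    _ ≤ (((𝓗.filter fun H => U ⊆ cliqueVerts H).card : ℝ) * N ^ (k - T.card)) *
          (p * (N ^ T.card / N ^ (r - U.card))) := by gcongr
    _ = (p * N ^ k * ((𝓗.filter fun H => U ⊆ cliqueVerts H).card : ℝ)) / N ^ (r - U.card) := by
        have : N ^ k = N ^ (k - T.card) * N ^ T.card := by
          rw [← pow_add, Nat.sub_add_cancel hTk]
        rw [this]; ring
    _ ≤ c := by rwa [div_le_iff₀ (by positivity)]

/-- The bounds for a single step, from the number of roots that contain given vertices. Here `c'`
is an upper bound for `p * N ^ k`, and `lam` is the density of the reserve and the absorber. -/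
lemma stepBounds (h : BoosterFamily q k 𝓗 ℬ) {r : ℕ} (hr : 1 ≤ r) (hqr : r ≤ q)
    (𝒦 : Finset (Set (Set V))) (h𝒦 : ∀ K ∈ 𝒦, IsClique q r K)
    (hN : 1 ≤ Fintype.card V) {p c c' lam : ℝ} (L : ℕ) (hp : 0 ≤ p)
    (hpk : p * (Fintype.card V : ℝ) ^ k ≤ c') (hlam0 : 0 ≤ lam) (hlam : lam ≤ 1) (hc0 : 0 ≤ c)
    (hc' : 1 ≤ c')
    (hsparse : ∀ U : Finset V, U.card < r → ((𝓗.filter fun H => U ⊆ cliqueVerts H).card : ℝ) ≤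
      c * lam * (Fintype.card V : ℝ) ^ (r - U.card))
    (hdense : ∀ U : Finset V, r ≤ U.card → ((𝓗.filter fun H => U ⊆ cliqueVerts H).card : ℝ) ≤ c) :
    StepBounds r ℬ 𝒦 p (Fintype.card V) (4 ^ L * (c + 1) * c') (4 ^ L * (c + 1) * c' * lam) L
      (q + k) where
  p_nonneg := hp
  one_le_N := by exact_mod_cast hN
  one_le_B := by
    have : (1 : ℝ) ≤ 4 ^ L := one_le_pow₀ (by norm_num)
    nlinarith [mul_nonneg hc0 (by linarith : 0 ≤ c'), mul_le_mul this (le_add_of_nonneg_left hc0)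
      zero_le_one (by linarith)]
  B₀_nonneg := by positivity
  card_booster := fun b hb => (h.card_boosterVerts b hb).le
  card_clique := fun K hK => by rw [(h𝒦 K hK).card_cliqueVerts hr hqr]; omega
  sum_le := by
    intro Y hY
    rw [Finset.sum_disjSum]
    have h1 := sum_clique_le hr hqr 𝒦 h𝒦 hN Y
    have h2 := h.sum_booster_le (r := r) (c := c' * c) hp hN Y Y.powerset (by
      intro U _
      have hpow : (1 : ℝ) ≤ (Fintype.card V : ℝ) ^ (r - U.card) :=
        one_le_pow₀ (by exact_mod_cast hN)
      rcases Nat.lt_or_ge U.card r with hU | hU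
      · calc _ ≤ c' * (c * lam * (Fintype.card V : ℝ) ^ (r - U.card)) := by
              gcongr; exact hsparse U hU
          _ ≤ c' * (c * 1 * (Fintype.card V : ℝ) ^ (r - U.card)) := by gcongr
          _ = _ := by ring
      · calc _ ≤ c' * c := by gcongr; exact hdense U hU
          _ ≤ _ := le_mul_of_one_le_right (by positivity) hpow)
    have h3 : (ℬ.filter fun b => rootVerts b ∩ Y ∈ Y.powerset) = ℬ := by
      refine Finset.filter_true_of_mem fun b _ => ?_
      simp
    rw [h3, Finset.card_powerset] at h2
    have h4 : (2 : ℝ) ^ Y.card ≤ 2 ^ L := pow_le_pow_right₀ (by norm_num) hY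
    have h5 : (2 : ℝ) ^ L ≤ 4 ^ L := pow_le_pow_left₀ (by norm_num) (by norm_num) _
    have h6 : (4 : ℝ) ^ L = 2 ^ L * 2 ^ L := by rw [← mul_pow]; norm_num
    calc _ ≤ ((2 ^ Y.card : ℕ) : ℝ) * 2 ^ Y.card * (c' * c) + 2 ^ Y.card := by
          refine add_le_add h2 ?_
          simpa [stepProb, stepExp] using h1
      _ ≤ 4 ^ L * (c' * c) + 4 ^ L * c' := by
          push_cast
          rw [h6]
          have : (2 : ℝ) ^ Y.card ≤ 2 ^ L * 2 ^ L * c' := by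
            calc (2 : ℝ) ^ Y.card ≤ 2 ^ L * 2 ^ L := by rw [← h6]; linarith
              _ ≤ _ := le_mul_of_one_le_right (by positivity) hc'
          gcongr
      _ = _ := by ring
  sum_sparse_le := by
    intro Y hY
    have h2 := h.sum_booster_le (r := r) (c := c' * (c * lam)) hp hN Y
      (Y.powerset.filter fun U => U.card < r) (by
      intro U hU
      calc _ ≤ c' * (c * lam * (Fintype.card V : ℝ) ^ (r - U.card)) := by
            gcongr; exact hsparse U (Finset.mem_filter.1 hU).2
        _ = _ := by ring)
    have h3 : (ℬ.filter fun b => rootVerts b ∩ Y ∈ Y.powerset.filter fun U => U.card < r) =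
        ℬ.filter fun b => (rootVerts b ∩ Y).card < r := by
      refine Finset.filter_congr fun b _ => ?_
      simp
    rw [h3] at h2
    have h4 : (2 : ℝ) ^ Y.card ≤ 2 ^ L := pow_le_pow_right₀ (by norm_num) hY
    have h6 : (4 : ℝ) ^ L = 2 ^ L * 2 ^ L := by rw [← mul_pow]; norm_num
    have h7 : ((Y.powerset.filter fun U => U.card < r).card : ℝ) ≤ 2 ^ L := by
      refine le_trans ?_ h4
      have := Finset.card_filter_le Y.powerset fun U => U.card < r
      rw [Finset.card_powerset] at this
      exact_mod_cast this
    calc _ ≤ _ := h2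
      _ ≤ 2 ^ L * 2 ^ L * (c' * (c * lam)) := by gcongr
      _ ≤ 2 ^ L * 2 ^ L * (c' * ((c + 1) * lam)) := by gcongr; linarith
      _ = _ := by rw [h6]; ring

end BoosterFamily
end Counting

section Counting
variable {V : Type*} [Fintype V]

lemma codegree_le_maxCodegree {α : Type*} [Finite α] (E : Set (Set α)) {U : Set α} {t : ℕ}
    (hU : U.encard = t) : codegree E U ≤ maxCodegree E t :=
  le_ciSup (f := fun U : {U : Set α // U.encard = t} => codegree E U.1)
    (Set.finite_range _).bddAbove ⟨U, hU⟩

lemma maxCodegree_le {α : Type*} {E : Set (Set α)} {t : ℕ} {x : ℝ} (hx : 0 ≤ x)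
    (h : ∀ U : Set α, U.encard = t → (codegree E U : ℝ) ≤ x) : (maxCodegree E t : ℝ) ≤ x := by
  have h1 : maxCodegree E t ≤ ⌊x⌋₊ := ciSup_le' fun U => Nat.le_floor (h U.1 U.2)
  exact (Nat.le_floor_iff hx).1 h1

lemma codegree_mono {α : Type*} [Finite α] {E E' : Set (Set α)} (h : E ⊆ E') (U : Set α) :
    codegree E U ≤ codegree E' U :=
  Set.ncard_le_ncard (fun _ he => ⟨h he.1, he.2⟩) (Set.toFinite _)

lemma maxCodegree_mono {α : Type*} [Finite α] {E E' : Set (Set α)} (h : E ⊆ E') (t : ℕ) :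
    maxCodegree E t ≤ maxCodegree E' t :=
  ciSup_le' fun U => (codegree_mono h U.1).trans (codegree_le_maxCodegree E' U.2)

/-- The number of cliques of `𝓗` that contain given vertices. If there are at least `r` of them,
then some edge of the reserve or the absorber is determined. -/
lemma card_roots_le_of_dense {q r C : ℕ} (hr : 1 ≤ r) (hqr : r ≤ q) {E : Set (Set V)}
    {𝓗 : Finset (Set (Set V))} (h𝓗 : ∀ H ∈ 𝓗, IsClique q r H ∧ H ⊆ E)
    (hC : ∀ e ∈ E, (𝓗.filter fun H => e ∈ H).card ≤ C) {U : Finset V} (hU : r ≤ U.card) :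
    (𝓗.filter fun H => U ⊆ cliqueVerts H).card ≤ C := by
  obtain ⟨e, heU, he⟩ := Finset.exists_subset_card_eq hU
  rcases (𝓗.filter fun H => U ⊆ cliqueVerts H).eq_empty_or_nonempty with h0 | ⟨H, hH⟩
  · simp [h0]
  have hmem : ∀ H ∈ 𝓗.filter fun H => U ⊆ cliqueVerts H, (e : Set V) ∈ H := fun H hH => by
    rw [Finset.mem_filter] at hH
    exact ((h𝓗 H hH.1).1.mem_iff hr hqr).2 ⟨heU.trans hH.2, he⟩
  refine (Finset.card_le_card fun H hH => ?_).trans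
    (hC e ((h𝓗 H (Finset.mem_filter.1 hH).1).2 (hmem H hH)))
  exact Finset.mem_filter.2 ⟨(Finset.mem_filter.1 hH).1, hmem H hH⟩

/-- The number of edges of an `r`-graph that contain given vertices. -/
lemma card_edges_le {r D : ℕ} {E : Set (Set V)} (hr : 1 ≤ r)
    (hD : ∀ W : Finset V, W.card = r - 1 → codegree E (W : Set V) ≤ D)
    {U : Finset V} (hU : U.card < r) :
    ((Finset.powersetCard r Finset.univ).filter fun e : Finset V => (e : Set V) ∈ E ∧ U ⊆ e).card ≤
      Fintype.card V ^ (r - 1 - U.card) * D := by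
  refine (Finset.card_le_card (t := ((Finset.powersetCard (r - 1) Finset.univ).filter fun S =>
    U ⊆ S).biUnion fun W => (Finset.univ : Finset (Finset V)).filter fun e : Finset V =>
      (e : Set V) ∈ E ∧ W ⊆ e) ?_).trans (Finset.card_biUnion_le.trans ?_)
  · intro e he
    simp only [Finset.mem_filter, Finset.mem_powersetCard, Finset.subset_univ, true_and,
      Finset.mem_biUnion, Finset.mem_univ] at he ⊢
    obtain ⟨W, hUW, hWe, hW⟩ := Finset.exists_subsuperset_card_eq he.2.2
      (n := r - 1) (by omega) (by omega)
    exact ⟨W, ⟨hW, hUW⟩, he.2.1, hWe⟩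
  · refine (Finset.sum_le_card_nsmul _ _ D fun W hW => ?_).trans ?_
    · simp only [Finset.mem_filter, Finset.mem_powersetCard, Finset.subset_univ, true_and] at hW
      refine le_trans ?_ (hD W hW.1)
      rw [codegree, ← Set.ncard_coe_finset]
      refine Set.ncard_le_ncard_of_injOn (fun e : Finset V => (e : Set V)) ?_
        (fun _ _ _ _ h => by simpa using h) (Set.toFinite _)
      intro e he
      simpa using he
    · rw [smul_eq_mul]
      exact Nat.mul_le_mul_right _ (card_supersets_le U (r - 1))

/-- The number of cliques of `𝓗` that contain less than `r` given vertices. -/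
lemma card_roots_le_of_sparse {q r C D : ℕ} (hr : 1 ≤ r) (hqr : r ≤ q) {E : Set (Set V)}
    {𝓗 : Finset (Set (Set V))} (h𝓗 : ∀ H ∈ 𝓗, IsClique q r H ∧ H ⊆ E)
    (hC : ∀ e ∈ E, (𝓗.filter fun H => e ∈ H).card ≤ C)
    (hD : ∀ W : Finset V, W.card = r - 1 → codegree E (W : Set V) ≤ D)
    {U : Finset V} (hU : U.card < r) :
    (𝓗.filter fun H => U ⊆ cliqueVerts H).card ≤ Fintype.card V ^ (r - 1 - U.card) * D * C := by
  refine (Finset.card_le_card (t := ((Finset.powersetCard r Finset.univ).filter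
    fun e : Finset V => (e : Set V) ∈ E ∧ U ⊆ e).biUnion fun e =>
      𝓗.filter fun H => (e : Set V) ∈ H) ?_).trans (Finset.card_biUnion_le.trans ?_)
  · intro H hH
    simp only [Finset.mem_filter, Finset.mem_powersetCard, Finset.subset_univ, true_and,
      Finset.mem_biUnion] at hH ⊢
    obtain ⟨hHcl, hHE⟩ := h𝓗 H hH.1
    obtain ⟨e, hUe, heH, he⟩ := Finset.exists_subsuperset_card_eq hH.2
      (n := r) hU.le (by rw [hHcl.card_cliqueVerts hr hqr]; exact hqr)
    have := (hHcl.mem_iff hr hqr).2 ⟨heH, he⟩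
    exact ⟨e, ⟨he, hHE this, hUe⟩, hH.1, this⟩
  · refine (Finset.sum_le_card_nsmul _ _ C fun e he => hC _ ?_).trans ?_
    · exact (Finset.mem_filter.1 he).2.1
    · rw [smul_eq_mul]
      exact Nat.mul_le_mul_right _ (card_edges_le hr hD hU)

end Counting

/-! ### Copies of a booster -/

lemma mem_spanned {V : Type*} {F : Set (Set (Set V))} {x : V} :
    x ∈ spanned F ↔ ∃ K ∈ F, ∃ e ∈ K, x ∈ e := by
  constructor
  · rintro ⟨e, ⟨K, hK, he⟩, hx⟩
    exact ⟨K, hK, e, he, hx⟩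
  · rintro ⟨K, hK, e, he, hx⟩
    exact ⟨e, ⟨K, hK, he⟩, hx⟩

lemma spanned_image {V W : Type*} (φ : W → V) (P : Set (Set (Set W))) :
    spanned (Set.image (Set.image φ) '' P) = φ '' spanned P := by
  ext x
  simp only [mem_spanned, Set.mem_image]
  constructor
  · rintro ⟨_, ⟨K, hK, rfl⟩, _, ⟨e, he, rfl⟩, y, hy, rfl⟩
    exact ⟨y, ⟨K, hK, e, he, hy⟩, rfl⟩
  · rintro ⟨y, ⟨K, hK, e, he, hy⟩, rfl⟩
    exact ⟨_, ⟨K, hK, rfl⟩, _, ⟨e, he, rfl⟩, y, hy, rfl⟩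

section Copies
variable {V W : Type*} [Fintype V]

instance : Finite (RootedBooster V) := by
  refine Finite.of_injective (β := Set V × Set (Set V) × Set (Set V) × Set (Set (Set V)) ×
    Set (Set (Set V))) (fun b => (b.verts, b.edges, b.root, b.off, b.on)) ?_
  rintro ⟨⟩ ⟨⟩ h
  simpa using h

/-- Few cliques of a booster of rooted girth at least `g` span many vertices outside its root. For
cliques of `B_off`, this is a property of the configuration that they form with the root. -/
lemma RootedBooster.IsRootedBooster.le_encard_spanned_diff {q r g : ℕ} (hr : 1 ≤ r) (hqr : r ≤ q)
    {B₀ : RootedBooster W} (hB₀ : B₀.IsRootedBooster q r) (hg : (g : ℕ∞) ≤ B₀.rootedGirth q r)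
    {P : Set (Set (Set W))} {i : ℕ} (hP : P ⊆ B₀.on ∨ P ⊆ B₀.off) (hi : P.encard = i)
    (hi1 : 1 ≤ i) (hig : i + 1 < g) :
    ((i * (q - r) : ℕ) : ℕ∞) ≤ (spanned P \ ⋃₀ B₀.root).encard := by
  simp only [RootedBooster.rootedGirth, le_min_iff] at hg
  obtain ⟨⟨-, hoff⟩, hon⟩ := hg
  by_contra! hlt
  rcases hP with hP | hP
  · rw [packingRootedGirth, le_iInf₂_iff] at hon
    have h1 := hon i ⟨hi1, P, hP, hi, by rwa [mul_comm]⟩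
    have : g ≤ i := by exact_mod_cast h1
    omega
  · rw [packingGirth, le_iInf₂_iff] at hoff
    obtain ⟨Q, hQ, hroot⟩ := hB₀.isClique_root
    have hQr : ⋃₀ B₀.root = Q := by rw [hroot, sUnion_complete hr hqr hQ]
    have hne : B₀.root.Nonempty := by
      rw [Set.nonempty_iff_ne_empty]
      intro h0
      rw [h0, Set.sUnion_empty] at hQr
      rw [← hQr, Set.encard_empty] at hQ
      have : q = 0 := by exact_mod_cast hQ.symm
      omega
    have hnot : B₀.root ∉ P := by
      intro hmem
      have h1 : B₀.root ⊆ B₀.edges := by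
        rw [← hB₀.off_decomp.2.2]; exact Set.subset_sUnion_of_mem (hP hmem)
      obtain ⟨e, he⟩ := hne
      exact (Set.disjoint_left.1 hB₀.disjoint_root (h1 he)) he
    have h1 := hoff (i + 1) ⟨by omega, insert B₀.root P, ?_, ?_, ?_⟩
    · have : g ≤ i + 1 := by exact_mod_cast h1
      omega
    · exact Set.insert_subset (Or.inr rfl) (hP.trans Set.subset_union_left)
    · rw [Set.encard_insert_of_notMem hnot, hi]; rfl
    · have h2 : spanned (insert B₀.root P) = Q ∪ (spanned P \ Q) := by
        rw [Set.union_sdiff_self, ← hQr]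
        simp [spanned, Set.sUnion_union]
      rw [h2]
      rw [hQr] at hlt
      refine (Set.encard_union_le _ _).trans ?_
      rw [hQ]
      calc (q : ℕ∞) + (spanned P \ Q).encard ≤ q + ((i * (q - r) : ℕ) : ℕ∞) := by
            gcongr
        _ = (((i + 1) * (q - r) + r : ℕ) : ℕ∞) := by
            norm_cast
            rw [add_mul, one_mul]
            omega

end Copies

section Copies
variable {V W : Type*} [Fintype V]

lemma RootedBooster.IsRootedBooster.spanned_subset {q r : ℕ} {B₀ : RootedBooster W}
    (hB₀ : B₀.IsRootedBooster q r) {P : Set (Set (Set W))} (hP : P ⊆ B₀.on ∨ P ⊆ B₀.off) :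
    spanned P ⊆ B₀.verts := by
  intro x hx
  obtain ⟨K, hK, e, he, hx⟩ := mem_spanned.1 hx
  have h1 : e ∈ B₀.edges ∪ B₀.root := by
    rcases hP with hP | hP
    · rw [← hB₀.on_decomp.2.2]; exact ⟨K, hP hK, he⟩
    · left; rw [← hB₀.off_decomp.2.2]; exact ⟨K, hP hK, he⟩
  rcases h1 with h1 | h1
  · exact hB₀.edges_subset ⟨e, h1, hx⟩
  · exact hB₀.root_subset ⟨e, h1, hx⟩

lemma RootedBooster.sUnion_root_map {V W : Type*} (φ : W → V) (B₀ : RootedBooster W) :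
    ⋃₀ (B₀.map φ).root = φ '' ⋃₀ B₀.root := by
  rw [Set.sUnion_eq_biUnion, Set.sUnion_eq_biUnion, Set.image_iUnion₂]
  simp only [RootedBooster.map, Set.biUnion_image]

/-- What is needed to know about a part `P` of one of the two packings of a copy of `B₀`. -/
lemma spanVerts_of_copy {q r g : ℕ} (hr : 1 ≤ r) (hqr : r ≤ q) {B₀ : RootedBooster W}
    (hB₀ : B₀.IsRootedBooster q r) (hg : (g : ℕ∞) ≤ B₀.rootedGirth q r) {b : RootedBooster V}
    (hb : B₀.IsCopy b) {P : Finset (Set (Set V))}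
    (hP : (P : Set (Set (Set V))) ⊆ b.on ∨ (P : Set (Set (Set V))) ⊆ b.off) :
    spanVerts P ⊆ boosterVerts b ∧ (P.Nonempty → P.card + 1 < g →
      P.card * (q - r) ≤ (spanVerts P \ rootVerts b).card) := by
  obtain ⟨φ, hφ, rfl⟩ := hb
  obtain ⟨P₀, hP₀, hbij⟩ : ∃ P₀, (P₀ ⊆ B₀.on ∨ P₀ ⊆ B₀.off) ∧
      Set.BijOn (Set.image (Set.image φ)) P₀ (P : Set (Set (Set V))) := by
    rcases hP with hP | hP
    · obtain ⟨P₀, h1, h2⟩ := Set.SurjOn.exists_bijOn_subset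
        (f := Set.image (Set.image φ)) (s := B₀.on) (t := (P : Set (Set (Set V)))) hP
      exact ⟨P₀, Or.inl h1, h2⟩
    · obtain ⟨P₀, h1, h2⟩ := Set.SurjOn.exists_bijOn_subset
        (f := Set.image (Set.image φ)) (s := B₀.off) (t := (P : Set (Set (Set V)))) hP
      exact ⟨P₀, Or.inr h1, h2⟩
  have hspan : (spanVerts P : Set V) = φ '' spanned P₀ := by
    rw [coe_spanVerts, ← hbij.image_eq, spanned_image]
  have hsub := hB₀.spanned_subset hP₀
  constructor
  · rw [← Finset.coe_subset, hspan, boosterVerts, Set.coe_toFinset]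
    exact Set.image_mono hsub
  · intro hne hPg
    have hcard : P₀.encard = P.card := by
      rw [← Set.encard_coe_eq_coe_finsetCard, ← hbij.image_eq, hbij.injOn.encard_image]
    have h1 := hB₀.le_encard_spanned_diff hr hqr hg hP₀ hcard hne.card_pos hPg
    have h2 : ((spanVerts P \ rootVerts (B₀.map φ) : Finset V) : Set V) =
        φ '' (spanned P₀ \ ⋃₀ B₀.root) := by
      rw [Finset.coe_sdiff, hspan, rootVerts, coe_cliqueVerts, RootedBooster.sUnion_root_map]
      apply Set.Subset.antisymm
      · rintro _ ⟨⟨x, hx, rfl⟩, hx'⟩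
        exact ⟨x, ⟨hx, fun hxr => hx' ⟨x, hxr, rfl⟩⟩, rfl⟩
      · rintro _ ⟨x, ⟨hx, hxr⟩, rfl⟩
        refine ⟨⟨x, hx, rfl⟩, ?_⟩
        rintro ⟨y, hy, hxy⟩
        exact hxr (hφ (hB₀.root_subset hy) (hsub hx) hxy ▸ hy)
    have h3 : ((spanVerts P \ rootVerts (B₀.map φ)).card : ℕ∞) =
        (spanned P₀ \ ⋃₀ B₀.root).encard := by
      rw [← Set.encard_coe_eq_coe_finsetCard, h2, (hφ.mono (Set.sdiff_subset.trans hsub)).encard_image]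
    rw [← h3] at h1
    exact_mod_cast h1

end Copies

/-! ### The boosters of a full collection -/

section Full
variable {V W : Type*} [Fintype V]

/-- The members of `𝓗` as a finset. -/
def rootFinset (𝓗 : Set (Set (Set V))) : Finset (Set (Set V)) := 𝓗.toFinset

/-- All boosters of a collection, for all members of `𝓗`. -/
def boosterFinset (𝓗 : Set (Set (Set V))) (𝓑 : Set (Set V) → Set (RootedBooster V)) :
    Finset (RootedBooster V) := (Set.toFinite (⋃ H ∈ 𝓗, 𝓑 H)).toFinset

lemma mem_boosterFinset {𝓗 : Set (Set (Set V))} {𝓑 : Set (Set V) → Set (RootedBooster V)}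
    {b : RootedBooster V} : b ∈ boosterFinset 𝓗 𝓑 ↔ ∃ H ∈ 𝓗, b ∈ 𝓑 H := by
  simp [boosterFinset]

lemma boosterFamily_of_isFull {q r k : ℕ} (hr : 1 ≤ r) (hqr : r ≤ q) {B₀ : RootedBooster W}
    {G A X : Set (Set V)} {𝓗 : Set (Set (Set V))} {𝓑 : Set (Set V) → Set (RootedBooster V)}
    (hk : B₀.verts.encard = q + k) (hfull : IsFull q r B₀ G A X 𝓗 𝓑) :
    BoosterFamily q k (rootFinset 𝓗) (boosterFinset 𝓗 𝓑) := by
  have hncard : B₀.verts.ncard - q = k := by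
    rw [Set.ncard, hk]
    have : ((q : ℕ∞) + k).toNat = q + k := by
      rw [← Nat.cast_add, ENat.toNat_natCast]
    omega
  have hroot : ∀ b ∈ boosterFinset 𝓗 𝓑, b.root ∈ 𝓗 ∧ b ∈ 𝓑 b.root := by
    intro b hb
    obtain ⟨H, hH, hb⟩ := mem_boosterFinset.1 hb
    rw [(hfull.1 H hH b hb).2.1]
    exact ⟨hH, hb⟩
  have hcard : ∀ b ∈ boosterFinset 𝓗 𝓑, (rootVerts b).card = q := by
    intro b hb
    exact (hfull.1 _ (hroot b hb).1 b (hroot b hb).2).1.isClique_root.card_cliqueVerts hr hqr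
  have hsub : ∀ b ∈ boosterFinset 𝓗 𝓑, rootVerts b ⊆ boosterVerts b := by
    intro b hb
    rw [← Finset.coe_subset, rootVerts, coe_cliqueVerts, boosterVerts, Set.coe_toFinset]
    exact (hfull.1 _ (hroot b hb).1 b (hroot b hb).2).1.root_subset
  have hverts : ∀ b ∈ boosterFinset 𝓗 𝓑, (boosterVerts b).card = q + k := by
    intro b hb
    obtain ⟨φ, hφ, hbφ⟩ := ((hfull.2 _ (hroot b hb).1).1 b (hroot b hb).2).1
    have h1 : b.verts = φ '' B₀.verts := by rw [hbφ]; rfl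
    have h2 : ((boosterVerts b).card : ℕ∞) = q + k := by
      rw [← Set.encard_coe_eq_coe_finsetCard, boosterVerts, Set.coe_toFinset, h1,
        hφ.encard_image, hk]
    exact_mod_cast h2
  refine ⟨fun b hb => by simpa [rootFinset] using (hroot b hb).1, hcard, hsub, hverts, ?_⟩
  intro b hb b' hb' hbb hv
  have hv' : b.verts = b'.verts := by simpa [boosterVerts] using hv
  have hH := (hroot b hb).1
  have hslot : b.verts \ ⋃₀ b.root ∈ slots q B₀ G A X b.root := by
    refine ⟨?_, b, (hfull.2 _ hH).1 b (hroot b hb).2, ?_⟩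
    · have h1 : b.verts \ ⋃₀ b.root = ((boosterVerts b \ rootVerts b : Finset V) : Set V) := by
        rw [Finset.coe_sdiff, rootVerts, coe_cliqueVerts, boosterVerts, Set.coe_toFinset]
      rw [h1, hncard, Set.encard_coe_eq_coe_finsetCard, Finset.card_sdiff_of_subset (hsub b hb),
        hcard b hb, hverts b hb, Nat.add_sub_cancel_left]
    · rw [Set.union_sdiff_self]; exact Set.subset_union_right
  obtain ⟨B, -, huniq⟩ := (hfull.2 _ hH).2 _ hslot
  have h1 : b.verts ⊆ ⋃₀ b.root ∪ b.verts \ ⋃₀ b.root := by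
    rw [Set.union_sdiff_self]; exact Set.subset_union_right
  rw [huniq b ⟨(hroot b hb).2, h1⟩, huniq b' ⟨hbb ▸ (hroot b' hb').2, hv' ▸ h1⟩]

/-- A configuration whose remaining cliques belong to a matching of the collection. -/
lemma exists_isExtension {q r g : ℕ} (hr : 1 ≤ r) (hqr : r ≤ q) {B₀ : RootedBooster W}
    (hB₀ : B₀.IsRootedBooster q r) (hg : (g : ℕ∞) ≤ B₀.rootedGirth q r)
    {G A X : Set (Set V)} {𝓗 : Set (Set (Set V))} {𝓑 : Set (Set V) → Set (RootedBooster V)}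
    (hfull : IsFull q r B₀ G A X 𝓗 𝓑) {ω : Set (RootedBooster V)} {M : Set (Set (Set V))}
    (hM : M ∈ matchingSet q r G 𝓗 (restrict 𝓑 ω)) {S F : Finset (Set (Set V))}
    (hS : (S : Set (Set (Set V))) ∈ (girthHypergraph q r g G).edgeSet) (hF : F ⊆ S)
    (hSF : ((S \ F : Finset (Set (Set V))) : Set (Set (Set V))) ⊆ M) :
    ∃ (I : Finset (RootedBooster V)) (P : RootedBooster V → Finset (Set (Set V))),
      I ⊆ boosterFinset 𝓗 𝓑 ∧ (I : Set (RootedBooster V)) ⊆ ω ∧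
        IsExtension (q - r) r g I F S P := by
  obtain ⟨⟨c, hc, rfl⟩, -, -⟩ := hM
  obtain ⟨hSd, i, hi3, hig, ⟨hSi, hspan⟩, hsub⟩ := hS
  have : Nonempty (RootedBooster V) := ⟨⟨∅, ∅, ∅, ∅, ∅⟩⟩
  choose! B hB hBc using hc
  have hmem : ∀ K ∈ S \ F, ∃ H ∈ 𝓗, K ∈ c H := fun K hK => by
    simpa using hSF hK
  choose! h hh hKc using hmem
  have hBroot : ∀ H ∈ 𝓗, (B H).root = H := fun H hH => (hfull.1 H hH _ (hB H hH).1).2.1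
  set P : RootedBooster V → Finset (Set (Set V)) := fun b => (S \ F).filter fun K => B (h K) = b
    with hPdef
  have hcardS : S.card = i := by
    rw [Set.encard_coe_eq_coe_finsetCard] at hSi; exact_mod_cast hSi
  have hspanc : ∀ Z : Finset (Set (Set V)), (spanned (Z : Set (Set (Set V)))).encard =
      (spanVerts Z).card := fun Z => by
    rw [← coe_spanVerts, Set.encard_coe_eq_coe_finsetCard]
  have hcopy : ∀ b ∈ (S \ F).image fun K => B (h K), B₀.IsCopy b ∧
      ((P b : Set (Set (Set V))) ⊆ b.on ∨ (P b : Set (Set (Set V))) ⊆ b.off) := by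
    intro b hb
    obtain ⟨K₀, hK₀, rfl⟩ := Finset.mem_image.1 hb
    have hH := hh K₀ hK₀
    refine ⟨((hfull.2 _ hH).1 _ (hB _ hH).1).1, ?_⟩
    have hPc : (P (B (h K₀)) : Set (Set (Set V))) ⊆ c (h K₀) := by
      intro K hK
      simp only [hPdef, Finset.mem_coe, Finset.mem_filter] at hK
      have : h K = h K₀ := by
        rw [← hBroot _ (hh K hK.1), hK.2, hBroot _ hH]
      exact this ▸ hKc K hK.1
    rcases hBc _ hH with h1 | h1
    · exact Or.inl (h1 ▸ hPc)
    · exact Or.inr (h1 ▸ hPc)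
  refine ⟨(S \ F).image fun K => B (h K), P, ?_, ?_, ?_⟩
  · intro b hb
    obtain ⟨K, hK, rfl⟩ := Finset.mem_image.1 hb
    exact mem_boosterFinset.2 ⟨h K, hh K hK, (hB _ (hh K hK)).1⟩
  · intro b hb
    obtain ⟨K, hK, rfl⟩ := Finset.mem_image.1 hb
    exact (hB _ (hh K hK)).2
  · have hne : ∀ b ∈ (S \ F).image fun K => B (h K), (P b).Nonempty := by
      intro b hb
      obtain ⟨K, hK, rfl⟩ := Finset.mem_image.1 hb
      exact ⟨K, Finset.mem_filter.2 ⟨hK, rfl⟩⟩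
    refine ⟨by omega, by omega, ?_, ?_, ?_, hF, ?_, ?_, hne, ?_, ?_⟩
    · intro K hK
      have : IsClique q r K := (hSd hK).2
      rw [this.card_cliqueVerts hr hqr]
      omega
    · rw [hspanc] at hspan
      rw [hcardS]
      exact_mod_cast hspan
    · intro Z hZ hZ2 hZS
      by_contra! hle
      refine hsub Z.card hZ2 (by omega) Z (by exact_mod_cast hZ) ⟨?_, ?_⟩
      · rw [Set.encard_coe_eq_coe_finsetCard]
      · rw [hspanc]; exact_mod_cast hle
    · ext K
      simp only [Finset.mem_biUnion, Finset.mem_image, hPdef, Finset.mem_filter]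
      constructor
      · intro hK; exact ⟨_, ⟨K, hK, rfl⟩, hK, rfl⟩
      · rintro ⟨_, -, hK, -⟩; exact hK
    · intro b _ b' _ hbb
      refine Finset.disjoint_left.2 fun K hK hK' => hbb ?_
      rw [← (Finset.mem_filter.1 hK).2, (Finset.mem_filter.1 hK').2]
    · intro b hb
      exact (spanVerts_of_copy hr hqr hB₀ hg (hcopy b hb).1 (hcopy b hb).2).1
    · intro b hb
      exact (spanVerts_of_copy hr hqr hB₀ hg (hcopy b hb).1 (hcopy b hb).2).2 (hne b hb)

end Full

/-! ### Families of structures and their expected partial derivatives -/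

section Families
variable {V : Type*}

/-- A structure: a set of boosters that have to be retained, and a set of cliques that, together
with fixed cliques, are completed to configurations by these boosters. -/
abbrev Struct (V : Type*) := Finset (RootedBooster V) × Finset (Set (Set V))

variable {d r g v₀ : ℕ} {ℬ : Finset (RootedBooster V)} {𝒦 : Finset (Set (Set V))} {p N B B₀ : ℝ}

/-- All structures with boosters in `ℬ` and cliques in `𝒦` that have a given property. -/
def structs (ℬ : Finset (RootedBooster V)) (𝒦 : Finset (Set (Set V)))
    (φ : Finset (RootedBooster V) → Finset (Set (Set V)) → Prop) : Finset (Struct V) :=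
  (ℬ.powerset ×ˢ 𝒦.powerset).filter fun e => φ e.1 e.2

lemma mem_structs {φ : Finset (RootedBooster V) → Finset (Set (Set V)) → Prop} {e : Struct V} :
    e ∈ structs ℬ 𝒦 φ ↔ e.1 ⊆ ℬ ∧ e.2 ⊆ 𝒦 ∧ φ e.1 e.2 := by
  simp [structs, and_assoc]

variable [Fintype V]

lemma IsExtension.card_add_card_le {I : Finset (RootedBooster V)} {F S : Finset (Set (Set V))}
    {P : RootedBooster V → Finset (Set (Set V))} (h : IsExtension d r g I F S P) :
    I.card + F.card ≤ g := by
  have h1 := h.card_eq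
  have h2 : I.card ≤ ∑ b ∈ I, (P b).card := by
    rw [Finset.card_eq_sum_ones]
    exact Finset.sum_le_sum fun b hb => (h.nonempty b hb).card_pos
  have := h.card_le
  omega

lemma card_biUnion_boosterVerts_le (h : StepBounds r ℬ 𝒦 p N B B₀ (5 * g * v₀) v₀)
    {A : Finset (RootedBooster V)} (hA : A ⊆ ℬ) :
    (A.biUnion boosterVerts).card ≤ A.card * v₀ :=
  Finset.card_biUnion_le_card_mul _ _ _ fun b hb => h.card_booster b (hA hb)

/-- A partial derivative, where the vertices `Y₀` and those of the boosters `A` are known. -/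
lemma sum_derivative_le (h : StepBounds r ℬ 𝒦 p N B B₀ (5 * g * v₀) v₀)
    (𝓔 : Finset (Struct V)) {Y₀ : Finset V} (hY₀ : Y₀.card ≤ g * v₀) {E : ℤ}
    (hℬ : ∀ e ∈ 𝓔, e.1 ⊆ ℬ) (h𝒦 : ∀ e ∈ 𝓔, e.2 ⊆ 𝒦)
    (hm : ∀ e ∈ 𝓔, e.1.card + e.2.card ≤ 2 * g) (A : Finset (RootedBooster V))
    (hE : ∀ e ∈ 𝓔, A ⊆ e.1 → HasOrder r (e.1 \ A) e.2 (Y₀ ∪ A.biUnion boosterVerts) E) :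
    ∑ e ∈ 𝓔 with A ⊆ e.1, p ^ (e.1 \ A).card ≤ (2 * g + 1) * B ^ (2 * g) * N ^ E := by
  rcases (𝓔.filter fun e => A ⊆ e.1).eq_empty_or_nonempty with h0 | ⟨e₀, he₀⟩
  · rw [h0, Finset.sum_empty]
    have := h.one_le_B
    have := h.one_le_N
    positivity
  rw [Finset.mem_filter] at he₀
  have hAc : A.card ≤ 2 * g := by
    have := Finset.card_le_card he₀.2
    have := hm e₀ he₀.1
    omega
  have hY : (Y₀ ∪ A.biUnion boosterVerts).card + 2 * g * v₀ ≤ 5 * g * v₀ := by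
    have h1 := Finset.card_union_le Y₀ (A.biUnion boosterVerts)
    have h2 := card_biUnion_boosterVerts_le h (he₀.2.trans (hℬ e₀ he₀.1))
    have h3 := Nat.mul_le_mul_right v₀ hAc
    have h4 : 5 * g * v₀ = g * v₀ + 2 * g * v₀ + 2 * g * v₀ := by ring
    omega
  have h1 := h.sum_le_of_hasOrder (𝓔.filter fun e => A ⊆ e.1) (A := A)
    (Y := Y₀ ∪ A.biUnion boosterVerts) (E := E) (m := 2 * g)
    (fun e he => (Finset.mem_filter.1 he).2) (fun e he => hℬ e (Finset.mem_filter.1 he).1)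
    (fun e he => h𝒦 e (Finset.mem_filter.1 he).1) (fun e he => hm e (Finset.mem_filter.1 he).1)
    hY (fun e he => hE e (Finset.mem_filter.1 he).1 (Finset.mem_filter.1 he).2)
  exact_mod_cast h1

/-- The expectation, if every structure either starts with a sparse root or gains a factor `n`. -/
lemma sum_expectation_le (h : StepBounds r ℬ 𝒦 p N B B₀ (5 * g * v₀) v₀) (hg : 3 ≤ g)
    (𝓔 : Finset (Struct V)) {Y₀ : Finset V} (hY₀ : Y₀.card ≤ g * v₀) {E : ℤ}
    (hℬ : ∀ e ∈ 𝓔, e.1 ⊆ ℬ) (h𝒦 : ∀ e ∈ 𝓔, e.2 ⊆ 𝒦)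
    (hm : ∀ e ∈ 𝓔, e.1.card + e.2.card + 1 ≤ g)
    (hE : ∀ e ∈ 𝓔, HasSparseOrder r e.1 e.2 Y₀ E ∨ HasOrder r e.1 e.2 Y₀ (E - 1)) :
    ∑ e ∈ 𝓔, p ^ e.1.card ≤
      g * (B₀ * B ^ (g - 2)) * N ^ E + (2 * g + 1) * B ^ (2 * g) * N ^ (E - 1) := by
  have hN : 0 < N := by linarith [h.one_le_N]
  have hB := h.one_le_B
  have h₀ := h.B₀_nonneg
  rw [← Finset.sum_filter_add_sum_filter_not 𝓔 fun e => HasSparseOrder r e.1 e.2 Y₀ E]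
  refine add_le_add ?_ ?_
  · have h1 := h.sum_le_of_hasSparseOrder (𝓔.filter fun e => HasSparseOrder r e.1 e.2 Y₀ E)
      (Y := Y₀) (E := E) (m := g - 2)
      (fun e he => hℬ e (Finset.mem_filter.1 he).1) (fun e he => h𝒦 e (Finset.mem_filter.1 he).1)
      (fun e he => by have := hm e (Finset.mem_filter.1 he).1; omega) (by
        have : (g - 2 + 1) * v₀ ≤ g * v₀ := Nat.mul_le_mul_right _ (by omega)
        have h4 : 5 * g * v₀ = g * v₀ + g * v₀ + 3 * g * v₀ := by ring
        omega)
      (fun e he => (Finset.mem_filter.1 he).2)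
    refine h1.trans ?_
    have : ((g - 2 : ℕ) : ℝ) + 1 ≤ g := by
      have : g - 2 + 1 ≤ g := by omega
      exact_mod_cast this
    gcongr
  · have h1 := sum_derivative_le h (𝓔.filter fun e => ¬ HasSparseOrder r e.1 e.2 Y₀ E) hY₀
      (E := E - 1)
      (fun e he => hℬ e (Finset.mem_filter.1 he).1) (fun e he => h𝒦 e (Finset.mem_filter.1 he).1)
      (fun e he => by have := hm e (Finset.mem_filter.1 he).1; omega) ∅
      (fun e he _ => by
        rw [Finset.mem_filter] at he
        simpa using (hE e he.1).resolve_left he.2)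
    simpa using h1

/-- The boosters of `I` can complete `F` to a configuration. -/
def Completes (d r g : ℕ) (I : Finset (RootedBooster V)) (F : Finset (Set (Set V))) : Prop :=
  ∃ S P, IsExtension d r g I F S P

/-- The configurations of size `s` of the projection that contain `U`. -/
def configStructs (d r g : ℕ) (ℬ : Finset (RootedBooster V)) (𝒦 : Finset (Set (Set V))) (s : ℕ)
    (U : Finset (Set (Set V))) : Finset (Struct V) :=
  structs ℬ 𝒦 fun I F => Disjoint F U ∧ (U ∪ F).card = s ∧ Completes d r g I (U ∪ F)

/-- The configurations of size two of the projection that contain `K` and another clique with the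
vertices `x`. -/
def pairStructs (d r g : ℕ) (ℬ : Finset (RootedBooster V)) (𝒦 : Finset (Set (Set V)))
    (K : Set (Set V)) (x : Finset V) : Finset (Struct V) :=
  structs ℬ 𝒦 fun I F => ∃ K', F = {K'} ∧ K ≠ K' ∧ x ⊆ cliqueVerts K' ∧ Completes d r g I {K, K'}

/-- The common neighbours of `u` and `v` in the configurations of size two of the projection. -/
def commonStructs (d r g : ℕ) (ℬ : Finset (RootedBooster V)) (𝒦 : Finset (Set (Set V)))
    (u v : Set (Set V)) : Finset (Struct V) :=
  structs ℬ 𝒦 fun I F => ∃ w I₁ I₂, F = {w} ∧ u ≠ w ∧ v ≠ w ∧ I = I₁ ∪ I₂ ∧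
    Completes d r g I₁ {u, w} ∧ Completes d r g I₂ {v, w}

/-- The cliques of `𝒢` on the vertices `x` that are deleted by the projection. -/
def removedStructs (d r g : ℕ) (ℬ : Finset (RootedBooster V)) (𝒢 : Finset (Set (Set V)))
    (x : Finset V) : Finset (Struct V) :=
  structs ℬ 𝒢 fun I F => ∃ K, F = {K} ∧ x ⊆ cliqueVerts K ∧ Completes d r g I {K}

lemma card_le_of_configStructs {s : ℕ} {U : Finset (Set (Set V))} {e : Struct V}
    (he : e ∈ configStructs d r g ℬ 𝒦 s U) : e.1.card + e.2.card + U.card ≤ g := by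
  obtain ⟨-, -, hdis, -, S, P, h⟩ := mem_structs.1 he
  have := h.card_add_card_le
  rw [Finset.card_union_of_disjoint hdis.symm] at this
  omega

/-- Two cliques of the configuration, or one clique and the part of a booster, are known: a factor
`N` is lost. -/
lemma sum_configStructs_le (h : StepBounds r ℬ 𝒦 p N B B₀ (5 * g * v₀) v₀) {s : ℕ}
    {U : Finset (Set (Set V))} (hU𝒦 : U ⊆ 𝒦) (hU : U.Nonempty) (hUs : U.card < s)
    (A : Finset (RootedBooster V)) (hUA : 2 ≤ U.card ∨ A.Nonempty) :
    ∑ e ∈ configStructs d r g ℬ 𝒦 s U with A ⊆ e.1, p ^ (e.1 \ A).card ≤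
      (2 * g + 1) * B ^ (2 * g) * N ^ (((s - U.card : ℕ) : ℤ) * d - 1) := by
  rcases Nat.lt_or_ge g s with hgs | hgs
  · have h0 : configStructs d r g ℬ 𝒦 s U = ∅ := by
      refine Finset.eq_empty_of_forall_notMem fun e he => ?_
      obtain ⟨-, -, -, hs, S, P, h⟩ := mem_structs.1 he
      have := h.card_add_card_le
      omega
    rw [h0, Finset.filter_empty, Finset.sum_empty]
    have := h.one_le_B
    have := h.one_le_N
    positivity
  refine sum_derivative_le h _ (Y₀ := spanVerts U) ?_ (fun e he => (mem_structs.1 he).1)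
    (fun e he => (mem_structs.1 he).2.1) (fun e he => ?_) A fun e he hAe => ?_
  · refine (Finset.card_biUnion_le_card_mul _ _ _ fun K hK => h.card_clique K (hU𝒦 hK)).trans ?_
    exact Nat.mul_le_mul_right _ (by omega)
  · have := card_le_of_configStructs he
    omega
  · obtain ⟨-, -, hdis, hs, S, P, hext⟩ := mem_structs.1 he
    have hF : (U ∪ e.2) \ U = e.2 := by
      rw [Finset.union_sdiff_left, Finset.sdiff_eq_self_of_disjoint hdis]
    have hcard := Finset.card_union_of_disjoint hdis.symm
    have hss : U ⊂ U ∪ e.2 := by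
      refine Finset.ssubset_iff_subset_ne.2 ⟨Finset.subset_union_left, fun hh => ?_⟩
      rw [← hh] at hs
      omega
    have h1 := hext.hasOrder_sub_one hAe (by have := hU.card_pos; omega) hss
      (hUA.imp id fun hA => ⟨hU, hA⟩) (Y := spanVerts U ∪ A.biUnion boosterVerts)
      Finset.subset_union_left Finset.subset_union_right
    rw [hF] at h1
    have h2 : e.2.card = s - U.card := by omega
    rwa [h2] at h1

/-- If one clique is known and there is a booster, a sparse root or a factor `N` helps. -/
lemma sum_configStructs_singleton_le (h : StepBounds r ℬ 𝒦 p N B B₀ (5 * g * v₀) v₀)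
    (hg : 3 ≤ g) {s : ℕ} {K : Set (Set V)} (hK : K ∈ 𝒦) (hs : 2 ≤ s)
    (A : Finset (RootedBooster V)) :
    ∑ e ∈ (configStructs d r g ℬ 𝒦 s {K}).filter (fun e => e.1.Nonempty) with A ⊆ e.1,
        p ^ (e.1 \ A).card ≤ g * (B₀ * B ^ (g - 2)) * N ^ (((s - 1 : ℕ) : ℤ) * d) +
      (2 * g + 1) * B ^ (2 * g) * N ^ (((s - 1 : ℕ) : ℤ) * d - 1) := by
  have hN : 0 < N := by linarith [h.one_le_N]
  have hB := h.one_le_B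
  have h₀ := h.B₀_nonneg
  rcases A.eq_empty_or_nonempty with rfl | hA
  · simp only [Finset.empty_subset, Finset.filter_true, Finset.sdiff_empty]
    refine sum_expectation_le h hg _ (Y₀ := cliqueVerts K) ?_
      (fun e he => (mem_structs.1 (Finset.mem_filter.1 he).1).1)
      (fun e he => (mem_structs.1 (Finset.mem_filter.1 he).1).2.1) (fun e he => ?_) fun e he => ?_
    · exact (h.card_clique K hK).trans (Nat.le_mul_of_pos_left _ (by omega))
    · exact card_le_of_configStructs (Finset.mem_filter.1 he).1
    · rw [Finset.mem_filter] at he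
      obtain ⟨-, -, hdis, hs', S, P, hext⟩ := mem_structs.1 he.1
      have hF : ({K} ∪ e.2) \ {K} = e.2 := by
        rw [Finset.union_sdiff_left, Finset.sdiff_eq_self_of_disjoint hdis]
      have hcard := Finset.card_union_of_disjoint hdis.symm
      rw [Finset.card_singleton] at hcard
      have h1 := hext.hasSparseOrder_or_hasOrder he.2 (K := K) (by simp) (Or.inl (by omega))
      have h2 : e.2.card = s - 1 := by omega
      rwa [hF, h2] at h1
  · have h1 := sum_configStructs_le (d := d) h (U := {K}) (s := s) (by simpa) (by simp)
      (by simpa) A (Or.inr hA)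
    rw [Finset.card_singleton] at h1
    refine le_trans ?_ (h1.trans (le_add_of_nonneg_left (by positivity)))
    refine Finset.sum_le_sum_of_subset_of_nonneg ?_ fun _ _ _ => pow_nonneg h.p_nonneg _
    exact Finset.filter_subset_filter _ (Finset.filter_subset _ _)

/-- A factor `N` is lost, as a vertex of the second clique outside the first one is known. -/
lemma sum_pairStructs_le (h : StepBounds r ℬ 𝒦 p N B B₀ (5 * g * v₀) v₀) (hg : 3 ≤ g)
    {K : Set (Set V)} (hK : K ∈ 𝒦) {x : Finset V} (hxr : x.card ≤ v₀)
    (hx : ¬ x ⊆ cliqueVerts K) (A : Finset (RootedBooster V)) :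
    ∑ e ∈ pairStructs d r g ℬ 𝒦 K x with A ⊆ e.1, p ^ (e.1 \ A).card ≤
      (2 * g + 1) * B ^ (2 * g) * N ^ ((d : ℤ) - 1) := by
  refine sum_derivative_le h _ (Y₀ := cliqueVerts K ∪ x) ?_ (fun e he => (mem_structs.1 he).1)
    (fun e he => (mem_structs.1 he).2.1) (fun e he => ?_) A fun e he hAe => ?_
  · have h1 := Finset.card_union_le (cliqueVerts K) x
    have h2 := h.card_clique K hK
    nlinarith
  · obtain ⟨-, -, K', hF, hne, -, S, P, hext⟩ := mem_structs.1 he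
    have := hext.card_add_card_le
    rw [Finset.card_pair hne] at this
    rw [hF, Finset.card_singleton]
    omega
  · obtain ⟨-, -, K', hF, hne, hxK', S, P, hext⟩ := mem_structs.1 he
    rw [hF]
    exact hext.hasOrder_of_clique_of_edge rfl hne hAe hxK' hx
      (Finset.subset_union_right.trans Finset.subset_union_left)
      (Finset.subset_union_left.trans Finset.subset_union_left) Finset.subset_union_right

lemma sum_commonStructs_le (h : StepBounds r ℬ 𝒦 p N B B₀ (5 * g * v₀) v₀) (hg : 3 ≤ g)
    {u v : Set (Set V)} (hu : u ∈ 𝒦) (hv : v ∈ 𝒦)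
    (huv : (cliqueVerts u ∩ cliqueVerts v).card < r) (A : Finset (RootedBooster V)) :
    ∑ e ∈ commonStructs d r g ℬ 𝒦 u v with A ⊆ e.1, p ^ (e.1 \ A).card ≤
      (2 * g + 1) * B ^ (2 * g) * N ^ ((d : ℤ) - 1) := by
  refine sum_derivative_le h _ (Y₀ := cliqueVerts u ∪ cliqueVerts v) ?_
    (fun e he => (mem_structs.1 he).1)
    (fun e he => (mem_structs.1 he).2.1) (fun e he => ?_) A fun e he hAe => ?_
  · have h1 := Finset.card_union_le (cliqueVerts u) (cliqueVerts v)
    have h2 := h.card_clique u hu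
    have h3 := h.card_clique v hv
    nlinarith
  · obtain ⟨-, -, w, I₁, I₂, hF, huw, hvw, hI, ⟨S₁, P₁, h₁⟩, S₂, P₂, h₂⟩ := mem_structs.1 he
    have := h₁.card_add_card_le
    have := h₂.card_add_card_le
    rw [Finset.card_pair huw] at *
    rw [Finset.card_pair hvw] at *
    rw [hF, Finset.card_singleton, hI]
    have := Finset.card_union_le I₁ I₂
    omega
  · obtain ⟨-, -, w, I₁, I₂, hF, huw, hvw, hI, ⟨S₁, P₁, h₁⟩, S₂, P₂, h₂⟩ := mem_structs.1 he
    rw [hF, hI]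
    exact h₁.hasOrder_common h₂ huw hvw huv (hI ▸ hAe)
      (Finset.subset_union_left.trans Finset.subset_union_left)
      (Finset.subset_union_right.trans Finset.subset_union_left) Finset.subset_union_right

/-- The clique is counted first if no booster is known. Then a sparse root or a factor `N` helps. If
boosters are known, the bound is that for the choice of a clique with one more known vertex. -/
lemma sum_removedStructs_le (h : StepBounds r ℬ 𝒦 p N B B₀ (5 * g * v₀) v₀) (hg : 3 ≤ g)
    {𝒢 : Finset (Set (Set V))} (h𝒢 : 𝒢 ⊆ 𝒦)
    (hroot : ∀ K ∈ 𝒢, ∀ b ∈ ℬ, (rootVerts b ∩ cliqueVerts K).card ≤ r) {x : Finset V}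
    (hx : x.card = r) (hrv : r ≤ v₀) (A : Finset (RootedBooster V)) :
    ∑ e ∈ removedStructs d r g ℬ 𝒢 x with A ⊆ e.1, p ^ (e.1 \ A).card ≤
      (𝒢.filter fun K => x ⊆ cliqueVerts K).card *
        (g * (B₀ * B ^ (g - 2)) + (2 * g + 1) * B ^ (2 * g) * N ^ (-1 : ℤ)) +
      (2 * g + 1) * B ^ (2 * g) * N ^ ((d : ℤ) - 1) := by
  have hN : 0 < N := by linarith [h.one_le_N]
  have hB := h.one_le_B
  have h₀ := h.B₀_nonneg
  have hsize : ∀ e ∈ removedStructs d r g ℬ 𝒢 x, e.1.card + e.2.card ≤ g := fun e he => by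
    obtain ⟨-, -, K, hF, -, S, P, hext⟩ := mem_structs.1 he
    rw [hF]
    exact hext.card_add_card_le
  rcases A.eq_empty_or_nonempty with rfl | hA
  · refine le_trans ?_ (le_add_of_nonneg_right (by positivity))
    simp only [Finset.empty_subset, Finset.filter_true, Finset.sdiff_empty]
    have hmaps : ∀ e ∈ removedStructs d r g ℬ 𝒢 x,
        e.2 ∈ (𝒢.filter fun K => x ⊆ cliqueVerts K).image fun K => ({K} : Finset (Set (Set V))) := by
      intro e he
      obtain ⟨-, h2, K, hF, hxK, -⟩ := mem_structs.1 he
      rw [hF] at h2 ⊢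
      exact Finset.mem_image_of_mem _ (Finset.mem_filter.2 ⟨h2 (by simp), hxK⟩)
    rw [← Finset.sum_fiberwise_of_maps_to hmaps, Finset.sum_image (fun K _ K' _ hKK => by
      simpa using hKK), ← nsmul_eq_mul]
    refine Finset.sum_le_card_nsmul _ _ _ fun K hK => ?_
    rw [Finset.mem_filter] at hK
    -- the structures `(I, {K})` are counted as `(I, ∅)`, with `K` known at the beginning
    have hinj : Set.InjOn (fun e : Struct V => ((e.1, ∅) : Struct V))
        ((removedStructs d r g ℬ 𝒢 x).filter fun e => e.2 = {K}) := by
      intro e he e' he' hee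
      simp only [Finset.coe_filter, Set.mem_ofPred_eq, Prod.mk.injEq, and_true] at he he' hee
      exact Prod.ext hee (by rw [he.2, he'.2])
    have hmem : ∀ e ∈ ((removedStructs d r g ℬ 𝒢 x).filter fun e => e.2 = {K}).image
        (fun e : Struct V => ((e.1, ∅) : Struct V)), e.2 = ∅ ∧ e.1 ⊆ ℬ ∧
          Completes d r g e.1 {K} := by
      intro e he
      obtain ⟨e', he', rfl⟩ := Finset.mem_image.1 he
      rw [Finset.mem_filter] at he'
      obtain ⟨h1, -, K', hF, -, hext⟩ := mem_structs.1 he'.1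
      rw [he'.2] at hF
      exact ⟨rfl, h1, hF ▸ hext⟩
    generalize hT : ((removedStructs d r g ℬ 𝒢 x).filter fun e => e.2 = {K}).image
        (fun e : Struct V => ((e.1, ∅) : Struct V)) = T at hmem
    have hKv : (cliqueVerts K).card ≤ g * v₀ :=
      (h.card_clique K (h𝒢 hK.1)).trans (Nat.le_mul_of_pos_left _ (by omega))
    have h1 := sum_expectation_le h hg T hKv (E := 0) (fun e he => (hmem e he).2.1)
      (fun e he => by rw [(hmem e he).1]; exact Finset.empty_subset _)
      (fun e he => ?_) (fun e he => ?_)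
    · rw [← hT, Finset.sum_image hinj] at h1
      simpa using h1
    · obtain ⟨h0, -, S, P, hext⟩ := hmem e he
      have := hext.card_add_card_le
      rw [h0]
      simpa using this
    · obtain ⟨h0, heℬ, S, P, hext⟩ := hmem e he
      have hI : e.1.Nonempty := by
        rw [Finset.nonempty_iff_ne_empty]
        intro hI
        have h2 := hext.card_eq
        have h3 := hext.three_le
        rw [hI] at h2
        simp at h2
        omega
      have h2 := hext.hasSparseOrder_or_hasOrder hI (K := K) (by simp)
        (Or.inr fun b hb => hroot K hK.1 b (heℬ hb))
      rw [h0]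
      simpa using h2
  · refine le_trans ?_ (le_add_of_nonneg_left (by positivity))
    refine sum_derivative_le h _ (Y₀ := x) ?_ (fun e he => (mem_structs.1 he).1)
      (fun e he => (mem_structs.1 he).2.1.trans h𝒢) (fun e he => ?_) A fun e he hAe => ?_
    · rw [hx]; exact hrv.trans (Nat.le_mul_of_pos_left _ (by omega))
    · have := hsize e he; omega
    · obtain ⟨-, -, K, hF, hxK, S, P, hext⟩ := mem_structs.1 he
      rw [hF]
      exact hext.hasOrder_of_edge rfl hAe hA hx hxK Finset.subset_union_left
        Finset.subset_union_right

end Families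

/-! ### Degrees in the projection treasury -/

section Degrees
variable {V W : Type*} [Fintype V]

lemma ncard_le_monomialCount {V : Type*} {γ : Type*} [Finite γ] {𝓔 : Finset (Struct V)}
    {ω : Set (RootedBooster V)}
    (𝒮 : Set γ) (F : γ → Finset (Set (Set V))) (hF : Set.InjOn F 𝒮)
    (h : ∀ y ∈ 𝒮, ∃ I : Finset (RootedBooster V), (I, F y) ∈ 𝓔 ∧ (I : Set (RootedBooster V)) ⊆ ω) :
    𝒮.ncard ≤ monomialCount 𝓔 Prod.fst ω := by
  choose! I hI hIω using h
  rw [monomialCount, ← Set.ncard_coe_finset]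
  refine Set.ncard_le_ncard_of_injOn (fun y => (I y, F y)) (fun y hy => ?_) (fun y hy y' hy' hyy => ?_)
    (Set.toFinite _)
  · simpa using ⟨hI y hy, hIω y hy⟩
  · exact hF hy hy' (Prod.ext_iff.1 hyy).2

/-- All copies of `K_q^r` on the vertex type. -/
def allCliques (V : Type*) [Fintype V] (q r : ℕ) : Finset (Set (Set V)) :=
  {K : Set (Set V) | IsClique q r K}.toFinset

lemma mem_allCliques {q r : ℕ} {K : Set (Set V)} : K ∈ allCliques V q r ↔ IsClique q r K := by
  simp [allCliques]

/-- The setting of the degree bounds: a full collection of boosters of rooted girth at least `g`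
in the complete `r`-graph. -/
structure Setting (q r g : ℕ) (B₀ : RootedBooster W) (A X : Set (Set V))
    (𝓗 : Set (Set (Set V))) (𝓑 : Set (Set V) → Set (RootedBooster V)) : Prop where
  one_le : 1 ≤ r
  lt : r < q
  isRootedBooster : B₀.IsRootedBooster q r
  le_rootedGirth : (g : ℕ∞) ≤ B₀.rootedGirth q r
  isFull : IsFull q r B₀ (complete r Set.univ) A X 𝓗 𝓑

namespace Setting

variable {q r g : ℕ} {B₀ : RootedBooster W} {A X : Set (Set V)} {𝓗 : Set (Set (Set V))}
  {𝓑 : Set (Set V) → Set (RootedBooster V)} {ω : Set (RootedBooster V)}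

/-- The edges of the projection are completed by retained boosters. If none is needed, they are
edges of the original treasury. -/
lemma exists_completes (h : Setting q r g B₀ A X 𝓗 𝓑) {F : Set (Set (Set V))}
    (hF : F ∈ (projTreasury q r g (complete r Set.univ) A X 𝓗 (restrict 𝓑 ω)).H.edgeSet) :
    F.toFinset ⊆ allCliques V q r ∧ ∃ I ⊆ boosterFinset 𝓗 𝓑, (I : Set (RootedBooster V)) ⊆ ω ∧
      Completes (q - r) r g I F.toFinset ∧
      (I.Nonempty ∨ F ∈ (designTreasury q r g (complete r Set.univ)
        (complete r Set.univ \ A) X).H.edgeSet) := by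
  obtain ⟨hFV, S, hS, M, hM, hFS, -, hSF⟩ := hF
  obtain ⟨I, P, hI, hIω, hext⟩ := exists_isExtension h.one_le h.lt.le h.isRootedBooster
    h.le_rootedGirth h.isFull hM (S := S.toFinset) (F := F.toFinset)
    (by rw [Set.coe_toFinset]; exact hS)
    (by simpa using hFS) (by simpa using hSF)
  refine ⟨fun K hK => ?_, I, hI, hIω, ⟨_, _, hext⟩, ?_⟩
  · have h1 : K ∈ (designTreasury q r g (complete r Set.univ)
      (complete r Set.univ \ A) X).H.vertexSet := (hFV (by simpa using hK)).1
    exact mem_allCliques.2 h1.2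
  · rcases I.eq_empty_or_nonempty with rfl | hne
    · right
      have h1 := hext.sdiff_eq
      rw [Finset.biUnion_empty, Finset.sdiff_eq_empty_iff_subset] at h1
      have h2 : S = F := Set.Subset.antisymm (by simpa using h1) hFS
      exact h2 ▸ hS
    · exact Or.inl hne

/-- A clique that is removed by the projection is a structure that is present. -/
lemma codegree_le_add (h : Setting q r g B₀ A X 𝓗 𝓑) {𝒢 : Set (Set (Set V))}
    (h𝒢 : ∀ K ∈ 𝒢, IsClique q r K) {x : Finset V} :
    codegree 𝒢 {(x : Set V)} ≤ codegree (𝒢 ∩ (designTreasury q r g (complete r Set.univ)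
      (complete r Set.univ \ A) X).projVertices (matchingSet q r (complete r Set.univ) 𝓗
        (restrict 𝓑 ω))) {(x : Set V)} +
      monomialCount (removedStructs (q - r) r g (boosterFinset 𝓗 𝓑) 𝒢.toFinset x) Prod.fst ω := by
  set 𝒱 := (designTreasury q r g (complete r Set.univ)
      (complete r Set.univ \ A) X).projVertices (matchingSet q r (complete r Set.univ) 𝓗
        (restrict 𝓑 ω)) with h𝒱
  have hsub : {K ∈ 𝒢 | {(x : Set V)} ⊆ K} ⊆ {K ∈ 𝒢 ∩ 𝒱 | {(x : Set V)} ⊆ K} ∪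
      {K ∈ 𝒢 | {(x : Set V)} ⊆ K ∧ K ∉ 𝒱} := by
    intro K hK
    by_cases hK' : K ∈ 𝒱
    · exact Or.inl ⟨⟨hK.1, hK'⟩, hK.2⟩
    · exact Or.inr ⟨hK.1, hK.2, hK'⟩
  refine (Set.ncard_le_ncard hsub (Set.toFinite _)).trans ((Set.ncard_union_le _ _).trans ?_)
  refine Nat.add_le_add_left (ncard_le_monomialCount _ (fun K => {K}) (fun _ _ _ _ hh => by
    simpa using hh) ?_) _
  rintro K ⟨hK, hxK, hKV⟩
  have hKc := h𝒢 K hK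
  have hKH : K ∈ (designTreasury q r g (complete r Set.univ)
      (complete r Set.univ \ A) X).H.vertexSet := by
    refine ⟨fun e he => ⟨Set.subset_univ _, ?_⟩, hKc⟩
    obtain ⟨Q, hQ, rfl⟩ := hKc
    exact he.2
  obtain ⟨S, hS, M, hM, hKS, -, hSM⟩ : ∃ S ∈ (designTreasury q r g (complete r Set.univ)
      (complete r Set.univ \ A) X).H.edgeSet, ∃ M ∈ matchingSet q r (complete r Set.univ) 𝓗
        (restrict 𝓑 ω), K ∈ S ∧ K ∉ M ∧ S \ {K} ⊆ M := by
    by_contra hcon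
    exact hKV ⟨hKH, hcon⟩
  obtain ⟨I, P, hI, hIω, hext⟩ := exists_isExtension h.one_le h.lt.le h.isRootedBooster
    h.le_rootedGirth h.isFull hM (S := S.toFinset) (F := {K})
    (by rw [Set.coe_toFinset]; exact hS)
    (by simpa using hKS) (by simpa using hSM)
  refine ⟨I, mem_structs.2 ⟨hI, by simpa using hK, K, rfl, ?_, _, _, hext⟩, hIω⟩
  exact ((hKc.mem_iff h.one_le h.lt.le).1 (hxK rfl)).1

lemma codegree_level_le (h : Setting q r g B₀ A X 𝓗 𝓑) (s : ℕ) {U : Set (Set (Set V))} :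
    codegree ((projTreasury q r g (complete r Set.univ) A X 𝓗 (restrict 𝓑 ω)).level s) U ≤
      monomialCount (configStructs (q - r) r g (boosterFinset 𝓗 𝓑) (allCliques V q r) s U.toFinset)
        Prod.fst ω := by
  refine ncard_le_monomialCount _ (fun F => F.toFinset \ U.toFinset) ?_ ?_
  · intro F hF F' hF' hh
    simp only at hh
    have h1 : U.toFinset ⊆ F.toFinset := by simpa using hF.2
    have h2 : U.toFinset ⊆ F'.toFinset := by simpa using hF'.2
    have h3 : F.toFinset = F'.toFinset := by
      rw [← Finset.union_sdiff_of_subset h1, hh, Finset.union_sdiff_of_subset h2]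
    simpa using h3
  · rintro F ⟨⟨hF, hFs⟩, hUF⟩
    obtain ⟨hF𝒦, I, hI, hIω, hcomp, -⟩ := h.exists_completes hF
    have h1 : U.toFinset ⊆ F.toFinset := by simpa using hUF
    refine ⟨I, mem_structs.2 ⟨hI, Finset.sdiff_subset.trans hF𝒦, Finset.sdiff_disjoint, ?_, ?_⟩, hIω⟩
    · rw [Finset.union_sdiff_of_subset h1]
      have : (F.toFinset.card : ℕ∞) = s := by
        rw [← Set.encard_coe_eq_coe_finsetCard, Set.coe_toFinset, hFs]
      exact_mod_cast this
    · rwa [Finset.union_sdiff_of_subset h1]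

lemma codegree_level_le_add (h : Setting q r g B₀ A X 𝓗 𝓑) (s : ℕ) {U : Set (Set (Set V))} :
    codegree ((projTreasury q r g (complete r Set.univ) A X 𝓗 (restrict 𝓑 ω)).level s) U ≤
      codegree ((designTreasury q r g (complete r Set.univ)
        (complete r Set.univ \ A) X).level s) U +
      monomialCount ((configStructs (q - r) r g (boosterFinset 𝓗 𝓑) (allCliques V q r) s
        U.toFinset).filter fun e => e.1.Nonempty) Prod.fst ω := by
  set T := projTreasury q r g (complete r Set.univ) A X 𝓗 (restrict 𝓑 ω)
  set T₀ := designTreasury q r g (complete r Set.univ) (complete r Set.univ \ A) X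
  have hsub : {F ∈ T.level s | U ⊆ F} ⊆ {F ∈ T₀.level s | U ⊆ F} ∪
      {F ∈ T.level s | U ⊆ F ∧ F ∉ T₀.H.edgeSet} := by
    intro F hF
    by_cases hF' : F ∈ T₀.H.edgeSet
    · exact Or.inl ⟨⟨hF', hF.1.2⟩, hF.2⟩
    · exact Or.inr ⟨hF.1, hF.2, hF'⟩
  refine (Set.ncard_le_ncard hsub (Set.toFinite _)).trans ((Set.ncard_union_le _ _).trans ?_)
  refine Nat.add_le_add_left (ncard_le_monomialCount _ (fun F => F.toFinset \ U.toFinset) ?_ ?_) _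
  · intro F hF F' hF' hh
    simp only at hh
    have h1 : U.toFinset ⊆ F.toFinset := by simpa using hF.2.1
    have h2 : U.toFinset ⊆ F'.toFinset := by simpa using hF'.2.1
    have h3 : F.toFinset = F'.toFinset := by
      rw [← Finset.union_sdiff_of_subset h1, hh, Finset.union_sdiff_of_subset h2]
    simpa using h3
  · rintro F ⟨⟨hF, hFs⟩, hUF, hF0⟩
    obtain ⟨hF𝒦, I, hI, hIω, hcomp, hne⟩ := h.exists_completes hF
    have h1 : U.toFinset ⊆ F.toFinset := by simpa using hUF
    refine ⟨I, Finset.mem_filter.2 ⟨mem_structs.2 ⟨hI, Finset.sdiff_subset.trans hF𝒦,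
      Finset.sdiff_disjoint, ?_, ?_⟩, hne.resolve_right hF0⟩, hIω⟩
    · rw [Finset.union_sdiff_of_subset h1]
      have : (F.toFinset.card : ℕ∞) = s := by
        rw [← Set.encard_coe_eq_coe_finsetCard, Set.coe_toFinset, hFs]
      exact_mod_cast this
    · rwa [Finset.union_sdiff_of_subset h1]

lemma two_codegree_le (h : Setting q r g B₀ A X 𝓗 𝓑) {x : Finset V} {K : Set (Set V)}
    (hxK : (x : Set V) ∉ K) :
    {S ∈ (projTreasury q r g (complete r Set.univ) A X 𝓗 (restrict 𝓑 ω)).level 2 | K ∈ S ∧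
      ∃ f ∈ S, f ∈ (projTreasury q r g (complete r Set.univ) A X 𝓗 (restrict 𝓑 ω)).edges ∧
        (x : Set V) ∈ f}.ncard ≤
      monomialCount (pairStructs (q - r) r g (boosterFinset 𝓗 𝓑) (allCliques V q r) K x)
        Prod.fst ω := by
  have hpair : ∀ S : Set (Set (Set V)), S.encard = (2 : ℕ) → K ∈ S → ∀ f ∈ S, (x : Set V) ∈ f →
      K ≠ f ∧ S = {K, f} := by
    intro S hS hK f hf hxf
    have hne : K ≠ f := fun hh => hxK (hh ▸ hxf)
    refine ⟨hne, (Set.Finite.eq_of_subset_of_encard_le (Set.toFinite _) (t := S)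
      (Set.insert_subset hK (by simpa)) ?_).symm⟩
    rw [hS, Set.encard_pair hne]
    rfl
  refine ncard_le_monomialCount _ (fun S => S.toFinset \ {K}) ?_ ?_
  · intro F hF F' hF' hh
    simp only at hh
    have h1 : {K} ⊆ F.toFinset := by simpa using hF.2.1
    have h2 : {K} ⊆ F'.toFinset := by simpa using hF'.2.1
    have h3 : F.toFinset = F'.toFinset := by
      rw [← Finset.union_sdiff_of_subset h1, hh, Finset.union_sdiff_of_subset h2]
    simpa using h3
  · rintro S ⟨⟨hS, hS2⟩, hKS, f, hf, -, hxf⟩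
    obtain ⟨hS𝒦, I, hI, hIω, hcomp, -⟩ := h.exists_completes hS
    obtain ⟨hne, hSe⟩ := hpair S hS2 hKS f hf hxf
    have hSf : S.toFinset = {K, f} := by
      ext y; simp [hSe]
    refine ⟨I, mem_structs.2 ⟨hI, Finset.sdiff_subset.trans hS𝒦, f, ?_, hne, ?_, ?_⟩, hIω⟩
    · ext y
      simp only [hSf, Finset.mem_sdiff, Finset.mem_insert, Finset.mem_singleton]
      constructor
      · tauto
      · rintro rfl; exact ⟨Or.inr rfl, hne.symm⟩
    · have hfc : IsClique q r f := mem_allCliques.1 (hS𝒦 (by simpa using hf))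
      exact ((hfc.mem_iff h.one_le h.lt.le).1 hxf).1
    · rwa [hSf] at hcomp

lemma common_two_degree_le (h : Setting q r g B₀ A X 𝓗 𝓑) {u v : Set (Set V)} :
    {w ∈ (projTreasury q r g (complete r Set.univ) A X 𝓗 (restrict 𝓑 ω)).H.vertexSet |
      {u, w} ∈ (projTreasury q r g (complete r Set.univ) A X 𝓗 (restrict 𝓑 ω)).level 2 ∧
      {v, w} ∈ (projTreasury q r g (complete r Set.univ) A X 𝓗 (restrict 𝓑 ω)).level 2}.ncard ≤
      monomialCount (commonStructs (q - r) r g (boosterFinset 𝓗 𝓑) (allCliques V q r) u v)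
        Prod.fst ω := by
  refine ncard_le_monomialCount _ (fun w => {w}) (fun _ _ _ _ hh => by simpa using hh) ?_
  rintro w ⟨hw, ⟨huw, hu2⟩, hvw, hv2⟩
  have hne : ∀ y : Set (Set V), ({y, w} : Set (Set (Set V))).encard = (2 : ℕ) → y ≠ w := by
    rintro y hy rfl
    rw [Set.pair_eq_singleton, Set.encard_singleton] at hy
    have : (1 : ℕ) = 2 := by exact_mod_cast hy
    omega
  obtain ⟨hS₁, I₁, hI₁, hω₁, hcomp₁, -⟩ := h.exists_completes huw
  obtain ⟨hS₂, I₂, hI₂, hω₂, hcomp₂, -⟩ := h.exists_completes hvw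
  replace hcomp₁ : Completes (q - r) r g I₁ {u, w} := by
    convert hcomp₁ using 1
    ext z
    simp
  replace hcomp₂ : Completes (q - r) r g I₂ {v, w} := by
    convert hcomp₂ using 1
    ext z
    simp
  refine ⟨I₁ ∪ I₂, mem_structs.2 ⟨Finset.union_subset hI₁ hI₂, ?_, w, I₁, I₂, rfl, hne u hu2,
    hne v hv2, rfl, hcomp₁, hcomp₂⟩, ?_⟩
  · simpa using hS₁ (show w ∈ _ by simp)
  · simpa using ⟨hω₁, hω₂⟩

end Setting
end Degrees

/-! ### Roots of the boosters of a sponge -/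

section Sponge
variable {V W : Type*} [Fintype V]
variable {q r g : ℕ} {B₀ : RootedBooster W} {A X : Set (Set V)} {𝓗 : Set (Set (Set V))}
  {𝓑 : Set (Set V) → Set (RootedBooster V)}

/-- A clique of the treasury meets the root of a booster in at most one edge, which lies in the
reserve. -/
lemma card_rootVerts_inter_le (hr : 1 ≤ r) (hqr : r ≤ q)
    (hS : IsSponge q r (complete r Set.univ) A X 𝓗)
    (hroot : ∀ H ∈ 𝓗, ∀ B ∈ 𝓑 H, B.root = H) {K : Set (Set V)}
    (hK : K ∈ (designTreasury q r g (complete r Set.univ) (complete r Set.univ \ A) X).edges)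
    {b : RootedBooster V} (hb : b ∈ boosterFinset 𝓗 𝓑) :
    (rootVerts b ∩ cliqueVerts K).card ≤ r := by
  obtain ⟨H, hH, hbH⟩ := mem_boosterFinset.1 hb
  obtain ⟨-, -, -, 𝒬, h𝒬⟩ := hS
  obtain ⟨hHc, hHE⟩ := h𝒬.isClique H hH
  have hKc : IsClique q r K := by
    rcases hK with hK | hK
    exacts [hK.2, hK.2.1]
  have hKA : ∀ e ∈ K, e ∉ A ∨ e ∈ X := fun e he => by
    rcases hK with hK | hK
    · exact Or.inl (hK.1 he).1.2
    · exact (hK.1 he).imp (fun h => h.1.2) id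
  rw [rootVerts, hroot H hH b hbH]
  by_contra! hcon
  obtain ⟨T, hT, hTc⟩ := Finset.exists_subset_card_eq (Nat.succ_le_of_lt hcon)
  have hmem : ∀ v ∈ T, ((T.erase v : Finset V) : Set V) ∈ H ∩ X := fun v hv => by
    have hc : (T.erase v).card = r := by rw [Finset.card_erase_of_mem hv, hTc]; omega
    have hsub := (Finset.erase_subset v T).trans hT
    have h1 := (hHc.mem_iff hr hqr).2 ⟨hsub.trans Finset.inter_subset_left, hc⟩
    have h2 := (hKc.mem_iff hr hqr).2 ⟨hsub.trans Finset.inter_subset_right, hc⟩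
    refine ⟨h1, (hKA _ h2).elim (fun h3 => ?_) id⟩
    exact (hHE h1).resolve_right h3
  obtain ⟨v, hv, w, hw, hvw⟩ := Finset.one_lt_card.1 (show 1 < T.card by omega)
  have heq := Set.encard_le_one_iff.1 (h𝒬.inter_le H hH) _ _ (hmem v hv) (hmem w hw)
  rw [Finset.coe_inj] at heq
  have : w ∈ T.erase v := Finset.mem_erase.2 ⟨hvw.symm, hw⟩
  rw [heq] at this
  simp at this

lemma codegree_union_le {α : Type*} [Finite α] (E E' : Set (Set α)) (U : Set α) :
    codegree (E ∪ E') U ≤ codegree E U + codegree E' U := by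
  refine le_trans (Set.ncard_le_ncard (t := {e ∈ E | U ⊆ e} ∪ {e ∈ E' | U ⊆ e}) ?_
    (Set.toFinite _)) (Set.ncard_union_le _ _)
  rintro e ⟨he | he, hU⟩
  exacts [Or.inl ⟨he, hU⟩, Or.inr ⟨he, hU⟩]

/-- A booster has vertices outside its root: otherwise all its cliques would coincide with the
root. -/
lemma RootedBooster.IsRootedBooster.lt_encard_verts {B : RootedBooster V} (hr : 1 ≤ r) (hqr : r ≤ q)
    (hB : B.IsRootedBooster q r) : (q : ℕ∞) < B.verts.encard := by
  have hroot : (⋃₀ B.root).encard = q := by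
    rw [← coe_cliqueVerts, encard_coe_eq]
    exact hB.isClique_root.card_cliqueVerts hr hqr
  by_contra! hcon
  have hverts : ⋃₀ B.root = B.verts :=
    Set.Finite.eq_of_subset_of_encard_le (Set.toFinite _) hB.root_subset (hcon.trans hroot.ge)
  have hne : B.root.Nonempty := by
    rw [Set.nonempty_iff_ne_empty]
    intro h0
    rw [h0, Set.sUnion_empty, Set.encard_empty] at hroot
    have : 0 = q := by exact_mod_cast hroot
    omega
  obtain ⟨e, he⟩ := hne
  have he' : e ∈ ⋃₀ B.on := by
    rw [hB.on_decomp.2.2]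
    exact Or.inr he
  obtain ⟨K, hK, -⟩ := he'
  have hKc := hB.on_decomp.1 K hK
  have hKsub : ⋃₀ K ⊆ B.verts := by
    rintro x ⟨f, hf, hxf⟩
    have hf' : f ∈ B.edges ∪ B.root := by
      rw [← hB.on_decomp.2.2]
      exact ⟨K, hK, hf⟩
    rcases hf' with hf' | hf'
    · exact hB.edges_subset ⟨f, hf', hxf⟩
    · exact hB.root_subset ⟨f, hf', hxf⟩
  have hKroot : K = B.root := by
    refine IsClique.injOn_cliqueVerts hr hqr hKc hB.isClique_root ?_
    refine Finset.eq_of_subset_of_card_le ?_ ?_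
    · rw [← Finset.coe_subset, coe_cliqueVerts, coe_cliqueVerts, hverts]
      exact hKsub
    · rw [hKc.card_cliqueVerts hr hqr, hB.isClique_root.card_cliqueVerts hr hqr]
  exact hB.root_notMem_on (hKroot ▸ hK)

/-- The bounds for a single step in the boosters of a sponge, where `lam` bounds the density of
the reserve and the absorber. -/
lemma stepBounds_of_sponge {k C : ℕ} (hr : 1 ≤ r) (hqr : r ≤ q)
    (hk : B₀.verts.encard = q + k) (hfull : IsFull q r B₀ (complete r Set.univ) A X 𝓗 𝓑)
    (hS : IsSponge q r (complete r Set.univ) A X 𝓗) (hR : IsSpongeRefined r A X 𝓗 C)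
    (hN : 1 ≤ Fintype.card V) {p c' lam : ℝ} (L : ℕ) (hp : 0 ≤ p)
    (hpk : p * (Fintype.card V : ℝ) ^ k ≤ c') (hlam0 : 0 ≤ lam) (hlam : lam ≤ 1) (hc' : 1 ≤ c')
    (hD : (maxDegree r X : ℝ) + maxDegree r A ≤ (C + 1) * lam * Fintype.card V) :
    StepBounds r (boosterFinset 𝓗 𝓑) (allCliques V q r) p (Fintype.card V)
      (4 ^ L * ((C + 1) * C + 1) * c') (4 ^ L * ((C + 1) * C + 1) * c' * lam) L (q + k) := by
  obtain ⟨-, -, -, 𝒬, h𝒬⟩ := hS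
  have h𝓗 : ∀ H ∈ rootFinset 𝓗, IsClique q r H ∧ H ⊆ X ∪ A := fun H hH =>
    h𝒬.isClique H (by simpa [rootFinset] using hH)
  have hC : ∀ e ∈ X ∪ A, ((rootFinset 𝓗).filter fun H => e ∈ H).card ≤ C := fun e he => by
    have h1 := hR.1 e he
    have h2 : {H ∈ 𝓗 | e ∈ H}.ncard = ((rootFinset 𝓗).filter fun H => e ∈ H).card := by
      rw [← Set.ncard_coe_finset]
      congr 1
      ext H
      simp [rootFinset]
    rw [h2] at h1
    exact_mod_cast h1
  have hDW : ∀ S : Finset V, S.card = r - 1 → codegree (X ∪ A) (S : Set V) ≤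
      maxDegree r X + maxDegree r A := fun S hS =>
    (codegree_union_le _ _ _).trans (Nat.add_le_add
      (codegree_le_maxCodegree _ (encard_coe_eq.2 hS))
      (codegree_le_maxCodegree _ (encard_coe_eq.2 hS)))
  refine (boosterFamily_of_isFull hr hqr hk hfull).stepBounds hr hqr _
    (fun K hK => mem_allCliques.1 hK) hN L hp hpk hlam0 hlam (by positivity) hc' ?_ ?_
  · intro U hU
    have h1 := card_roots_le_of_sparse hr hqr h𝓗 hC hDW hU
    have h2 : (Fintype.card V : ℝ) ^ (r - U.card) =
        (Fintype.card V : ℝ) ^ (r - 1 - U.card) * Fintype.card V := by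
      rw [← pow_succ]
      congr 1
      omega
    calc (((rootFinset 𝓗).filter fun H => U ⊆ cliqueVerts H).card : ℝ)
        ≤ (Fintype.card V : ℝ) ^ (r - 1 - U.card) * ((maxDegree r X : ℝ) + maxDegree r A) * C := by
          exact_mod_cast h1
      _ ≤ (Fintype.card V : ℝ) ^ (r - 1 - U.card) * ((C + 1) * lam * Fintype.card V) * C := by
          gcongr
      _ = (C + 1) * C * lam * (Fintype.card V : ℝ) ^ (r - U.card) := by rw [h2]; ring
  · intro U hU
    have h1 := card_roots_le_of_dense hr hqr h𝓗 hC hU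
    have h2 : (((rootFinset 𝓗).filter fun H => U ⊆ cliqueVerts H).card : ℝ) ≤ C := by
      exact_mod_cast h1
    nlinarith [(Nat.cast_nonneg C : (0 : ℝ) ≤ C)]

end Sponge

/-! ### Regularity of the projection treasury of a typical sparsification -/

section Typical
variable {V W : Type*} [Fintype V]
variable {q r g : ℕ} {B₀ : RootedBooster W} {A X : Set (Set V)} {𝓗 : Set (Set (Set V))}
  {𝓑 : Set (Set V) → Set (RootedBooster V)} {ω : Set (RootedBooster V)}

/-- The families of structures are not much larger than their expectations, relative to `δ` (for
those that include some booster) and the smaller `η` (for those in which a further factor `n` is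
lost). -/
structure IsTypical (q r g : ℕ) (ℬ : Finset (RootedBooster V)) (𝒢s : Finset (Finset (Set (Set V))))
    (δ η : ℝ) (ω : Set (RootedBooster V)) : Prop where
  removed : ∀ 𝒢 ∈ 𝒢s, ∀ x : Finset V, x.card = r →
    (monomialCount (removedStructs (q - r) r g ℬ 𝒢 x) Prod.fst ω : ℝ) ≤
      (𝒢.filter fun K => x ⊆ cliqueVerts K).card * δ + η * (Fintype.card V : ℝ) ^ (q - r)
  config_degree : ∀ s, 2 ≤ s → s ≤ g → ∀ K ∈ allCliques V q r,
    (monomialCount ((configStructs (q - r) r g ℬ (allCliques V q r) s {K}).filter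
      fun e => e.1.Nonempty) Prod.fst ω : ℝ) ≤ δ * ((Fintype.card V : ℝ) ^ (q - r)) ^ (s - 1)
  config_codegree : ∀ s ≤ g, ∀ U ⊆ allCliques V q r, 2 ≤ U.card → U.card < s →
    (monomialCount (configStructs (q - r) r g ℬ (allCliques V q r) s U) Prod.fst ω : ℝ) ≤
      η * ((Fintype.card V : ℝ) ^ (q - r)) ^ (s - U.card)
  pair : ∀ K ∈ allCliques V q r, ∀ x : Finset V, x.card = r → ¬ x ⊆ cliqueVerts K →
    (monomialCount (pairStructs (q - r) r g ℬ (allCliques V q r) K x) Prod.fst ω : ℝ) ≤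
      η * (Fintype.card V : ℝ) ^ (q - r)
  common : ∀ u ∈ allCliques V q r, ∀ v ∈ allCliques V q r,
    (cliqueVerts u ∩ cliqueVerts v).card < r →
    (monomialCount (commonStructs (q - r) r g ℬ (allCliques V q r) u v) Prod.fst ω : ℝ) ≤
      η * (Fintype.card V : ℝ) ^ (q - r)

lemma codegree_eq_card (hr : 1 ≤ r) (hqr : r ≤ q) {𝒢 : Set (Set (Set V))}
    (h𝒢 : ∀ K ∈ 𝒢, IsClique q r K) {x : Finset V} (hx : x.card = r) :
    codegree 𝒢 {(x : Set V)} = (𝒢.toFinset.filter fun K => x ⊆ cliqueVerts K).card := by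
  rw [codegree, ← Set.ncard_coe_finset]
  congr 1
  ext K
  simp only [Set.mem_ofPred_eq, Set.singleton_subset_iff, Finset.coe_filter, Set.mem_toFinset]
  refine and_congr_right fun hK => ?_
  rw [(h𝒢 K hK).mem_iff hr hqr]
  simp [hx]

lemma codegree_eq_zero_of_not_subset {α : Type*} [Finite α] {E : Set (Set α)} {U : Set α}
    (h : ∀ e ∈ E, ¬ U ⊆ e) : codegree E U = 0 := by
  rw [codegree, Set.ncard_eq_zero]
  exact Set.eq_empty_of_forall_notMem fun e he => h e he.1 he.2

/-- The design and reserve parts of the treasury, as finsets of cliques. -/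
def treasuryCliques (q r g : ℕ) (A X : Set (Set V)) : Finset (Finset (Set (Set V))) :=
  {(designTreasury q r g (complete r Set.univ) (complete r Set.univ \ A) X).G₁.edgeSet.toFinset,
    (designTreasury q r g (complete r Set.univ) (complete r Set.univ \ A) X).G₂.edgeSet.toFinset}

/-- The structures that are present account for all differences between the treasury and its
projection. The codegree bounds for configurations do not use those for the original treasury: the
original configurations are counted as structures without boosters. -/
lemma isRegular_of_isTypical (h : Setting q r g B₀ A X 𝓗 𝓑)
    (hS : IsSponge q r (complete r Set.univ) A X 𝓗) {D α β β' δ η : ℝ}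
    (hreg : (designTreasury q r g (complete r Set.univ) (complete r Set.univ \ A) X).IsRegular g
      D (α * D) β α)
    (ht : IsTypical q r g (boosterFinset 𝓗 𝓑) (treasuryCliques q r g A X) δ η ω)
    (hα : 0 ≤ α) (hδ₀ : 0 ≤ δ) (hD : 1 ≤ D) (hβ : β' ≤ β)
    (hdeg : δ * D + η * (Fintype.card V : ℝ) ^ (q - r) ≤ α * D) (hδ : δ ≤ 1 / 4)
    (hres : η * (Fintype.card V : ℝ) ^ (q - r) ≤ D ^ (1 - α) / 4)
    (hconf : ∀ i : ℕ, 2 ≤ i → i ≤ g →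
      δ * ((Fintype.card V : ℝ) ^ (q - r)) ^ (i - 1) ≤ α * D ^ (i - 1) * Real.log D)
    (hcod : ∀ k : ℕ, 1 ≤ k → k ≤ g →
      η * ((Fintype.card V : ℝ) ^ (q - r)) ^ k ≤ D ^ ((k : ℝ) - β'))
    (hhalf : D ^ (1 - 2 * α) ≤ D ^ (1 - α) / 2) (hg : 1 ≤ g) :
    (projTreasury q r g (complete r Set.univ) A X 𝓗 (restrict 𝓑 ω)).IsRegular g
      D (2 * α * D) β' (2 * α) := by
  have hr := h.one_le
  have hqr := h.lt.le
  obtain ⟨-, hX, -, -⟩ := hS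
  set T₀ := designTreasury q r g (complete r Set.univ) (complete r Set.univ \ A) X with hT₀
  set T := projTreasury q r g (complete r Set.univ) A X 𝓗 (restrict 𝓑 ω) with hT
  have hV : ∀ v ∈ T₀.G₁.vertexSet ∪ T₀.G₂.vertexSet,
      ∃ x : Finset V, (x : Set V) = v ∧ x.card = r := by
    intro v hv
    have hvr : v.encard = r := by
      rcases hv with hv | hv | hv
      exacts [hv.1.1.2, hv.1.1.2, (hX hv).2]
    refine ⟨v.toFinset, by simp, ?_⟩
    rw [← encard_coe_eq]
    simpa using hvr
  have hc₁ : ∀ K ∈ T₀.G₁.edgeSet, IsClique q r K := fun K hK => hK.2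
  have hc₂ : ∀ K ∈ T₀.G₂.edgeSet, IsClique q r K := fun K hK => hK.2.1
  have hcod1 := hcod 1 le_rfl hg
  rw [pow_one, Nat.cast_one] at hcod1
  refine ⟨?_, ?_, ?_, ?_, ?_, ?_, ?_, ?_, ?_⟩
  · intro v hv
    refine le_trans ?_ (hreg.degree_le v hv)
    exact_mod_cast codegree_mono Set.inter_subset_left _
  · intro v hv
    obtain ⟨x, rfl, hx⟩ := hV v (Or.inl hv.1)
    have h1 := hreg.le_degree _ hv
    have h2 := hreg.degree_le _ hv.1
    have h3 := (Nat.cast_le (α := ℝ)).2 (h.codegree_le_add (ω := ω) hc₁ (x := x))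
    rw [Nat.cast_add] at h3
    change (codegree T₀.G₁.edgeSet {(x : Set V)} : ℝ) ≤
      (codegree T.G₁.edgeSet {(x : Set V)} : ℝ) + _ at h3
    have h4 := ht.removed T₀.G₁.edgeSet.toFinset (by simp [treasuryCliques, hT₀]) x hx
    rw [← codegree_eq_card hr hqr hc₁ hx] at h4
    have h5 := mul_le_mul_of_nonneg_right h2 hδ₀
    nlinarith
  · intro v hv
    refine le_trans ?_ (hreg.reserve_degree_le v hv)
    exact_mod_cast codegree_mono Set.inter_subset_left _
  · intro v hv
    obtain ⟨x, rfl, hx⟩ := hV v (Or.inl hv.1)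
    have h1 := hreg.le_reserve_degree _ hv
    have h3 := (Nat.cast_le (α := ℝ)).2 (h.codegree_le_add (ω := ω) hc₂ (x := x))
    rw [Nat.cast_add] at h3
    change (codegree T₀.G₂.edgeSet {(x : Set V)} : ℝ) ≤
      (codegree T.G₂.edgeSet {(x : Set V)} : ℝ) + _ at h3
    have h4 := ht.removed T₀.G₂.edgeSet.toFinset (by simp [treasuryCliques, hT₀]) x hx
    rw [← codegree_eq_card hr hqr hc₂ hx] at h4
    have h5 := mul_le_mul_of_nonneg_left hδ
      (Nat.cast_nonneg (codegree T₀.G₂.edgeSet {(x : Set V)}) : (0 : ℝ) ≤ _)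
    linarith
  · intro i hi hig
    have hD0 : 0 ≤ α * D ^ (i - 1) * Real.log D := by
      have := Real.log_nonneg hD
      positivity
    refine maxCodegree_le (by linarith) fun U hU => ?_
    obtain ⟨K, rfl⟩ := Set.encard_eq_one.1 (by simpa using hU)
    by_cases hK : IsClique q r K
    · have h1 := (Nat.cast_le (α := ℝ)).2 (h.codegree_level_le_add (ω := ω) i (U := {K}))
      rw [Nat.cast_add] at h1
      have h2 : (codegree (T₀.level i) {K} : ℝ) ≤ maxCodegree (T₀.level i) 1 := by
        exact_mod_cast codegree_le_maxCodegree _ hU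
      have h3 := hreg.config_degree_le i hi hig
      have h4 := ht.config_degree i hi hig K (mem_allCliques.2 hK)
      have h5 := hconf i hi hig
      rw [Set.toFinset_singleton] at h1
      linarith
    · rw [codegree_eq_zero_of_not_subset]
      · rw [Nat.cast_zero]
        linarith
      · exact fun F hF hKF => hK (hF.1.1 (hKF rfl)).1.2
  · have h1 : T.edges ⊆ T₀.edges := Set.union_subset_union Set.inter_subset_left
      Set.inter_subset_left
    have h2 : (maxCodegree T.edges 2 : ℝ) ≤ maxCodegree T₀.edges 2 := by
      exact_mod_cast maxCodegree_mono h1 2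
    refine (h2.trans hreg.codegree_le).trans (Real.rpow_le_rpow_of_exponent_le hD (by linarith))
  · intro t s ht2 hts hsg
    refine maxCodegree_le (by positivity) fun U hU => ?_
    by_cases hK : ∀ K ∈ U, IsClique q r K
    · have h1 := (Nat.cast_le (α := ℝ)).2 (h.codegree_level_le (ω := ω) s (U := U))
      have hUt : U.toFinset.card = t := by
        rw [← encard_coe_eq]
        simpa using hU
      have h2 := ht.config_codegree s hsg U.toFinset
        (fun K hK' => mem_allCliques.2 (hK K (by simpa using hK'))) (by omega) (by omega)
      have h3 := hcod (s - t) (by omega) (by omega)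
      rw [hUt] at h2
      rw [Nat.cast_sub hts.le] at h3
      exact (h1.trans h2).trans h3
    · rw [codegree_eq_zero_of_not_subset]
      · rw [Nat.cast_zero]
        positivity
      · push Not at hK
        obtain ⟨K, hKU, hK⟩ := hK
        exact fun F hF hUF => hK (hF.1.1 (hUF hKU)).1.2
  · intro v hv e he hve
    obtain ⟨x, rfl, hx⟩ := hV v hv
    have hec : IsClique q r e := by
      rcases he with he | he
      exacts [hc₁ e he.1, hc₂ e he.1]
    have h1 := ht.pair e (mem_allCliques.2 hec) x hx
      fun hxe => hve ((hec.mem_iff hr hqr).2 ⟨hxe, hx⟩)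
    exact ((Nat.cast_le.2 (h.two_codegree_le (ω := ω) hve)).trans h1).trans hcod1
  · intro u hu v hv _ huv
    have huc : IsClique q r u := hu.1.2
    have hvc : IsClique q r v := hv.1.2
    have h1 := ht.common u (mem_allCliques.2 huc) v (mem_allCliques.2 hvc) (by
      by_contra! hcon
      obtain ⟨e, he, hec⟩ := Finset.exists_subset_card_eq hcon
      exact Set.disjoint_left.1 huv
        ((huc.mem_iff hr hqr).2 ⟨he.trans Finset.inter_subset_left, hec⟩)
        ((hvc.mem_iff hr hqr).2 ⟨he.trans Finset.inter_subset_right, hec⟩))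
    exact ((Nat.cast_le.2 (h.common_two_degree_le (ω := ω))).trans h1).trans hcod1

end Typical

/-! ### Typical sparsifications are likely -/

section Likely
variable {V : Type*} [Fintype V]

lemma card_allCliques_le {q r : ℕ} (hr : 1 ≤ r) (hqr : r ≤ q) :
    (allCliques V q r).card ≤ Fintype.card V ^ q := by
  refine (Finset.card_le_card_of_injOn (t := Finset.powersetCard q Finset.univ) cliqueVerts
    (fun K hK => ?_) fun K hK K' hK' => IsClique.injOn_cliqueVerts hr hqr (mem_allCliques.1 hK)
      (mem_allCliques.1 hK')).trans ?_
  · simpa using (mem_allCliques.1 hK).card_cliqueVerts hr hqr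
  · rw [Finset.card_powersetCard, Finset.card_univ]
    exact Nat.choose_le_pow _ _

variable {q r g v₀ : ℕ} {ℬ : Finset (RootedBooster V)} {𝒢s : Finset (Finset (Set (Set V)))}
  {B B₀ : ℝ}

/-- The families of structures that are controlled, each with a bound for its expected partial
derivatives. Here `ε` is the bound relative to the number of cliques with given vertices for
structures that include some booster, and `κ` is the one for structures that lose a factor `n`. -/
def controlled (q r g : ℕ) (ℬ : Finset (RootedBooster V)) (𝒢s : Finset (Finset (Set (Set V))))
    (ε κ : ℝ) : Finset (Finset (Struct V) × ℝ) :=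
  ((𝒢s ×ˢ Finset.powersetCard r Finset.univ).image fun y =>
    (removedStructs (q - r) r g ℬ y.1 y.2, (y.1.filter fun K => y.2 ⊆ cliqueVerts K).card * ε +
      κ * (Fintype.card V : ℝ) ^ (q - r))) ∪
  ((Finset.Icc 2 g ×ˢ allCliques V q r).image fun y =>
    ((configStructs (q - r) r g ℬ (allCliques V q r) y.1 {y.2}).filter fun e => e.1.Nonempty,
      ε * ((Fintype.card V : ℝ) ^ (q - r)) ^ (y.1 - 1))) ∪
  (((Finset.range (g + 1) ×ˢ (allCliques V q r).powerset.filter fun U => U.card ≤ g).filter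
    fun y => 2 ≤ y.2.card ∧ y.2.card < y.1).image fun y =>
    (configStructs (q - r) r g ℬ (allCliques V q r) y.1 y.2,
      κ * ((Fintype.card V : ℝ) ^ (q - r)) ^ (y.1 - y.2.card))) ∪
  (((allCliques V q r ×ˢ Finset.powersetCard r Finset.univ).filter fun y =>
    ¬ y.2 ⊆ cliqueVerts y.1).image fun y =>
    (pairStructs (q - r) r g ℬ (allCliques V q r) y.1 y.2, κ * (Fintype.card V : ℝ) ^ (q - r))) ∪
  (((allCliques V q r ×ˢ allCliques V q r).filter fun y =>
    (cliqueVerts y.1 ∩ cliqueVerts y.2).card < r).image fun y =>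
    (commonStructs (q - r) r g ℬ (allCliques V q r) y.1 y.2, κ * (Fintype.card V : ℝ) ^ (q - r)))

lemma card_controlled_le (hr : 1 ≤ r) (hqr : r ≤ q) (hg : 3 ≤ g) (hN : 1 ≤ Fintype.card V)
    (h𝒢s : 𝒢s.card ≤ 2) (ε κ : ℝ) :
    (controlled q r g ℬ 𝒢s ε κ).card ≤ (g + 3) ^ 2 * (Fintype.card V ^ q + 1) ^ g := by
  set N := Fintype.card V
  set Q := (N ^ q + 1) ^ g with hQ
  have h𝒦 := card_allCliques_le (V := V) hr hqr
  have hx : (Finset.powersetCard r (Finset.univ : Finset V)).card ≤ N ^ q := by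
    rw [Finset.card_powersetCard, Finset.card_univ]
    exact (Nat.choose_le_pow _ _).trans (Nat.pow_le_pow_right hN hqr)
  have hQ2 : N ^ q * N ^ q ≤ Q := by
    calc N ^ q * N ^ q ≤ (N ^ q + 1) ^ 2 := by rw [sq]; gcongr <;> omega
      _ ≤ Q := Nat.pow_le_pow_right (by omega) (by omega)
  have hQ1 : N ^ q ≤ Q := le_trans (Nat.le_mul_of_pos_right _ (by positivity)) hQ2
  have hU := card_powerset_card_le (allCliques V q r) g (N ^ q) h𝒦
  rw [controlled]
  refine (Finset.card_union_le _ _).trans ?_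
  refine (Nat.add_le_add_right (Finset.card_union_le _ _) _).trans ?_
  refine (Nat.add_le_add_right (Nat.add_le_add_right (Finset.card_union_le _ _) _) _).trans ?_
  refine (Nat.add_le_add_right (Nat.add_le_add_right (Nat.add_le_add_right
    (Finset.card_union_le _ _) _) _) _).trans ?_
  have h1 := Finset.card_image_le (s := 𝒢s ×ˢ Finset.powersetCard r (Finset.univ : Finset V))
    (f := fun y => (removedStructs (q - r) r g ℬ y.1 y.2,
      ((y.1.filter fun K => y.2 ⊆ cliqueVerts K).card * ε + κ * (N : ℝ) ^ (q - r) : ℝ)))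
  have h2 := Finset.card_image_le (s := Finset.Icc 2 g ×ˢ allCliques V q r)
    (f := fun y => ((configStructs (q - r) r g ℬ (allCliques V q r) y.1 {y.2}).filter
      fun e => e.1.Nonempty, (ε * ((N : ℝ) ^ (q - r)) ^ (y.1 - 1) : ℝ)))
  have h3 := (Finset.card_image_le (s := (Finset.range (g + 1) ×ˢ
      (allCliques V q r).powerset.filter fun U => U.card ≤ g).filter
        fun y => 2 ≤ y.2.card ∧ y.2.card < y.1)
    (f := fun y => (configStructs (q - r) r g ℬ (allCliques V q r) y.1 y.2,
      (κ * ((N : ℝ) ^ (q - r)) ^ (y.1 - y.2.card) : ℝ)))).trans (Finset.card_filter_le _ _)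
  have h4 := (Finset.card_image_le (s := (allCliques V q r ×ˢ
      Finset.powersetCard r Finset.univ).filter fun y => ¬ y.2 ⊆ cliqueVerts y.1)
    (f := fun y => (pairStructs (q - r) r g ℬ (allCliques V q r) y.1 y.2,
      (κ * (N : ℝ) ^ (q - r) : ℝ)))).trans (Finset.card_filter_le _ _)
  have h5 := (Finset.card_image_le (s := (allCliques V q r ×ˢ allCliques V q r).filter fun y =>
      (cliqueVerts y.1 ∩ cliqueVerts y.2).card < r)
    (f := fun y => (commonStructs (q - r) r g ℬ (allCliques V q r) y.1 y.2,
      (κ * (N : ℝ) ^ (q - r) : ℝ)))).trans (Finset.card_filter_le _ _)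
  rw [Finset.card_product] at h1 h2 h3 h4 h5
  rw [Nat.card_Icc] at h2
  rw [Finset.card_range] at h3
  have e1 := h1.trans (Nat.mul_le_mul h𝒢s (hx.trans hQ1))
  have e2 := h2.trans (Nat.mul_le_mul_left _ (h𝒦.trans hQ1))
  have e3 := h3.trans (Nat.mul_le_mul_left _ hU)
  have e4 := h4.trans ((Nat.mul_le_mul h𝒦 hx).trans hQ2)
  have e5 := h5.trans ((Nat.mul_le_mul h𝒦 h𝒦).trans hQ2)
  have e6 : (g + 1 - 2) * Q ≤ g * Q := Nat.mul_le_mul_right _ (by omega)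
  refine (Nat.add_le_add (Nat.add_le_add (Nat.add_le_add (Nat.add_le_add e1 (e2.trans e6)) e3) e4)
    e5).trans ?_
  nlinarith

lemma zpow_natCast_sub_one {x : ℝ} (hx : 0 < x) (k d : ℕ) :
    x ^ ((k : ℤ) * d - 1) = x⁻¹ * (x ^ d) ^ k := by
  rw [zpow_sub_one₀ hx.ne', ← Nat.cast_mul, zpow_natCast, mul_comm k d, pow_mul, mul_comm]

/-- The expected partial derivatives of the controlled families. -/
lemma sum_controlled_le {p : ℝ} (h : StepBounds r ℬ (allCliques V q r) p (Fintype.card V) B B₀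
    (5 * g * v₀) v₀) (hg : 3 ≤ g) (hrv : r ≤ v₀) (h𝒢s : ∀ 𝒢 ∈ 𝒢s, 𝒢 ⊆ allCliques V q r)
    (hroot : ∀ 𝒢 ∈ 𝒢s, ∀ K ∈ 𝒢, ∀ b ∈ ℬ, (rootVerts b ∩ cliqueVerts K).card ≤ r) {ε κ : ℝ}
    (hκ : κ = (2 * g + 1) * B ^ (2 * g) * (Fintype.card V : ℝ)⁻¹)
    (hε : ε = g * (B₀ * B ^ (g - 2)) + κ) {τ : Finset (Struct V) × ℝ}
    (hτ : τ ∈ controlled q r g ℬ 𝒢s ε κ) :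
    0 < τ.2 ∧ (∀ e ∈ τ.1, e.1 ⊆ ℬ ∧ e.1.card ≤ 2 * g) ∧
      ∀ A, ∑ e ∈ τ.1 with A ⊆ e.1, p ^ (e.1 \ A).card ≤ τ.2 := by
  have hN : (0 : ℝ) < Fintype.card V := by linarith [h.one_le_N]
  have hB : 0 < B := by linarith [h.one_le_B]
  have hB₀ := h.B₀_nonneg
  have hκ0 : 0 < κ := by rw [hκ]; positivity
  have hε0 : 0 < ε := by rw [hε]; positivity
  have hz := zpow_natCast_sub_one hN
  have hz1 : (Fintype.card V : ℝ) ^ (((q - r : ℕ) : ℤ) - 1) =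
      (Fintype.card V : ℝ)⁻¹ * (Fintype.card V : ℝ) ^ (q - r) := by
    simpa using hz 1 (q - r)
  simp only [controlled, Finset.mem_union, Finset.mem_image, Finset.mem_product, Finset.mem_filter,
    Finset.mem_powersetCard, Finset.subset_univ, true_and, Finset.mem_Icc, Finset.mem_range,
    Finset.mem_powerset] at hτ
  rcases hτ with (((⟨⟨𝒢, x⟩, ⟨h𝒢, hx⟩, rfl⟩ | ⟨⟨s, K⟩, ⟨hs, hK⟩, rfl⟩) |
    ⟨⟨s, U⟩, ⟨⟨hs, hU, -⟩, hU2, hUs⟩, rfl⟩) | ⟨⟨K, x⟩, ⟨⟨hK, hx⟩, hxK⟩, rfl⟩) |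
    ⟨⟨u, v⟩, ⟨⟨hu, hv⟩, huv⟩, rfl⟩
  · refine ⟨by positivity, fun e he => ?_, fun A => ?_⟩
    · obtain ⟨h1, -, K, -, -, S, P, hext⟩ := mem_structs.1 he
      have := hext.card_add_card_le
      exact ⟨h1, by omega⟩
    · refine (sum_removedStructs_le h hg (h𝒢s 𝒢 h𝒢) (hroot 𝒢 h𝒢) hx hrv A).trans_eq ?_
      rw [hz1, zpow_neg_one, ← hκ, hε, hκ]
      ring
  · refine ⟨by positivity, fun e he => ?_, fun A => ?_⟩
    · rw [Finset.mem_filter] at he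
      have := card_le_of_configStructs he.1
      exact ⟨(mem_structs.1 he.1).1, by omega⟩
    · refine (sum_configStructs_singleton_le h hg hK hs.1 A).trans_eq ?_
      dsimp only
      rw [hz, ← Nat.cast_mul, zpow_natCast, mul_comm (s - 1) (q - r), pow_mul, hε, hκ]
      ring
  · refine ⟨by positivity, fun e he => ?_, fun A => ?_⟩
    · have := card_le_of_configStructs he
      exact ⟨(mem_structs.1 he).1, by omega⟩
    · refine (sum_configStructs_le h hU (Finset.card_pos.1 (by omega)) hUs A (Or.inl hU2)).trans_eq
        ?_
      dsimp only
      rw [hz, hκ]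
      ring
  · refine ⟨by positivity, fun e he => ?_, fun A => ?_⟩
    · obtain ⟨h1, -, K', -, -, -, S, P, hext⟩ := mem_structs.1 he
      have := hext.card_add_card_le
      exact ⟨h1, by omega⟩
    · refine (sum_pairStructs_le h hg hK (hx.trans_le hrv) hxK A).trans_eq ?_
      rw [hz1, hκ]
      ring
  · refine ⟨by positivity, fun e he => ?_, fun A => ?_⟩
    · obtain ⟨h1, -, w, I₁, I₂, -, -, -, hI, ⟨S, P, hext⟩, S', P', hext'⟩ := mem_structs.1 he
      have h2 := hext.card_add_card_le
      have h3 := hext'.card_add_card_le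
      have h4 := Finset.card_union_le I₁ I₂
      rw [← hI] at h4
      exact ⟨h1, by omega⟩
    · refine (sum_commonStructs_le h hg hu hv huv A).trans_eq ?_
      rw [hz1, hκ]
      ring

lemma isTypical_of_forall_controlled {ε κ Λ : ℝ} {ω : Set (RootedBooster V)}
    (h : ∀ τ ∈ controlled q r g ℬ 𝒢s ε κ, (monomialCount τ.1 Prod.fst ω : ℝ) ≤ Λ * τ.2) :
    IsTypical q r g ℬ 𝒢s (Λ * ε) (Λ * κ) ω where
  removed 𝒢 h𝒢 x hx := by
    refine (h (_, _) (Finset.mem_union_left _ (Finset.mem_union_left _ (Finset.mem_union_left _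
      (Finset.mem_union_left _ (Finset.mem_image.2 ⟨(𝒢, x), ?_, rfl⟩)))))).trans_eq ?_
    · simp [h𝒢, hx]
    · ring
  config_degree s hs hsg K hK := by
    refine (h (_, _) (Finset.mem_union_left _ (Finset.mem_union_left _ (Finset.mem_union_left _
      (Finset.mem_union_right _ (Finset.mem_image.2 ⟨(s, K), ?_, rfl⟩)))))).trans_eq ?_
    · simp [hs, hsg, hK]
    · ring
  config_codegree s hsg U hU hU2 hUs := by
    refine (h (_, _) (Finset.mem_union_left _ (Finset.mem_union_left _ (Finset.mem_union_right _
      (Finset.mem_image.2 ⟨(s, U), ?_, rfl⟩))))).trans_eq ?_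
    · simp only [Finset.mem_filter, Finset.mem_product, Finset.mem_range, Finset.mem_powerset]
      exact ⟨⟨by omega, hU, by omega⟩, hU2, hUs⟩
    · ring
  pair K hK x hx hxK := by
    refine (h (_, _) (Finset.mem_union_left _ (Finset.mem_union_right _
      (Finset.mem_image.2 ⟨(K, x), ?_, rfl⟩)))).trans_eq ?_
    · simp [hK, hx, hxK]
    · ring
  common u hu v hv huv := by
    refine (h (_, _) (Finset.mem_union_right _
      (Finset.mem_image.2 ⟨(u, v), ?_, rfl⟩))).trans_eq ?_
    · simp [hu, hv, huv]
    · ring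

/-- Outside an event of small probability, a random sparsification is typical. The probability
bound is a union bound over the controlled families. -/
lemma exists_measurableSet_isTypical {p : unitInterval} (h : StepBounds r ℬ (allCliques V q r) p
      (Fintype.card V) B B₀ (5 * g * v₀) v₀) (hr : 1 ≤ r) (hqr : r ≤ q) (hg : 3 ≤ g) (hrv : r ≤ v₀)
    (h𝒢s : ∀ 𝒢 ∈ 𝒢s, 𝒢 ⊆ allCliques V q r) (h𝒢c : 𝒢s.card ≤ 2)
    (hroot : ∀ 𝒢 ∈ 𝒢s, ∀ K ∈ 𝒢, ∀ b ∈ ℬ, (rootVerts b ∩ cliqueVerts K).card ≤ r)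
    {u : Set (RootedBooster V)} (hu : (ℬ : Set (RootedBooster V)) ⊆ u) {κ Λ : ℝ}
    (hκ : κ = (2 * g + 1) * B ^ (2 * g) * (Fintype.card V : ℝ)⁻¹) (t : ℕ)
    (hΛ : Λ = 2 * ((2 * g + 1) * (t * (2 * g) + 1) ^ (2 * g) : ℕ)) :
    ∃ E : Set (Set (RootedBooster V)), MeasurableSet E ∧
      (setBernoulli u p).real E ≤
        ((g + 3) ^ 2 * (Fintype.card V ^ q + 1) ^ g : ℕ) * 2⁻¹ ^ t ∧
      ∀ ω, ω ∉ E → IsTypical q r g ℬ 𝒢s (Λ * (g * (B₀ * B ^ (g - 2)) + κ)) (Λ * κ) ω := by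
  have hN : 1 ≤ Fintype.card V := by exact_mod_cast h.one_le_N
  set ε := g * (B₀ * B ^ (g - 2)) + κ with hε
  have hT := fun τ hτ => sum_controlled_le (τ := τ) h hg hrv h𝒢s hroot hκ hε hτ
  refine ⟨⋃ τ ∈ controlled q r g ℬ 𝒢s ε κ, {ω | Λ * τ.2 ≤ (monomialCount τ.1 Prod.fst ω : ℝ)},
    Finset.measurableSet_biUnion _ fun τ _ => measurableSet_le_monomialCount _ _ _, ?_, ?_⟩
  · have h1 := measure_exists_monomialCount_le u p (controlled q r g ℬ 𝒢s ε κ) Prod.fst Prod.fst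
      Prod.snd (m := 2 * g) (fun τ hτ e he => (Finset.coe_subset.2 ((hT τ hτ).2.1 e he).1).trans hu)
      (fun τ hτ e he => ((hT τ hτ).2.1 e he).2) (fun τ hτ => (hT τ hτ).1)
      (fun τ hτ => (hT τ hτ).2.2) t
    rw [hΛ]
    refine h1.trans ?_
    gcongr
    exact card_controlled_le hr hqr hg hN h𝒢c ε κ
  · intro ω hω
    refine isTypical_of_forall_controlled fun τ hτ => ?_
    by_contra! hcon
    exact hω (Set.mem_biUnion hτ hcon.le)

end Likely

/-! ### Numerical estimates -/

section Numerics
open Filter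

/-- The inequalities needed for the regularity of the projection treasury. Here `d = q - r` and `D`
is of order `n ^ d`. The powers of `D` in question fall short of a power of `n ^ d` by at most a
factor of order `n ^ (1 / 2)`, which `η` makes up for. -/
lemma regularity_estimates {d g : ℕ} (hd : 1 ≤ d) (hg : 1 ≤ g) {n D α γ δ η : ℝ} (hn : 1 ≤ n)
    (hα : 0 < α) (hαd : α < 1 / (2 * d)) (hγ : 0 < γ) (hγ1 : γ ≤ 1) (hη : 0 ≤ η)
    (hD : γ * n ^ d ≤ D) (hD1 : 1 ≤ D) (hDα : 2 ≤ D ^ α) (hlogD : 1 ≤ Real.log D)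
    (hδρ : δ ≤ α * γ ^ g / 4) (hηρ : η * n ^ (1 / 2 : ℝ) ≤ α * γ ^ g / 4) :
    δ * D + η * n ^ d ≤ α * D ∧ δ ≤ 1 / 4 ∧ η * n ^ d ≤ D ^ (1 - α) / 4 ∧
      (∀ i : ℕ, 2 ≤ i → i ≤ g → δ * (n ^ d) ^ (i - 1) ≤ α * D ^ (i - 1) * Real.log D) ∧
      (∀ k : ℕ, 1 ≤ k → k ≤ g → η * (n ^ d) ^ k ≤ D ^ ((k : ℝ) - 1 / (4 * g * d))) ∧
      D ^ (1 - 2 * α) ≤ D ^ (1 - α) / 2 := by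
  have hd0 : (1 : ℝ) ≤ d := by exact_mod_cast hd
  have hg0 : (1 : ℝ) ≤ g := by exact_mod_cast hg
  have hn0 : 0 < n := by linarith
  have hP : 0 < n ^ d := by positivity
  have hD0 : 0 < D := by linarith
  have hdα : d * α ≤ 1 / 2 := by
    rw [lt_div_iff₀ (by positivity)] at hαd
    linarith
  have hα1 : α ≤ 1 / 2 := by nlinarith
  have hγg : γ ^ g ≤ γ := pow_le_of_le_one hγ.le hγ1 (by omega)
  have hγg1 : γ ^ g ≤ 1 := pow_le_one₀ hγ.le hγ1
  have hγg0 : 0 < γ ^ g := by positivity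
  -- a power of `D` that is smaller by at most `n ^ (1 / 2)`
  have key : ∀ (k : ℕ) (s : ℝ), 1 ≤ k → k ≤ g → 0 ≤ s → s ≤ k → d * s ≤ 1 / 2 →
      η * (n ^ d) ^ k ≤ D ^ ((k : ℝ) - s) / 4 := by
    intro k s hk hkg hs hsk hds
    have h1 : (γ * n ^ d) ^ ((k : ℝ) - s) ≤ D ^ ((k : ℝ) - s) :=
      Real.rpow_le_rpow (by positivity) hD (by linarith)
    rw [Real.mul_rpow hγ.le hP.le] at h1
    have h2 : γ ^ g ≤ γ ^ ((k : ℝ) - s) := by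
      rw [← Real.rpow_natCast]
      refine Real.rpow_le_rpow_of_exponent_ge hγ hγ1 ?_
      have : (k : ℝ) ≤ g := by exact_mod_cast hkg
      linarith
    have h3 : (n ^ d) ^ k = (n ^ d) ^ ((k : ℝ) - s) * n ^ (d * s) := by
      rw [Real.rpow_mul hn0.le, Real.rpow_natCast, ← Real.rpow_add hP, sub_add_cancel,
        Real.rpow_natCast]
    have h4 : n ^ (d * s) ≤ n ^ (1 / 2 : ℝ) := Real.rpow_le_rpow_of_exponent_le hn hds
    have h5 : 0 < (n ^ d) ^ ((k : ℝ) - s) := by positivity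
    calc η * (n ^ d) ^ k = η * n ^ (d * s) * (n ^ d) ^ ((k : ℝ) - s) := by rw [h3]; ring
      _ ≤ η * n ^ (1 / 2 : ℝ) * (n ^ d) ^ ((k : ℝ) - s) := by gcongr
      _ ≤ (α * γ ^ g / 4) * (n ^ d) ^ ((k : ℝ) - s) := by gcongr
      _ ≤ (γ ^ ((k : ℝ) - s) / 4) * (n ^ d) ^ ((k : ℝ) - s) := by
          gcongr
          nlinarith
      _ ≤ D ^ ((k : ℝ) - s) / 4 := by linarith
  have hδα : δ ≤ α / 4 := by nlinarith
  have hη1 : η ≤ α * γ ^ g / 4 := by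
    have : 1 ≤ n ^ (1 / 2 : ℝ) := Real.one_le_rpow hn (by norm_num)
    nlinarith
  refine ⟨?_, by linarith, ?_, ?_, ?_, ?_⟩
  · have h1 : η * n ^ d ≤ α / 4 * D := by
      calc η * n ^ d ≤ α * γ / 4 * n ^ d := by
            gcongr
            nlinarith
        _ = α / 4 * (γ * n ^ d) := by ring
        _ ≤ α / 4 * D := by gcongr
    have h2 := mul_le_mul_of_nonneg_right hδα hD0.le
    nlinarith
  · simpa using key 1 α le_rfl hg hα.le (by push_cast; linarith) hdα
  · intro i hi hig
    have h1 : γ ^ g * (n ^ d) ^ (i - 1) ≤ D ^ (i - 1) := by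
      calc γ ^ g * (n ^ d) ^ (i - 1) ≤ γ ^ (i - 1) * (n ^ d) ^ (i - 1) := by
            have := pow_le_pow_of_le_one hγ.le hγ1 (show i - 1 ≤ g by omega)
            gcongr
        _ = (γ * n ^ d) ^ (i - 1) := (mul_pow _ _ _).symm
        _ ≤ D ^ (i - 1) := by gcongr
    have h2 : 0 < D ^ (i - 1) := by positivity
    calc δ * (n ^ d) ^ (i - 1) ≤ α * γ ^ g / 4 * (n ^ d) ^ (i - 1) := by gcongr
      _ = α / 4 * (γ ^ g * (n ^ d) ^ (i - 1)) := by ring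
      _ ≤ α / 4 * D ^ (i - 1) := by gcongr
      _ ≤ α * D ^ (i - 1) * 1 := by nlinarith
      _ ≤ α * D ^ (i - 1) * Real.log D := by gcongr
  · intro k hk hkg
    have hk0 : (1 : ℝ) ≤ k := by exact_mod_cast hk
    have h1 : (1 : ℝ) ≤ g * d := by nlinarith
    have h2 := key k (1 / (4 * g * d)) hk hkg (by positivity) (by
      rw [div_le_iff₀ (by positivity)]
      nlinarith) (by
      rw [mul_one_div, div_le_iff₀ (by positivity)]
      nlinarith)
    have h3 : 0 < D ^ ((k : ℝ) - 1 / (4 * g * d)) := by positivity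
    linarith
  · have h1 : D ^ (1 - α) = D ^ (1 - 2 * α) * D ^ α := by
      rw [← Real.rpow_add hD0]
      congr 1
      ring
    have h2 : 0 < D ^ (1 - 2 * α) := by positivity
    rw [h1]
    nlinarith

lemma le_choose {n k : ℕ} (h : 2 * k ≤ n) :
    ((2 : ℝ) ^ k * k.factorial)⁻¹ * (n : ℝ) ^ k ≤ n.choose k := by
  have h1 : (((n + 1 - k : ℕ) : ℝ)) ^ k ≤ k.factorial * n.choose k := by
    have := Nat.pow_sub_le_descFactorial n k
    rw [Nat.descFactorial_eq_factorial_mul_choose] at this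
    exact_mod_cast this
  have h2 : (n : ℝ) ≤ 2 * ((n + 1 - k : ℕ) : ℝ) := by
    have : n ≤ 2 * (n + 1 - k) := by omega
    exact_mod_cast this
  have h3 : (n : ℝ) ^ k ≤ 2 ^ k * (k.factorial * n.choose k) := by
    calc (n : ℝ) ^ k ≤ (2 * ((n + 1 - k : ℕ) : ℝ)) ^ k := by gcongr
      _ = 2 ^ k * ((n + 1 - k : ℕ) : ℝ) ^ k := mul_pow _ _ _
      _ ≤ _ := by gcongr
  rw [inv_mul_le_iff₀ (by positivity)]
  linarith

lemma exists_mul_pow_le_choose (k : ℕ) : ∃ γ : ℝ, 0 < γ ∧ γ ≤ 1 ∧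
    ∀ n : ℕ, 2 * k ≤ n → γ * (n : ℝ) ^ k ≤ n.choose k := by
  refine ⟨((2 : ℝ) ^ k * k.factorial)⁻¹, by positivity, inv_le_one_of_one_le₀ ?_,
    fun n hn => le_choose hn⟩
  have h1 : 1 ≤ 2 ^ k * k.factorial := Nat.succ_le_of_lt (by positivity)
  exact_mod_cast h1

lemma eventually_log_pow_le (M : ℕ) {c s : ℝ} (hc : 0 < c) (hs : 0 < s) :
    ∀ᶠ n : ℕ in atTop, Real.log n ^ M ≤ c * (n : ℝ) ^ s := by
  have h := (isLittleO_log_rpow_rpow_atTop (M : ℝ) hs).bound hc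
  filter_upwards [tendsto_natCast_atTop_atTop.eventually h, eventually_ge_atTop 1] with n hn hn1
  have h1 : (0 : ℝ) ≤ Real.log n := Real.log_natCast_nonneg n
  rw [Real.norm_of_nonneg (by positivity), Real.norm_of_nonneg (by positivity),
    Real.rpow_natCast] at hn
  exact hn

lemma eventually_le_log (c : ℝ) : ∀ᶠ n : ℕ in atTop, c ≤ Real.log n :=
  (Real.tendsto_log_atTop.comp tendsto_natCast_atTop_atTop).eventually_ge_atTop c

lemma two_inv_pow_le {n e : ℕ} (hn : 1 ≤ n) {t : ℕ} (ht : 2 * e * Real.log n ≤ t) :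
    (2⁻¹ : ℝ) ^ t ≤ ((n : ℝ) ^ e)⁻¹ := by
  have hn0 : (0 : ℝ) < n := by exact_mod_cast hn
  have hL : 0 ≤ Real.log n := Real.log_natCast_nonneg n
  rw [inv_pow]
  refine inv_anti₀ (by positivity) ?_
  rw [← Real.log_le_log_iff (by positivity) (by positivity), Real.log_pow, Real.log_pow]
  have h2 := Real.log_two_gt_d9
  have h3 : (0 : ℝ) ≤ e * Real.log n := by positivity
  nlinarith

end Numerics

section Parameters
open Filter

/-- The deviations of the controlled families, where `b * L ^ a` bounds the number of choices in a
step, with a further factor `L ^ (-g * a)` for sparse roots, and `L` is `log n`. As the density of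
the reserve and the absorber is `L ^ (-g * a)`, the structures that include some booster are rarer
by a factor `L ^ (-a)`, which exceeds the polylogarithmic factor `Λ` of the tail bound. -/
lemma deviation_le {g a : ℕ} (hg : 3 ≤ g) (ha : 2 * g + 1 ≤ a) {L b l Λ κ n ρ : ℝ} (hL : 1 ≤ L)
    (hb : 0 ≤ b) (hl : 0 ≤ l) (hΛ : Λ ≤ l * L ^ (2 * g)) (hn : 1 ≤ n)
    (hκ : κ = (2 * g + 1) * (b * L ^ a) ^ (2 * g) * n⁻¹)
    (hLρ : 2 * (l * g * b ^ (g - 1)) ≤ ρ * L)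
    (hnρ : 2 * (l * (2 * g + 1) * b ^ (2 * g)) * L ^ (2 * g + 2 * g * a) ≤ ρ * n ^ (1 / 2 : ℝ)) :
    Λ * κ * n ^ (1 / 2 : ℝ) ≤ ρ ∧
    Λ * (g * (b * L ^ a * (L ^ (g * a))⁻¹ * (b * L ^ a) ^ (g - 2)) + κ) ≤ ρ := by
  subst hκ
  have hL0 : 0 < L := by linarith
  have hn0 : 0 < n := by linarith
  have hs : n ^ (1 / 2 : ℝ) * n ^ (1 / 2 : ℝ) = n := by
    rw [← Real.rpow_add hn0]
    norm_num
  have hs1 : 1 ≤ n ^ (1 / 2 : ℝ) := Real.one_le_rpow hn (by norm_num)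
  set m := n ^ (1 / 2 : ℝ) with hm
  have hm0 : 0 < m := by linarith
  have h1 : Λ * ((2 * g + 1) * (b * L ^ a) ^ (2 * g) * n⁻¹) * m ≤ ρ / 2 := by
    calc Λ * ((2 * g + 1) * (b * L ^ a) ^ (2 * g) * n⁻¹) * m
        ≤ l * L ^ (2 * g) * ((2 * g + 1) * (b * L ^ a) ^ (2 * g) * n⁻¹) * m := by gcongr
      _ = l * (2 * g + 1) * b ^ (2 * g) * L ^ (2 * g + 2 * g * a) * m⁻¹ := by
          have h2 : L ^ (2 * g + 2 * g * a) = L ^ (2 * g) * (L ^ a) ^ (2 * g) := by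
            rw [← pow_mul, ← pow_add]
            congr 1
            ring
          rw [← hs, h2, mul_pow]
          field_simp
      _ ≤ ρ / 2 := by
          rw [← div_eq_mul_inv, div_le_iff₀ hm0]
          linarith
  have hκ : 0 ≤ (2 * g + 1) * (b * L ^ a) ^ (2 * g) * n⁻¹ := by positivity
  have hρ : 0 ≤ ρ := by
    by_contra! hcon
    have h2 : 0 ≤ 2 * (l * g * b ^ (g - 1)) := by positivity
    nlinarith
  have h3 : Λ * (g * (b * L ^ a * (L ^ (g * a))⁻¹ * (b * L ^ a) ^ (g - 2))) ≤ ρ / 2 := by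
    have h4 : b * L ^ a * (L ^ (g * a))⁻¹ * (b * L ^ a) ^ (g - 2) = b ^ (g - 1) * (L ^ a)⁻¹ := by
      obtain ⟨j, rfl⟩ : ∃ j, g = j + 2 := ⟨g - 2, by omega⟩
      rw [show j + 2 - 2 = j by omega, show j + 2 - 1 = j + 1 by omega,
        show (j + 2) * a = a * j + a + a by ring, pow_add, pow_add, mul_pow, ← pow_mul]
      field_simp
      ring
    rw [h4]
    calc Λ * (g * (b ^ (g - 1) * (L ^ a)⁻¹))
        ≤ l * L ^ (2 * g) * (g * (b ^ (g - 1) * (L ^ a)⁻¹)) := by gcongr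
      _ ≤ l * L ^ (2 * g) * (g * (b ^ (g - 1) * (L ^ (2 * g + 1))⁻¹)) := by gcongr
      _ = l * g * b ^ (g - 1) / L := by
          rw [pow_succ]
          field_simp
      _ ≤ ρ / 2 := by
          rw [div_le_iff₀ hL0]
          linarith
  have h5 : Λ * ((2 * g + 1) * (b * L ^ a) ^ (2 * g) * n⁻¹) ≤ ρ / 2 := by
    rcases le_or_gt 0 (Λ * ((2 * g + 1) * (b * L ^ a) ^ (2 * g) * n⁻¹)) with h0 | h0
    · exact (le_mul_of_one_le_right h0 hs1).trans h1
    · linarith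
  refine ⟨by linarith, ?_⟩
  rw [mul_add]
  linarith

/-- The tail bound is applied with moments of order `log n`. -/
lemma exists_moment (q g : ℕ) : ∃ l : ℝ, 0 ≤ l ∧ ∀ᶠ n : ℕ in atTop, ∃ t : ℕ,
    2 * ((2 * g + 1) * (t * (2 * g) + 1) ^ (2 * g) : ℕ) ≤ l * Real.log n ^ (2 * g) ∧
    ((g + 3) ^ 2 * (n ^ q + 1) ^ g : ℕ) * (2⁻¹ : ℝ) ^ t ≤ 1 / 10 := by
  set e := q * g + 1 with he
  refine ⟨2 * ((2 * g + 1) * ((2 * e + 1) * (2 * g) + 1) ^ (2 * g)), by positivity, ?_⟩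
  filter_upwards [eventually_le_log 1, eventually_ge_atTop (10 * (g + 3) ^ 2 * 2 ^ g),
    eventually_ge_atTop 1] with n hL hn hn1
  have hL0 : 0 ≤ 2 * e * Real.log n := by positivity
  refine ⟨⌈2 * e * Real.log n⌉₊, ?_, ?_⟩
  · have h1 := (Nat.ceil_lt_add_one hL0).le
    have h2 : (⌈2 * e * Real.log n⌉₊ : ℝ) * (2 * g) + 1 ≤
        ((2 * e + 1) * (2 * g) + 1) * Real.log n := by
      have h3 : (⌈2 * e * Real.log n⌉₊ : ℝ) ≤ (2 * e + 1) * Real.log n := by linarith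
      have h4 := mul_le_mul_of_nonneg_right h3 (by positivity : (0 : ℝ) ≤ 2 * g)
      linarith
    push_cast
    calc 2 * ((2 * (g : ℝ) + 1) * ((⌈2 * e * Real.log n⌉₊ : ℝ) * (2 * g) + 1) ^ (2 * g))
        ≤ 2 * ((2 * (g : ℝ) + 1) * (((2 * e + 1) * (2 * g) + 1) * Real.log n) ^ (2 * g)) := by
          gcongr
      _ = _ := by
          rw [mul_pow]
          ring
  · have h1 := two_inv_pow_le (e := e) hn1 (Nat.le_ceil (2 * e * Real.log n))
    have hn0 : (0 : ℝ) < n := by exact_mod_cast hn1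
    have h2 : (n ^ q + 1) ^ g ≤ 2 ^ g * n ^ (q * g) := by
      rw [pow_mul, ← mul_pow]
      have := Nat.one_le_pow q n hn1
      gcongr
      omega
    calc (((g + 3) ^ 2 * (n ^ q + 1) ^ g : ℕ) : ℝ) * (2⁻¹ : ℝ) ^ ⌈2 * e * Real.log n⌉₊
        ≤ (((g + 3) ^ 2 * (2 ^ g * n ^ (q * g)) : ℕ) : ℝ) * ((n : ℝ) ^ e)⁻¹ := by gcongr
      _ = (((g + 3) ^ 2 * 2 ^ g : ℕ) : ℝ) / n := by
          rw [he, pow_succ]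
          push_cast
          field_simp
          ring
      _ ≤ 1 / 10 := by
          rw [div_le_div_iff₀ hn0 (by norm_num)]
          have : (g + 3) ^ 2 * 2 ^ g * 10 ≤ 1 * n := by linarith
          exact_mod_cast this

end Parameters

/-! ### Sparsifications of full collections of boosters -/

section Main
open Filter

/-- The density of the reserve and the absorber. The second term in the bound for the absorber is
negligible. -/
lemma maxDegree_add_le {V : Type*} {r C M : ℕ} {A X : Set (Set V)}
    {𝓗 : Set (Set (Set V))} (hV : 1 ≤ Nat.card V) (hL : 1 ≤ Real.log (Nat.card V))
    (hM : Real.log (Nat.card V) ^ (M + 1) ≤ (Nat.card V : ℝ) ^ (1 / r : ℝ))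
    (hX : IsSpongeBounded r X M) (hA : IsSpongeRefined r A X 𝓗 C) :
    (maxDegree r X : ℝ) + maxDegree r A ≤
      (C + 1) * (Real.log (Nat.card V) ^ M)⁻¹ * Nat.card V := by
  have hX' : (maxDegree r X : ℝ) ≤ Nat.card V / Real.log (Nat.card V) ^ M := hX
  have hA' := hA.2
  set n : ℝ := (Nat.card V : ℝ)
  have hn : 0 < n := by
    have : (1 : ℝ) ≤ n := Nat.one_le_cast.2 hV
    linarith
  set L := Real.log n
  have hL0 : 0 < L ^ M := by positivity
  have h1 : n ^ (1 - 1 / r : ℝ) * L ≤ n / L ^ M := by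
    rw [le_div_iff₀ hL0]
    calc n ^ (1 - 1 / r : ℝ) * L * L ^ M = n ^ (1 - 1 / r : ℝ) * L ^ (M + 1) := by ring
      _ ≤ n ^ (1 - 1 / r : ℝ) * n ^ (1 / r : ℝ) := by gcongr
      _ = n := by
          rw [← Real.rpow_add hn, sub_add_cancel, Real.rpow_one]
  have h2 : (C : ℝ) * max (maxDegree r X : ℝ) (n ^ (1 - 1 / r : ℝ) * L) ≤ C * (n / L ^ M) := by
    gcongr
    exact max_le hX' h1
  have h3 : (C + 1 : ℝ) * (L ^ M)⁻¹ * n = n / L ^ M + C * (n / L ^ M) := by ring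
  linarith

/-- With probability at least `9 / 10` the projection treasury is regular, provided that the bounds
for a single step satisfy the numerical conditions. -/
lemma le_measureReal_isRegular {V W : Type*} [Fintype V] {q r g v₀ : ℕ} {B₀ : RootedBooster W}
    {A X : Set (Set V)} {𝓗 : Set (Set (Set V))} {𝓑 : Set (Set V) → Set (RootedBooster V)}
    (h : Setting q r g B₀ A X 𝓗 𝓑) (hg : 3 ≤ g)
    (hS : IsSponge q r (complete r Set.univ) A X 𝓗) {p : unitInterval}
    {D α β β' B B₁ κ Λ δ η : ℝ}
    (hreg : (designTreasury q r g (complete r Set.univ) (complete r Set.univ \ A) X).IsRegular g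
      D (α * D) β α)
    (hstep : StepBounds r (boosterFinset 𝓗 𝓑) (allCliques V q r) p (Fintype.card V) B B₁
      (5 * g * v₀) v₀) (hrv : r ≤ v₀) (t : ℕ)
    (ht : ((g + 3) ^ 2 * (Fintype.card V ^ q + 1) ^ g : ℕ) * (2⁻¹ : ℝ) ^ t ≤ 1 / 10)
    (hκ : κ = (2 * g + 1) * B ^ (2 * g) * (Fintype.card V : ℝ)⁻¹)
    (hΛ : Λ = 2 * ((2 * g + 1) * (t * (2 * g) + 1) ^ (2 * g) : ℕ))
    (hδ : δ = Λ * (g * (B₁ * B ^ (g - 2)) + κ)) (hη : η = Λ * κ)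
    (hα : 0 ≤ α) (hδ₀ : 0 ≤ δ) (hD : 1 ≤ D) (hβ : β' ≤ β)
    (hdeg : δ * D + η * (Fintype.card V : ℝ) ^ (q - r) ≤ α * D) (hδ4 : δ ≤ 1 / 4)
    (hres : η * (Fintype.card V : ℝ) ^ (q - r) ≤ D ^ (1 - α) / 4)
    (hconf : ∀ i : ℕ, 2 ≤ i → i ≤ g →
      δ * ((Fintype.card V : ℝ) ^ (q - r)) ^ (i - 1) ≤ α * D ^ (i - 1) * Real.log D)
    (hcod : ∀ k : ℕ, 1 ≤ k → k ≤ g →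
      η * ((Fintype.card V : ℝ) ^ (q - r)) ^ k ≤ D ^ ((k : ℝ) - β'))
    (hhalf : D ^ (1 - 2 * α) ≤ D ^ (1 - α) / 2) :
    9 / 10 ≤ (sparsification 𝓗 𝓑 p).real
      {ω | (projTreasury q r g (complete r Set.univ) A X 𝓗 (restrict 𝓑 ω)).IsRegular g
        D (2 * α * D) β' (2 * α)} := by
  have hr := h.one_le
  have hqr := h.lt
  have hfull := h.isFull
  -- the treasury consists of cliques, which meet roots in at most one edge
  have hedges : ∀ 𝒢 ∈ treasuryCliques q r g A X, ∀ K ∈ 𝒢,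
      K ∈ (designTreasury q r g (complete r Set.univ) (complete r Set.univ \ A) X).edges := by
    intro 𝒢 h𝒢 K hK
    rw [treasuryCliques, Finset.mem_insert, Finset.mem_singleton] at h𝒢
    rcases h𝒢 with rfl | rfl
    · exact Or.inl (Set.mem_toFinset.1 hK)
    · exact Or.inr (Set.mem_toFinset.1 hK)
  have hsub : ∀ 𝒢 ∈ treasuryCliques q r g A X, 𝒢 ⊆ allCliques V q r := fun 𝒢 h𝒢 K hK => by
    rcases hedges 𝒢 h𝒢 K hK with h1 | h1
    exacts [mem_allCliques.2 h1.2, mem_allCliques.2 h1.2.1]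
  obtain ⟨E, hEm, hEp, hE⟩ := exists_measurableSet_isTypical (p := p)
    (u := ⋃ H ∈ 𝓗, 𝓑 H) hstep hr hqr.le hg hrv hsub Finset.card_le_two
    (fun 𝒢 h𝒢 K hK b hb => card_rootVerts_inter_le hr hqr.le hS
      (fun H hH B hB => (hfull.1 H hH B hB).2.1) (hedges 𝒢 h𝒢 K hK) hb)
    (by simp [boosterFinset]) hκ t hΛ
  rw [← hδ, ← hη] at hE
  have hcompl : (9 / 10 : ℝ) ≤ (setBernoulli (⋃ H ∈ 𝓗, 𝓑 H) p).real Eᶜ := by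
    rw [probReal_compl_eq_one_sub hEm]
    linarith
  rw [sparsification]
  exact hcompl.trans (measureReal_mono fun ω hω => isRegular_of_isTypical h hS hreg (hE ω hω) hα
    hδ₀ hD hβ hdeg hδ4 hres hconf hcod hhalf (by omega))

/-- The regularity of the projection treasury for a fixed exponent `a`. It has to be larger than
`2 * g` because structures involve at most `2 * g` boosters, for which the tail bound has a factor of
order `log n ^ (2 * g)`. -/
lemma eventually_isRegular (q r C g : ℕ) (hr : 1 ≤ r) (hqr : r < q) (hg : 3 ≤ g)
    (α : ℝ) (hα₀ : 0 < α) (hα : α < 1 / (2 * ((q : ℝ) - r)))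
    (m : ℕ) (B₀ : RootedBooster (Fin m)) (hB₀ : B₀.IsRootedBooster q r)
    (hB₀g : (g : ℕ∞) ≤ B₀.rootedGirth q r) (a : ℕ) (ha : 2 * g + 1 ≤ a) :
    ∀ᶠ n : ℕ in atTop,
      ∀ (A X : Set (Set (Fin n))) (𝓗 : Set (Set (Set (Fin n))))
        (𝓑 : Set (Set (Fin n)) → Set (RootedBooster (Fin n))),
        IsSponge q r (complete r Set.univ) A X 𝓗 →
        IsSpongeRegular q r (complete r Set.univ) A X α g →
        IsSpongeBounded r X (g * a) →
        IsSpongeRefined r A X 𝓗 C →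
        IsFull q r B₀ (complete r Set.univ) A X 𝓗 𝓑 →
        ∃ hp : Real.log n ^ a / (n.choose (B₀.verts.ncard - q) : ℝ) ∈ unitInterval,
          9 / 10 ≤ (sparsification 𝓗 𝓑 ⟨_, hp⟩).real
            {ω | (projTreasury q r g (complete r Set.univ) A X 𝓗 (restrict 𝓑 ω)).IsRegular g
              (n.choose (q - r)) (2 * α * n.choose (q - r))
              (1 / (4 * g * ((q : ℝ) - r))) (2 * α)} := by
  obtain ⟨k, hk0, hk⟩ : ∃ k : ℕ, 1 ≤ k ∧ B₀.verts.encard = q + k := by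
    have h1 := hB₀.lt_encard_verts hr hqr.le
    rw [← (Set.toFinite B₀.verts).cast_ncard_eq] at h1 ⊢
    have h2 : q < B₀.verts.ncard := by exact_mod_cast h1
    refine ⟨B₀.verts.ncard - q, by omega, ?_⟩
    rw [← Nat.cast_add, Nat.add_sub_cancel' h2.le]
  have hkn : B₀.verts.ncard - q = k := by
    have h1 := (Set.toFinite B₀.verts).cast_ncard_eq
    rw [hk] at h1
    have h2 : B₀.verts.ncard = q + k := by exact_mod_cast h1
    omega
  set d := q - r with hd
  have hd0 : 1 ≤ d := by omega
  have hdr : (q : ℝ) - r = d := by rw [hd, Nat.cast_sub hqr.le]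
  rw [hkn, hdr]
  rw [hdr] at hα
  have hβ : (1 : ℝ) / (4 * g * d) ≤ 1 / (2 * g * d) := by
    have : (0 : ℝ) < g * d := by positivity
    refine one_div_le_one_div_of_le (by positivity) ?_
    linarith
  obtain ⟨γ, hγ0, hγ1, hγ⟩ := exists_mul_pow_le_choose d
  obtain ⟨γk, hγk0, hγk1, hγk⟩ := exists_mul_pow_le_choose k
  obtain ⟨b, hb⟩ : ∃ b : ℝ, b = 4 ^ (5 * g * (q + k)) * ((C + 1) * C + 1) * γk⁻¹ := ⟨_, rfl⟩
  have hb0 : 0 ≤ b := by rw [hb]; positivity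
  obtain ⟨l, hl0, hl⟩ := exists_moment q g
  obtain ⟨ρ, hρ⟩ : ∃ ρ : ℝ, ρ = α * γ ^ g / 4 := ⟨_, rfl⟩
  have hρ0 : 0 < ρ := by rw [hρ]; positivity
  obtain ⟨c, hc⟩ : ∃ c : ℝ, c = 2 * (l * (2 * g + 1) * b ^ (2 * g)) := ⟨_, rfl⟩
  have hc0 : 0 ≤ c := by rw [hc]; positivity
  filter_upwards [hl, eventually_le_log 1, eventually_le_log (2 * (l * g * b ^ (g - 1)) / ρ),
    eventually_log_pow_le (2 * g + 2 * g * a) (show 0 < ρ / (c + 1) by positivity)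
      (show (0 : ℝ) < 1 / 2 by norm_num),
    eventually_log_pow_le (g * a + 1) one_pos (show (0 : ℝ) < 1 / r by positivity),
    eventually_log_pow_le a hγk0 one_pos, eventually_ge_atTop (2 * d), eventually_ge_atTop (2 * k),
    eventually_ge_atTop 1, eventually_le_log (1 - Real.log γ),
    eventually_le_log (Real.log 2 / α - Real.log γ)]
    with n ⟨t, ht, htp⟩ hL hLρ hnρ hLr hLa hnd hnk hn1 hLγ hLα A X 𝓗 𝓑 hS hreg hX hR hfull
  have hn0 : (1 : ℝ) ≤ n := by exact_mod_cast hn1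
  have hcard : Nat.card (Fin n) = n := Nat.card_fin n
  have hcard' : Fintype.card (Fin n) = n := Fintype.card_fin n
  have hdeg := maxDegree_add_le (M := g * a) (by rwa [hcard]) (by rwa [hcard])
    (by rw [hcard]; simpa using hLr) hX hR
  rw [hcard] at hdeg
  generalize hLn : Real.log n = L at *
  have hL0 : 0 < L := by linarith
  -- the retention probability
  have hch := hγk n hnk
  have hnk1 : (n : ℝ) ≤ (n : ℝ) ^ k := le_self_pow₀ hn0 (by omega)
  have hch0 : (0 : ℝ) < n.choose k := lt_of_lt_of_le (by positivity) hch
  have hp : L ^ a / (n.choose k : ℝ) ∈ unitInterval := by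
    refine ⟨by positivity, ?_⟩
    rw [div_le_one hch0]
    rw [Real.rpow_one] at hLa
    refine hLa.trans (le_trans ?_ hch)
    gcongr
  refine ⟨hp, ?_⟩
  have hpk : L ^ a / (n.choose k : ℝ) * (n : ℝ) ^ k ≤ γk⁻¹ * L ^ a := by
    rw [div_mul_eq_mul_div, div_le_iff₀ hch0]
    calc L ^ a * (n : ℝ) ^ k = γk⁻¹ * L ^ a * (γk * (n : ℝ) ^ k) := by field_simp
      _ ≤ γk⁻¹ * L ^ a * n.choose k := by gcongr
  have hc' : 1 ≤ γk⁻¹ * L ^ a :=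
    one_le_mul_of_one_le_of_one_le ((one_le_inv₀ hγk0).2 hγk1) (one_le_pow₀ hL)
  have hlam : (L ^ (g * a))⁻¹ ≤ 1 := inv_le_one_of_one_le₀ (one_le_pow₀ hL)
  -- the bounds for a single step
  have hstep := stepBounds_of_sponge (k := k) hr hqr.le hk hfull hS hR (by rwa [hcard'])
    (5 * g * (q + k)) hp.1 (by rw [hcard']; exact hpk) (by positivity) hlam hc' (by rwa [hcard'])
  have hBb : 4 ^ (5 * g * (q + k)) * ((C + 1) * C + 1) * (γk⁻¹ * L ^ a) = b * L ^ a := by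
    rw [hb]
    ring
  rw [hBb] at hstep
  -- the numerical conditions
  obtain ⟨Λ, hΛ⟩ : ∃ Λ : ℝ, Λ = 2 * ((2 * g + 1) * (t * (2 * g) + 1) ^ (2 * g) : ℕ) := ⟨_, rfl⟩
  obtain ⟨κ, hκ⟩ : ∃ κ : ℝ, κ = (2 * g + 1) * (b * L ^ a) ^ (2 * g) * (n : ℝ)⁻¹ := ⟨_, rfl⟩
  have hΛ0 : 0 ≤ Λ := by rw [hΛ]; positivity
  have hκ0 : 0 ≤ κ := by rw [hκ]; positivity
  rw [← hΛ] at ht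
  obtain ⟨hη, hδ⟩ := deviation_le hg ha hL hb0 hl0 ht hn0 hκ
    (by rwa [div_le_iff₀ hρ0, mul_comm L] at hLρ) (by
      rw [← hc]
      calc c * L ^ (2 * g + 2 * g * a) ≤ (c + 1) * (ρ / (c + 1) * (n : ℝ) ^ (1 / 2 : ℝ)) := by
            gcongr
            linarith
        _ = ρ * (n : ℝ) ^ (1 / 2 : ℝ) := by field_simp)
  obtain ⟨δ, hδd⟩ : ∃ δ : ℝ, δ =
    Λ * (g * (b * L ^ a * (L ^ (g * a))⁻¹ * (b * L ^ a) ^ (g - 2)) + κ) := ⟨_, rfl⟩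
  have hδ0 : 0 ≤ δ := by rw [hδd]; positivity
  rw [← hδd] at hδ
  have hreg' : (designTreasury q r g (complete r Set.univ) (complete r Set.univ \ A) X).IsRegular g
      (n.choose d) (α * n.choose d) (1 / (2 * g * d)) α := by
    have h1 := hreg
    rw [IsSpongeRegular, hcard, hdr] at h1
    exact h1
  have hD := hγ n hnd
  generalize (n.choose d : ℝ) = D at *
  have hnd1 : (n : ℝ) ≤ (n : ℝ) ^ d := le_self_pow₀ hn0 (by omega)
  have hγn : γ * n ≤ D := le_trans (by gcongr) hD
  have hlogD : Real.log γ + L ≤ Real.log D := by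
    rw [← hLn, ← Real.log_mul hγ0.ne' (by positivity)]
    exact Real.log_le_log (by positivity) hγn
  have hD0 : 0 < D := lt_of_lt_of_le (by positivity) hγn
  have hD1 : 1 ≤ D := (Real.log_nonneg_iff hD0).1 (by linarith)
  have hDα : 2 ≤ D ^ α := by
    rw [← Real.log_le_log_iff (by norm_num) (by positivity), Real.log_rpow hD0]
    have h1 : Real.log 2 / α ≤ Real.log D := by linarith
    rw [div_le_iff₀ hα₀] at h1
    linarith
  rw [hρ] at hδ hη
  obtain ⟨e₁, e₂, e₃, e₄, e₅, e₆⟩ := regularity_estimates hd0 (by omega : 1 ≤ g) hn0 hα₀ hα hγ0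
    hγ1 (by positivity) hD hD1 hDα (by linarith) hδ hη
  rw [← hcard'] at htp e₁ e₃ e₄ e₅ hκ
  exact le_measureReal_isRegular ⟨hr, hqr, hB₀, hB₀g, hfull⟩ hg hS hreg' (p := ⟨_, hp⟩) hstep
    (by omega) t htp hκ hΛ hδd rfl hα₀.le hδ0 hD1 hβ e₁ e₂ e₃ e₄ e₅ e₆

end Main

end Proof

end HighGirth

theorem mainTheorem10 (q r C g : ℕ) (hr : 1 ≤ r) (hqr : r < q) (hC : 1 ≤ C) (hg : 3 ≤ g)
    (α : ℝ) (hα₀ : 0 < α) (hα : α < 1 / (2 * ((q : ℝ) - r)))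
    (m : ℕ) (B₀ : RootedBooster (Fin m)) (hB₀ : B₀.IsRootedBooster q r)
    (hB₀g : (g : ℕ∞) ≤ B₀.rootedGirth q r) :
    ∃ a₂ : ℕ, 1 ≤ a₂ ∧ ∀ a : ℕ, a₂ ≤ a → ∃ n₂ : ℕ, 1 ≤ n₂ ∧ ∀ n : ℕ, n₂ ≤ n →
      ∀ (A X : Set (Set (Fin n))) (𝓗 : Set (Set (Set (Fin n))))
        (𝓑 : Set (Set (Fin n)) → Set (RootedBooster (Fin n))),
        IsSponge q r (complete r Set.univ) A X 𝓗 →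
        IsSpongeRegular q r (complete r Set.univ) A X α g →
        IsSpongeBounded r X (g * a) →
        IsSpongeRefined r A X 𝓗 C →
        IsFull q r B₀ (complete r Set.univ) A X 𝓗 𝓑 →
        ∃ hp : Real.log n ^ a / (n.choose (B₀.verts.ncard - q) : ℝ) ∈ unitInterval,
          9 / 10 ≤ (sparsification 𝓗 𝓑 ⟨_, hp⟩).real
            {ω | (projTreasury q r g (complete r Set.univ) A X 𝓗 (restrict 𝓑 ω)).IsRegular g
              (n.choose (q - r)) (2 * α * n.choose (q - r))
              (1 / (4 * g * ((q : ℝ) - r))) (2 * α)} := by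
  refine ⟨2 * g + 1, by omega, fun a ha => ?_⟩
  obtain ⟨n₂, h⟩ := Filter.eventually_atTop.1
    (eventually_isRegular q r C g hr hqr hg α hα₀ hα m B₀ hB₀ hB₀g a ha)
  exact ⟨max n₂ 1, le_max_right _ _, fun n hn => h n ((le_max_left _ _).trans hn)⟩
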